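/- Let $B\ge 1$, let $P_0=\sum_i p_i\,\delta(\mathbf a_i)$ be a probability distribution on $\mathbb R^B$ with finitely many atoms, and let $\alpha>0$, $\Delta>0$. The signal $\mathbf S\in\mathbb R^{N}$, $N=LB$, consists of $L$ i.i.d. sections in $\mathbb R^B$ with law $P_0$. One observes $\mathbf Y=\Phi\mathbf S+\sqrt\Delta\,\mathbf Z\in\mathbb R^M$, where $\mathbf Z\sim\mathcal N(0,\mathbf I_M)$, where $\Phi\in\mathbb R^{M\times N}$ is a known Gaussian matrix with independent centred entries, and where $\mathbf S,\Phi,\mathbf Z$ are independent. The mutual information (MI) per section is $\frac1L\mathbb E\big[\ln\frac{P(\mathbf S,\mathbf Y)}{P_0(\mathbf S)P(\mathbf Y)}\big]$, where all probabilities are conditional on $\Phi$. In every model below $L\to\infty$ with $M/N\to\alpha$ (and no limit depends on the choice of $M$ as a function of $L$). * CS model: all entries of $\Phi$ have variance $1/L$. Its MI per section is $i^{\rm cs}$. * Coupled models: $\Phi$ consists of $\Gamma\times\Gamma$ blocks, each with $M/\Gamma$ rows and the columns of $L/\Gamma$ sections ($\Gamma$ divides $L$ and $M$), and the entries in the block $(r,c)$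 have variance $J_{r,c}/L$. * Periodic coupled model with window $w$, $2w+1\le\Gamma$: $J_{r,c}=\Gamma/(2w+1)$ if $|r-c|\le w$ modulo $\Gamma$, and $J_{r,c}=0$ otherwise. Its MI per section is $i^{\rm per}_{\Gamma,w}$. * Seeded coupled model with window $w$, $2w+1\le\Gamma$, and a boundary of width $K$ (a number independent of $\Gamma$): $J_{r,c}=0$ if $|r-c|>w$ (without periodicity); if $|r-c|\le w$, then $J_{r,c}=\Gamma/(2w+1)$ for all rows $r$ at distance at least $K$ from both ends ($K<r\le\Gamma-K$), and $\Gamma/(2w+1)\le J_{r,c}\le K\,\Gamma/(2w+1)$ in general. Moreover the sections in the blocks of a set $\mathcal B=\mathcal B_\Gamma\subseteq\{1,\dots,K\}\cup\{\Gamma-K+1,\dots,\Gamma\}$ are known to the observer. Its MI per section $i^{\rm seed}_{\Gamma,w}$ is the one above, with all probabilities conditional also on the known sections (still divided by $L$). Then the limit $\lim_{L\to\infty} i^{\rm cs}$ exists and is finite. For all $\Gamma\ge1$ and all integers $w$ with $0\le w\le(\Gamma-1)/2$, the limit $\lim_{L\to\infty} i^{\rm per}_{\Gamma,w}$ exists and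 $$\lim_{L\to\infty} i^{\rm per}_{\Gamma,w}=\lim_{L\to\infty} i^{\rm cs}.$$ Moreover, for all fixed $w$ and $K$ and every choice, for each $\Gamma\ge 2w+1$, of a variance matrix $J$ and of a set $\mathcal B_\Gamma$ as in the description of the seeded model, the limit $\lim_{L\to\infty} i^{\rm seed}_{\Gamma,w}$ exists for every $\Gamma\ge 2w+1$, and $$\lim_{\Gamma\to\infty}\lim_{L\to\infty} i^{\rm seed}_{\Gamma,w}=\lim_{L\to\infty} i^{\rm cs}.$$ -/

import Mathlib

open Filter Topology MeasureTheory ProbabilityTheory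
open scoped NNReal

/-- A discrete prior `P₀ = ∑ᵢ pᵢ δ(aᵢ)` on `ℝ^B` with finitely many atoms. -/
structure DiscretePrior (B : ℕ) where
  /-- number of atoms -/
  n : ℕ
  /-- the weights `pᵢ` -/
  weight : Fin n → ℝ
  /-- the atoms `aᵢ` -/
  atom : Fin n → Fin B → ℝ
  weight_nonneg : ∀ i, 0 ≤ weight i
  weight_sum : ∑ i, weight i = 1

noncomputable section

namespace LinearEstimation

/- In this section the `M` measurements are indexed by `R` and the `L` sections of the signal by
`C`. A signal is encoded by `s : C → Fin P₀.n`: its section `l` is the atom number `s l`. A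
measurement matrix is `φ : R → C → Fin B → ℝ`, where `φ μ l b` is the entry in row `μ` and in the
column of the component `b` of section `l`. -/

variable {R C : Type} [Fintype R] [Fintype C] {B : ℕ}

/-- The probability `P₀(s) = ∏ₗ P₀(sₗ)` of a signal with i.i.d. sections. -/
def priorProb (P₀ : DiscretePrior B) (s : C → Fin P₀.n) : ℝ :=
  ∏ l, P₀.weight (s l)

/-- The noiseless measurement `[φ s]_μ`. -/
def measurement (P₀ : DiscretePrior B) (φ : R → C → Fin B → ℝ) (s : C → Fin P₀.n) (μ : R) : ℝ :=
  ∑ l, ∑ b, φ μ l b * P₀.atom (s l) b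

/-- The observation `y = φ s + z √Δ`. -/
def observation (P₀ : DiscretePrior B) (Δ : ℝ) (φ : R → C → Fin B → ℝ) (s : C → Fin P₀.n)
    (z : R → ℝ) (μ : R) : ℝ :=
  measurement P₀ φ s μ + z μ * √Δ

/-- The density `P(y | s)` of the observation given the signal (and the matrix). -/
def likelihood (P₀ : DiscretePrior B) (Δ : ℝ) (φ : R → C → Fin B → ℝ) (y : R → ℝ)
    (s : C → Fin P₀.n) : ℝ :=
  (√(2 * Real.pi * Δ) ^ Fintype.card R)⁻¹ *
    Real.exp (-(1 / (2 * Δ)) * ∑ μ, (y μ - measurement P₀ φ s μ) ^ 2)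

/-- The signal that coincides with `s` on the sections in `known` and with `x` elsewhere. -/
def pin [DecidableEq C] {n : ℕ} (known : Finset C) (s x : C → Fin n) (l : C) : Fin n :=
  if l ∈ known then s l else x l

/-- The density of the observation `y` (given the matrix) when the sections of `s` in `known` are
revealed and the other sections are distributed according to the prior. For `known = ∅` this is
`P(y) = ∑ₓ P₀(x) P(y | x)`. -/
def evidence [DecidableEq C] (P₀ : DiscretePrior B) (Δ : ℝ) (known : Finset C)
    (φ : R → C → Fin B → ℝ) (y : R → ℝ) (s : C → Fin P₀.n) : ℝ :=
  ∑ x : C → Fin P₀.n, priorProb P₀ x * likelihood P₀ Δ φ y (pin known s x)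

/-- The law of a measurement matrix with independent entries `φ μ l b ∼ 𝒩(0, V μ l)`. -/
def matrixLaw (B : ℕ) (V : R → C → ℝ≥0) : Measure (R → C → Fin B → ℝ) :=
  Measure.pi fun μ => Measure.pi fun l => Measure.pi fun _ : Fin B => gaussianReal 0 (V μ l)

/-- The law of the standard Gaussian noise `z`. -/
def noiseLaw (R : Type) [Fintype R] : Measure (R → ℝ) :=
  Measure.pi fun _ => gaussianReal 0 1

/-- The mutual information per section
`(1/L) 𝔼 [ln (P(S, Y) / (P₀(S) P(Y)))] = (1/L) 𝔼 [ln (P(Y | S) / P(Y))]`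
between the signal and the observation, the expectation being over the signal, the matrix and the
noise; the matrix is known to the observer, and so are the sections of the signal in `known` (thus
all the probabilities in the ratio are conditional on the matrix and on the known sections). -/
def mutualInfo [DecidableEq C] (P₀ : DiscretePrior B) (Δ : ℝ) (V : R → C → ℝ≥0)
    (known : Finset C) : ℝ :=
  (1 / (Fintype.card C : ℝ)) * ∑ s : C → Fin P₀.n, priorProb P₀ s *
    ∫ q : (R → C → Fin B → ℝ) × (R → ℝ),
      Real.log (likelihood P₀ Δ q.1 (observation P₀ Δ q.1 s q.2) s /
        evidence P₀ Δ known q.1 (observation P₀ Δ q.1 s q.2) s)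
      ∂((matrixLaw B V).prod (noiseLaw R))

/-- `i^cs`: the mutual information per section of the CS model with `L` sections and `M`
measurements, whose matrix has i.i.d. `𝒩(0, 1/L)` entries. -/
def csMI (P₀ : DiscretePrior B) (Δ : ℝ) (L M : ℕ) : ℝ :=
  mutualInfo P₀ Δ (fun (_ : Fin M) (_ : Fin L) => 1 / (L : ℝ≥0)) ∅

/-- The mutual information per section of the model whose matrix is made of `Γ × Γ` blocks, each
with `m` rows and the columns of `ℓ` sections (`L = Γ ℓ` sections and `M = Γ m` measurements in
all), with independent `𝒩(0, J r c / L)` entries in the block `(r, c)`, and in which the sections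
in the blocks of `seed` are known. -/
def blockMI (P₀ : DiscretePrior B) (Δ : ℝ) {Γ : ℕ} (J : Fin Γ → Fin Γ → ℝ≥0)
    (seed : Finset (Fin Γ)) (ℓ m : ℕ) : ℝ :=
  mutualInfo P₀ Δ
    (fun (μ : Fin Γ × Fin m) (l : Fin Γ × Fin ℓ) => J μ.1 l.1 / ((Γ : ℝ≥0) * (ℓ : ℝ≥0)))
    (seed ×ˢ Finset.univ)

/-- The variances of the periodic coupled matrix: `Γ / (2 w + 1)` if `|r - c| ≤ w` modulo `Γ`, and
`0` otherwise (the subtraction of `Fin Γ` is the one modulo `Γ`). -/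
def periodicVariance (Γ w : ℕ) (r c : Fin Γ) : ℝ≥0 :=
  if (r - c).val ≤ w ∨ (c - r).val ≤ w then (Γ : ℝ≥0) / (2 * w + 1) else 0

/-- `i^per_{Γ,w}`, with `L = Γ ℓ` sections and `M = Γ m` measurements. -/
def periodicMI (P₀ : DiscretePrior B) (Δ : ℝ) (Γ w ℓ m : ℕ) : ℝ :=
  blockMI P₀ Δ (periodicVariance Γ w) ∅ ℓ m

/-- `J` is the variance matrix of an opened coupled matrix with window `w`, and `seed` a seed for
it, where the boundary is made of the blocks at distance less than `K` from an end and the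
variances are at most `K` times those of the bulk. -/
structure IsSeededDesign (w K : ℕ) {Γ : ℕ} (J : Fin Γ → Fin Γ → ℝ≥0)
    (seed : Finset (Fin Γ)) : Prop where
  /-- no coupling outside of the window, which does not wrap around -/
  outside : ∀ r c : Fin Γ, ¬ (r.val ≤ c.val + w ∧ c.val ≤ r.val + w) → J r c = 0
  /-- in the bulk, the variances inside the window are those of the periodic matrix -/
  bulk : ∀ r c : Fin Γ, r.val ≤ c.val + w → c.val ≤ r.val + w → K ≤ r.val → r.val + K < Γ →
    J r c = (Γ : ℝ≥0) / (2 * w + 1)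
  /-- at the boundary, the variances inside the window are at least as large -/
  stronger : ∀ r c : Fin Γ, r.val ≤ c.val + w → c.val ≤ r.val + w →
    (Γ : ℝ≥0) / (2 * w + 1) ≤ J r c
  bounded : ∀ r c : Fin Γ, J r c ≤ K * ((Γ : ℝ≥0) / (2 * w + 1))
  /-- the seed lies at the boundary -/
  seed_boundary : ∀ c ∈ seed, c.val < K ∨ Γ ≤ c.val + K

end LinearEstimation

end

open LinearEstimation

set_option linter.unusedSectionVars false

noncomputable section

namespace LinearEstimation

section Experiments

variable {X : Type} [Fintype X]

/-- The total mass of a finite measure on a finite type. -/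
def mass (p : X → ℝ≥0) : ℝ := ∑ x, (p x : ℝ)

lemma mass_nonneg (p : X → ℝ≥0) : 0 ≤ mass p := Finset.sum_nonneg fun _ _ => NNReal.coe_nonneg _

lemma measurable_mass : Measurable (mass : (X → ℝ≥0) → ℝ) := by
  unfold mass
  fun_prop

variable (X) in
/-- The measurable functionals of a finite measure that are bounded by a multiple of the mass. -/
def boundedFunctionals : Submodule ℝ ((X → ℝ≥0) → ℝ) where
  carrier := {f | Measurable f ∧ ∃ c, ∀ p, |f p| ≤ c * mass p}
  add_mem' := by
    rintro f g ⟨hf, c, hc⟩ ⟨hg, d, hd⟩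
    refine ⟨hf.add hg, c + d, fun p => ?_⟩
    rw [add_mul]
    exact (abs_add_le _ _).trans (add_le_add (hc p) (hd p))
  zero_mem' := ⟨measurable_const, 0, by simp⟩
  smul_mem' := by
    rintro a f ⟨hf, c, hc⟩
    refine ⟨hf.const_smul a, |a| * c, fun p => ?_⟩
    simp only [Pi.smul_apply, smul_eq_mul, abs_mul, mul_assoc]
    exact mul_le_mul_of_nonneg_left (hc p) (abs_nonneg a)

variable (X) in
/-- The type of the measurable functionals that are bounded by a multiple of the mass. -/
def Functional : Type := boundedFunctionals X

instance : AddCommGroup (Functional X) := inferInstanceAs (AddCommGroup (boundedFunctionals X))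
instance : Module ℝ (Functional X) := inferInstanceAs (Module ℝ (boundedFunctionals X))

instance : CoeFun (Functional X) fun _ => (X → ℝ≥0) → ℝ := ⟨fun f => f.1⟩

lemma measurable_functional (f : Functional X) : Measurable (f : (X → ℝ≥0) → ℝ) := f.2.1

@[ext] lemma Functional.ext {f g : Functional X} (h : ∀ p, f p = g p) : f = g :=
  Subtype.ext (funext h)

@[simp] lemma Functional.add_apply (f g : Functional X) (p : X → ℝ≥0) :
    (f + g) p = f p + g p := rfl
@[simp] lemma Functional.sub_apply (f g : Functional X) (p : X → ℝ≥0) :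
    (f - g) p = f p - g p := rfl
@[simp] lemma Functional.smul_apply (a : ℝ) (f : Functional X) (p : X → ℝ≥0) :
    (a • f) p = a * f p := rfl
@[simp] lemma Functional.zero_apply (p : X → ℝ≥0) : (0 : Functional X) p = 0 := rfl
@[simp] lemma Functional.sum_apply {ι : Type*} (s : Finset ι) (f : ι → Functional X)
    (p : X → ℝ≥0) : (∑ i ∈ s, f i) p = ∑ i ∈ s, f i p := by
  classical
  induction s using Finset.induction_on with
  | empty => simp
  | insert a s ha ih => rw [Finset.sum_insert ha, Finset.sum_insert ha, Functional.add_apply, ih]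

variable (X) in
/-- The total mass, as a functional. -/
def massF : Functional X :=
  ⟨mass, measurable_mass, 1, fun p => by rw [one_mul, abs_of_nonneg (mass_nonneg p)]⟩

variable (X) in
/-- A statistical experiment on a finite parameter space: a reference measure `law` on the space of
outcomes, and the density `ker ω x` of the outcome `ω` given the parameter `x`. -/
structure Experiment where
  /-- the outcomes -/
  Ω : Type
  [mΩ : MeasurableSpace Ω]
  /-- the reference measure -/
  law : Measure Ω
  [sfinite : SFinite law]
  /-- the densities -/
  ker : Ω → X → ℝ≥0
  measurable_ker : Measurable ker
  lintegral_ker : ∀ x, ∫⁻ ω, ker ω x ∂law = 1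

namespace Experiment

instance (E : Experiment X) : MeasurableSpace E.Ω := E.mΩ
instance (E : Experiment X) : SFinite E.law := E.sfinite

omit [Fintype X] in
lemma measurable_ker_apply (E : Experiment X) (x : X) : Measurable fun ω => E.ker ω x :=
  (measurable_pi_apply x).comp E.measurable_ker

lemma integrable_ker (E : Experiment X) (x : X) : Integrable (fun ω => (E.ker ω x : ℝ)) E.law := by
  refine ⟨(E.measurable_ker_apply x).coe_nnreal_real.aestronglyMeasurable, ?_⟩
  rw [hasFiniteIntegral_iff_enorm]
  simp only [Real.enorm_eq_ofReal (NNReal.coe_nonneg _), ENNReal.ofReal_coe_nnreal,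
    E.lintegral_ker x]
  exact ENNReal.one_lt_top

lemma integral_ker (E : Experiment X) (x : X) : ∫ ω, (E.ker ω x : ℝ) ∂E.law = 1 := by
  rw [integral_eq_lintegral_of_nonneg_ae (ae_of_all _ fun _ => NNReal.coe_nonneg _)
    (E.measurable_ker_apply x).coe_nnreal_real.aestronglyMeasurable]
  simp only [ENNReal.ofReal_coe_nnreal, E.lintegral_ker x, ENNReal.toReal_one]

lemma integrable_mass (E : Experiment X) (p : X → ℝ≥0) :
    Integrable (fun ω => mass (E.ker ω * p)) E.law := by
  unfold mass
  refine integrable_finsetSum _ fun x _ => ?_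
  simpa using (E.integrable_ker x).mul_const (p x : ℝ)

lemma integral_mass (E : Experiment X) (p : X → ℝ≥0) :
    ∫ ω, mass (E.ker ω * p) ∂E.law = mass p := by
  unfold mass
  rw [integral_finsetSum _ fun x _ => by simpa using (E.integrable_ker x).mul_const (p x : ℝ)]
  simp [integral_mul_const, E.integral_ker]

lemma measurable_ker_mul (E : Experiment X) :
    Measurable fun z : (X → ℝ≥0) × E.Ω => E.ker z.2 * z.1 := by
  refine measurable_pi_lambda _ fun x => ?_
  exact ((E.measurable_ker_apply x).comp measurable_snd).mul
    ((measurable_pi_apply x).comp measurable_fst)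

lemma integrable (E : Experiment X) (f : Functional X) (p : X → ℝ≥0) :
    Integrable (fun ω => f (E.ker ω * p)) E.law := by
  obtain ⟨c, hc⟩ := f.2.2
  refine ((E.integrable_mass p).const_mul c).mono' ?_ (ae_of_all _ fun ω => hc _)
  exact ((measurable_functional f).comp (E.measurable_ker_mul.comp measurable_prodMk_left)).aestronglyMeasurable

/-- The expectation of a functional of the (unnormalised) posterior. -/
def op (E : Experiment X) : Module.End ℝ (Functional X) where
  toFun f := ⟨fun p => ∫ ω, f (E.ker ω * p) ∂E.law, by
    refine ⟨?_, ?_⟩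
    · have : StronglyMeasurable fun z : (X → ℝ≥0) × E.Ω => f (E.ker z.2 * z.1) :=
        ((measurable_functional f).comp E.measurable_ker_mul).stronglyMeasurable
      exact this.integral_prod_right.measurable
    · obtain ⟨c, hc⟩ := f.2.2
      refine ⟨c, fun p => ?_⟩
      refine (abs_integral_le_integral_abs).trans ?_
      rw [← E.integral_mass p, ← integral_const_mul]
      exact integral_mono (E.integrable f p).abs ((E.integrable_mass p).const_mul c)
        fun ω => hc _⟩
  map_add' f g := by
    ext p
    exact integral_add (E.integrable f p) (E.integrable g p)
  map_smul' a f := by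
    ext p
    exact integral_const_mul a _

lemma op_apply (E : Experiment X) (f : Functional X) (p : X → ℝ≥0) :
    E.op f p = ∫ ω, f (E.ker ω * p) ∂E.law := rfl

/-- The experiment that consists of two experiments, independent given the parameter. -/
def prod (E E' : Experiment X) : Experiment X where
  Ω := E.Ω × E'.Ω
  law := E.law.prod E'.law
  ker z := E.ker z.1 * E'.ker z.2
  measurable_ker := by
    refine measurable_pi_lambda _ fun x => ?_
    exact ((E.measurable_ker_apply x).comp measurable_fst).mul
      ((E'.measurable_ker_apply x).comp measurable_snd)
  lintegral_ker x := by
    simp only [Pi.mul_apply, ENNReal.coe_mul]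
    rw [lintegral_prod_mul (E.measurable_ker_apply x).coe_nnreal_ennreal.aemeasurable
      (E'.measurable_ker_apply x).coe_nnreal_ennreal.aemeasurable, E.lintegral_ker,
      E'.lintegral_ker, one_mul]

lemma op_prod (E E' : Experiment X) : (E.prod E').op = E.op * E'.op := by
  ext f p
  rw [op_apply]
  have h := (E.prod E').integrable f p
  refine (integral_prod_symm _ h).trans ?_
  rw [integral_integral_swap (f := fun y x => f ((E.prod E').ker (x, y) * p)) h.swap]
  simp only [Module.End.mul_apply, op_apply]
  refine integral_congr_ae (ae_of_all _ fun ω => integral_congr_ae (ae_of_all _ fun ω' => ?_))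
  simp only [prod]
  rw [mul_assoc, mul_left_comm]

lemma op_comm (E E' : Experiment X) : E.op * E'.op = E'.op * E.op := by
  ext f p
  rw [← op_prod, op_apply]
  refine (integral_prod_symm _ ((E.prod E').integrable f p)).trans ?_
  simp only [Module.End.mul_apply, op_apply]
  refine integral_congr_ae (ae_of_all _ fun ω => integral_congr_ae (ae_of_all _ fun ω' => ?_))
  simp only [prod]
  rw [mul_assoc]

end Experiment

variable (X) in
/-- The algebra generated by the expectation operators of the experiments. -/
def opAlgebra : Subalgebra ℝ (Module.End ℝ (Functional X)) :=
  Algebra.adjoin ℝ (Set.range (Experiment.op (X := X)))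

instance : IsMulCommutative (opAlgebra X) :=
  Algebra.isMulCommutative_adjoin ℝ (by
    rintro _ ⟨E, rfl⟩ _ ⟨E', rfl⟩
    exact E.op_comm E')

variable (X) in
/-- The commutative algebra generated by the expectation operators of the experiments. -/
def Ops : Type := opAlgebra X

open scoped IsMulCommutative in
instance : CommRing (Ops X) := inferInstanceAs (CommRing (opAlgebra X))
instance : Algebra ℝ (Ops X) := inferInstanceAs (Algebra ℝ (opAlgebra X))

/-- The expectation operator of an experiment. -/
def Experiment.expect (E : Experiment X) : Ops X := ⟨E.op, Algebra.subset_adjoin ⟨E, rfl⟩⟩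

instance : CoeFun (Ops X) fun _ => Functional X → Functional X := ⟨fun T f => T.1 f⟩

namespace Ops

lemma expect_apply (E : Experiment X) (f : Functional X) (p : X → ℝ≥0) :
    E.expect f p = ∫ ω, f (E.ker ω * p) ∂E.law := rfl
lemma mul_apply (S T : Ops X) (f : Functional X) : (S * T) f = S (T f) := rfl
lemma one_apply (f : Functional X) : (1 : Ops X) f = f := rfl
lemma add_apply (S T : Ops X) (f : Functional X) : (S + T) f = S f + T f := rfl
lemma sub_apply (S T : Ops X) (f : Functional X) : (S - T) f = S f - T f := rfl
lemma smul_apply (a : ℝ) (T : Ops X) (f : Functional X) : (a • T) f = a • T f := rfl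
lemma map_add (T : Ops X) (f g : Functional X) : T (f + g) = T f + T g := T.1.map_add f g
lemma map_sub (T : Ops X) (f g : Functional X) : T (f - g) = T f - T g := T.1.map_sub f g
lemma map_smul (T : Ops X) (a : ℝ) (f : Functional X) : T (a • f) = a • T f := T.1.map_smul a f
lemma map_sum {ι : Type*} (T : Ops X) (s : Finset ι) (f : ι → Functional X) :
    T (∑ i ∈ s, f i) = ∑ i ∈ s, T (f i) := _root_.map_sum T.1 f s
lemma sum_apply {ι : Type*} (s : Finset ι) (T : ι → Ops X) (f : Functional X) :
    (∑ i ∈ s, T i) f = ∑ i ∈ s, T i f := by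
  classical
  induction s using Finset.induction_on with
  | empty => simp; rfl
  | insert a s ha ih => rw [Finset.sum_insert ha, Finset.sum_insert ha, add_apply, ih]

/-- An operator is Markov if it preserves positivity and the mass. -/
structure IsMarkov (T : Ops X) : Prop where
  nonneg : ∀ f : Functional X, (∀ p, 0 ≤ f p) → ∀ p, 0 ≤ T f p
  mass : T (massF X) = massF X

lemma IsMarkov.mono {T : Ops X} (hT : T.IsMarkov) {f g : Functional X} (h : ∀ p, f p ≤ g p)
    (p : X → ℝ≥0) : T f p ≤ T g p := by
  have := hT.nonneg (g - f) (fun p => by simpa using h p) p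
  rw [map_sub, Functional.sub_apply] at this
  linarith

lemma IsMarkov.smul_mass {T : Ops X} (hT : T.IsMarkov) (c : ℝ) (p : X → ℝ≥0) :
    T (c • massF X) p = c * LinearEstimation.mass p := by
  rw [map_smul, hT.mass]; rfl

lemma isMarkov_one : (1 : Ops X).IsMarkov := ⟨fun _ h => h, rfl⟩

lemma IsMarkov.mul {S T : Ops X} (hS : S.IsMarkov) (hT : T.IsMarkov) : (S * T).IsMarkov :=
  ⟨fun f hf => hS.nonneg _ (hT.nonneg f hf), by rw [mul_apply, hT.mass, hS.mass]⟩

lemma IsMarkov.pow {T : Ops X} (hT : T.IsMarkov) (k : ℕ) : (T ^ k).IsMarkov := by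
  induction k with
  | zero => rw [pow_zero]; exact isMarkov_one
  | succ k ih => rw [pow_succ]; exact ih.mul hT

lemma isMarkov_prod {ι : Type*} {s : Finset ι} {T : ι → Ops X} (h : ∀ i ∈ s, (T i).IsMarkov) :
    (∏ i ∈ s, T i).IsMarkov := by
  classical
  induction s using Finset.induction_on with
  | empty => rw [Finset.prod_empty]; exact isMarkov_one
  | insert a s ha ih =>
    rw [Finset.prod_insert ha]
    exact (h a (Finset.mem_insert_self a s)).mul
      (ih fun i hi => h i (Finset.mem_insert_of_mem hi))

lemma isMarkov_sum {ι : Type*} {s : Finset ι} {w : ι → ℝ} {T : ι → Ops X}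
    (hw : ∀ i ∈ s, 0 ≤ w i) (hw1 : ∑ i ∈ s, w i = 1) (h : ∀ i ∈ s, (T i).IsMarkov) :
    (∑ i ∈ s, w i • T i).IsMarkov := by
  refine ⟨fun f hf p => ?_, ?_⟩
  · rw [sum_apply, Functional.sum_apply]
    exact Finset.sum_nonneg fun i hi => mul_nonneg (hw i hi) ((h i hi).nonneg f hf p)
  · have : ∀ i ∈ s, (w i • T i) (massF X) = w i • massF X := fun i hi => by
      rw [smul_apply, (h i hi).mass]
    rw [sum_apply, Finset.sum_congr rfl this, ← Finset.sum_smul, hw1, one_smul]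

lemma isMarkov_expect (E : Experiment X) : E.expect.IsMarkov :=
  ⟨fun _ hf _ => integral_nonneg fun _ => hf _, by
    ext p
    exact E.integral_mass p⟩

end Ops

end Experiments

end LinearEstimation

end

noncomputable section

namespace LinearEstimation

section Entropy

variable {X Y : Type} [Fintype X] [Fintype Y] [DecidableEq Y]

/-- The Shannon entropy of a finite measure, normalised to be homogeneous of degree one. -/
def entropy (p : X → ℝ≥0) : ℝ := ∑ x, (p x : ℝ) * Real.log (mass p / p x)

lemma measurable_entropy : Measurable (entropy : (X → ℝ≥0) → ℝ) := by
  unfold entropy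
  refine Finset.measurable_sum _ fun x _ => ?_
  exact (measurable_pi_apply x).coe_nnreal_real.mul
    (Real.measurable_log.comp (measurable_mass.div (measurable_pi_apply x).coe_nnreal_real))

lemma le_mass (p : X → ℝ≥0) (x : X) : (p x : ℝ) ≤ mass p :=
  Finset.single_le_sum (f := fun x => (p x : ℝ)) (fun _ _ => NNReal.coe_nonneg _)
    (Finset.mem_univ x)

lemma entropy_nonneg (p : X → ℝ≥0) : 0 ≤ entropy p := by
  refine Finset.sum_nonneg fun x _ => ?_
  rcases eq_or_lt_of_le (NNReal.coe_nonneg (p x)) with h | h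
  · rw [← h, zero_mul]
  · exact mul_nonneg h.le (Real.log_nonneg ((one_le_div h).2 (le_mass p x)))

/-- Gibbs' inequality. -/
lemma entropy_le_of_sum_le_one (p : X → ℝ≥0) (r : X → ℝ) (hr : ∀ x, 0 ≤ r x)
    (hpr : ∀ x, 0 < p x → 0 < r x) (hsum : ∑ x, r x ≤ 1) :
    entropy p ≤ ∑ x, (p x : ℝ) * -Real.log (r x) := by
  have key : ∀ x, (p x : ℝ) * Real.log (mass p / p x) - p x * -Real.log (r x)
      ≤ mass p * r x - p x := by
    intro x
    rcases eq_or_lt_of_le (NNReal.coe_nonneg (p x)) with h | h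
    · rw [← h]
      simpa using mul_nonneg (mass_nonneg p) (hr x)
    · have hP : 0 < mass p := h.trans_le (le_mass p x)
      have hrx := hpr x (by exact_mod_cast h)
      have h1 := Real.log_le_sub_one_of_pos (show 0 < mass p / p x * r x by positivity)
      rw [Real.log_mul (by positivity) hrx.ne'] at h1
      have h2 := mul_le_mul_of_nonneg_left h1 h.le
      have h3 : (p x : ℝ) * (mass p / p x * r x - 1) = mass p * r x - p x := by field_simp
      linarith
  have h1 := Finset.sum_le_sum fun x (_ : x ∈ Finset.univ) => key x
  simp only [Finset.sum_sub_distrib, ← Finset.mul_sum] at h1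
  have h2 : mass p * ∑ x, r x ≤ mass p * 1 := mul_le_mul_of_nonneg_left hsum (mass_nonneg p)
  have h3 : ∑ x, (p x : ℝ) = mass p := rfl
  unfold entropy
  linarith

lemma entropy_le (p : X → ℝ≥0) : entropy p ≤ Real.log (Fintype.card X) * mass p := by
  rcases isEmpty_or_nonempty X with hX | hX
  · simp [entropy, mass]
  · have hc : (0 : ℝ) < Fintype.card X := by exact_mod_cast Fintype.card_pos
    refine (entropy_le_of_sum_le_one p (fun _ => (Fintype.card X : ℝ)⁻¹) (fun _ => by positivity)
      (fun _ _ => by positivity) ?_).trans (le_of_eq ?_)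
    · rw [Finset.sum_const, nsmul_eq_mul, Finset.card_univ]
      exact (mul_inv_cancel₀ hc.ne').le
    · rw [← Finset.sum_mul, Real.log_inv, neg_neg, mul_comm]; rfl

/-- The image of a finite measure. -/
def marginal (f : X → Y) (p : X → ℝ≥0) (y : Y) : ℝ≥0 := ∑ x, if f x = y then p x else 0

lemma sum_marginal_mul (f : X → Y) (p : X → ℝ≥0) (h : Y → ℝ) :
    ∑ y, (marginal f p y : ℝ) * h y = ∑ x, (p x : ℝ) * h (f x) := by
  simp only [marginal, NNReal.coe_sum, Finset.sum_mul]
  rw [Finset.sum_comm]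
  refine Finset.sum_congr rfl fun x _ => ?_
  rw [Finset.sum_eq_single (f x)]
  · simp
  · intro y _ hy
    simp [Ne.symm hy]
  · simp

lemma mass_marginal (f : X → Y) (p : X → ℝ≥0) : mass (marginal f p) = mass p := by
  simpa [mass] using sum_marginal_mul f p 1

lemma le_marginal (f : X → Y) (p : X → ℝ≥0) (x : X) : p x ≤ marginal f p (f x) := by
  refine le_trans (le_of_eq ?_) (Finset.single_le_sum
    (f := fun x' => if f x' = f x then p x' else 0) (fun _ _ => zero_le) (Finset.mem_univ x))
  simp

omit [Fintype Y] in
lemma measurable_marginal (f : X → Y) : Measurable (marginal f) := by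
  refine measurable_pi_lambda _ fun y => Finset.measurable_sum _ fun x _ => ?_
  split_ifs
  · exact measurable_pi_apply x
  · exact measurable_const

lemma entropy_marginal (f : X → Y) (p : X → ℝ≥0) :
    entropy (marginal f p) = ∑ x, (p x : ℝ) * Real.log (mass p / marginal f p (f x)) := by
  rw [entropy, mass_marginal]
  exact sum_marginal_mul f p fun y => Real.log (mass p / marginal f p y)

/-- The entropy of an image of the measure. -/
def marginalEntropy (f : X → Y) : Functional X :=
  ⟨fun p => entropy (marginal f p), measurable_entropy.comp (measurable_marginal f),
    Real.log (Fintype.card Y), fun p => by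
      rw [abs_of_nonneg (entropy_nonneg _), ← mass_marginal f p]
      exact entropy_le _⟩

lemma marginalEntropy_apply (f : X → Y) (p : X → ℝ≥0) :
    marginalEntropy f p = entropy (marginal f p) := rfl

lemma marginalEntropy_nonneg (f : X → Y) (p : X → ℝ≥0) : 0 ≤ marginalEntropy f p :=
  entropy_nonneg _

lemma marginalEntropy_le (f : X → Y) (p : X → ℝ≥0) :
    marginalEntropy f p ≤ Real.log (Fintype.card Y) * mass p := by
  rw [← mass_marginal f p]
  exact entropy_le _

variable (X) in
/-- The entropy, as a functional. -/
def entropyF : Functional X :=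
  ⟨entropy, measurable_entropy, Real.log (Fintype.card X), fun p => by
    rw [abs_of_nonneg (entropy_nonneg _)]
    exact entropy_le _⟩

@[simp] lemma entropyF_apply (p : X → ℝ≥0) : entropyF X p = entropy p := rfl

/-- The data processing inequality. -/
lemma expect_marginalEntropy_le (E : Experiment X) (f : X → Y) (p : X → ℝ≥0) :
    E.expect (marginalEntropy f) p ≤ marginalEntropy f p := by
  have h1 : ∀ ω, marginalEntropy f (E.ker ω * p)
      ≤ ∑ x, (E.ker ω x : ℝ) * (p x * Real.log (mass p / marginal f p (f x))) := by
    intro ω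
    have hpos : ∀ y, 0 < marginal f (E.ker ω * p) y → 0 < marginal f p y := by
      intro y hy
      by_contra h0
      have h0 : marginal f p y = 0 := by simpa using h0
      refine hy.ne' (Finset.sum_eq_zero fun x _ => ?_)
      split_ifs with hx
      · have : p x = 0 := le_antisymm (by rw [← h0, ← hx]; exact le_marginal f p x) zero_le
        simp [this]
      · rfl
    rcases eq_or_lt_of_le (mass_nonneg p) with hP | hP
    · have hp : p = 0 := by
        funext x
        have := (le_mass p x).trans_eq hP.symm
        exact_mod_cast le_antisymm this (NNReal.coe_nonneg _)
      subst hp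
      simp [marginalEntropy_apply, entropy, marginal]
    · have hmP : ∀ y, (0:ℝ) ≤ marginal f p y / mass p := fun y => by positivity
      refine (entropy_le_of_sum_le_one _ (fun y => marginal f p y / mass p) hmP ?_ ?_).trans_eq ?_
      · intro y hy
        have := hpos y hy
        have : (0 : ℝ) < marginal f p y := by exact_mod_cast this
        positivity
      · rw [← Finset.sum_div, show ∑ y, (marginal f p y : ℝ) = mass (marginal f p) from rfl,
          mass_marginal, div_self hP.ne']
      · rw [sum_marginal_mul f _ fun y => -Real.log (marginal f p y / mass p)]
        refine Finset.sum_congr rfl fun x _ => ?_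
        rw [← Real.log_inv, inv_div]
        simp [mul_assoc]
  refine (integral_mono (E.integrable _ p) ?_ h1).trans_eq ?_
  · exact integrable_finsetSum _ fun x _ => (E.integrable_ker x).mul_const _
  · rw [integral_finsetSum _ fun x _ => (E.integrable_ker x).mul_const _]
    simp only [integral_mul_const, E.integral_ker, one_mul]
    rw [marginalEntropy_apply, entropy_marginal]

lemma marginal_id [DecidableEq X] (p : X → ℝ≥0) : marginal id p = p := by
  funext y
  simp [marginal]

lemma expect_entropyF_le (E : Experiment X) (p : X → ℝ≥0) :
    E.expect (entropyF X) p ≤ entropy p := by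
  classical
  have : entropyF X = marginalEntropy id := by
    ext p
    rw [marginalEntropy_apply, marginal_id]; rfl
  rw [this]
  refine (expect_marginalEntropy_le E id p).trans_eq ?_
  rw [marginalEntropy_apply, marginal_id]

/-- Subadditivity of the entropy. -/
lemma entropy_le_sum_marginalEntropy {ι : Type} [Fintype ι] {Z : ι → Type} [∀ i, Fintype (Z i)]
    [∀ i, DecidableEq (Z i)] (f : ∀ i, X → Z i) (hf : Function.Injective fun x i => f i x)
    (p : X → ℝ≥0) : entropy p ≤ ∑ i, marginalEntropy (f i) p := by
  classical
  rcases eq_or_lt_of_le (mass_nonneg p) with hP | hP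
  · refine (entropy_le p).trans ?_
    rw [← hP, mul_zero]
    exact Finset.sum_nonneg fun i _ => marginalEntropy_nonneg _ _
  have hpos : ∀ x, 0 < p x → ∀ i, (0 : ℝ) < marginal (f i) p (f i x) / mass p := by
    intro x hx i
    have : (0 : ℝ) < marginal (f i) p (f i x) := by
      exact_mod_cast hx.trans_le (le_marginal (f i) p x)
    positivity
  refine (entropy_le_of_sum_le_one p (fun x => ∏ i, (marginal (f i) p (f i x) / mass p : ℝ))
    (fun x => Finset.prod_nonneg fun i _ => by positivity)
    (fun x hx => Finset.prod_pos fun i _ => hpos x hx i) ?_).trans_eq ?_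
  · calc ∑ x, ∏ i, (marginal (f i) p (f i x) / mass p : ℝ)
        = ∑ z ∈ Finset.univ.image (fun x i => f i x), ∏ i, (marginal (f i) p (z i) / mass p : ℝ) :=
          (Finset.sum_image (f := fun z : ∀ i, Z i => ∏ i, (marginal (f i) p (z i) / mass p : ℝ))
            fun _ _ _ _ h => hf h).symm
      _ ≤ ∑ z : ∀ i, Z i, ∏ i, (marginal (f i) p (z i) / mass p : ℝ) :=
          Finset.sum_le_sum_of_subset_of_nonneg (Finset.subset_univ _)
            fun z _ _ => Finset.prod_nonneg fun i _ => by positivity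
      _ = ∏ i, ∑ y, (marginal (f i) p y / mass p : ℝ) := by
          rw [Finset.prod_univ_sum]; simp
      _ = 1 := by
          refine Finset.prod_eq_one fun i _ => ?_
          rw [← Finset.sum_div, show ∑ y, (marginal (f i) p y : ℝ) = mass (marginal (f i) p)
            from rfl, mass_marginal, div_self hP.ne']
  · simp only [marginalEntropy_apply, entropy_marginal]
    rw [Finset.sum_comm]
    refine Finset.sum_congr rfl fun x _ => ?_
    rw [← Finset.mul_sum]
    rcases eq_or_lt_of_le (zero_le : 0 ≤ p x) with h | h
    · simp [← h]
    · rw [Real.log_prod (fun i _ => (hpos x h i).ne'), ← Finset.sum_neg_distrib]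
      simp only [← Real.log_inv, inv_div]

/-- The experiment that reveals a function of the parameter. -/
def reveal (f : X → Y) : Experiment X where
  Ω := Y
  mΩ := ⊤
  law := @Measure.count Y ⊤
  sfinite := by
    let _ : MeasurableSpace Y := ⊤
    infer_instance
  ker y x := if f x = y then 1 else 0
  measurable_ker := by
    let _ : MeasurableSpace Y := ⊤
    exact measurable_from_top
  lintegral_ker x := by
    let _ : MeasurableSpace Y := ⊤
    rw [lintegral_count, tsum_eq_single (f x)]
    · simp
    · intro y hy
      simp [Ne.symm hy]

lemma expect_reveal_apply (f : X → Y) (F : Functional X) (p : X → ℝ≥0) :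
    (reveal f).expect F p = ∑ y, F fun x => if f x = y then p x else 0 := by
  let _ : MeasurableSpace Y := ⊤
  have h := Ops.expect_apply (reveal f) F p
  rw [h]
  change ∫ y, F ((reveal f).ker y * p) ∂(Measure.count : Measure Y) = _
  rw [integral_fintype]
  refine Finset.sum_congr rfl fun y _ => ?_
  rw [show (Measure.count : Measure Y).real {y} = 1 by simp [Measure.real], one_smul]
  refine congrArg F.1 (funext fun x => ?_)
  · simp only [reveal, Pi.mul_apply, ite_mul, one_mul, zero_mul]
  · exact Integrable.of_finite

omit [Fintype Y] in
lemma mass_ite (f : X → Y) (p : X → ℝ≥0) (y : Y) :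
    mass (fun x => if f x = y then p x else 0) = marginal f p y := by
  simp only [mass, marginal, NNReal.coe_sum]

/-- The chain rule. -/
lemma expect_reveal_entropyF (f : X → Y) :
    (reveal f).expect (entropyF X) = entropyF X - marginalEntropy f := by
  ext p
  rw [expect_reveal_apply, Functional.sub_apply, marginalEntropy_apply, entropy_marginal]
  simp only [entropyF_apply, entropy, mass_ite]
  rw [Finset.sum_comm, ← Finset.sum_sub_distrib]
  refine Finset.sum_congr rfl fun x _ => ?_
  rw [Finset.sum_eq_single (f x)]
  · rcases eq_or_lt_of_le (zero_le : 0 ≤ p x) with h | h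
    · simp [← h]
    · have h1 : (0 : ℝ) < p x := by exact_mod_cast h
      have h2 : (0 : ℝ) < marginal f p (f x) := by exact_mod_cast h.trans_le (le_marginal f p x)
      have h3 : 0 < mass p := h1.trans_le (le_mass p x)
      simp only [if_true]
      rw [Real.log_div h2.ne' h1.ne', Real.log_div h3.ne' h1.ne', Real.log_div h3.ne' h2.ne']
      ring
  · intro y _ hy
    simp [Ne.symm hy]
  · simp

end Entropy

end LinearEstimation

end

noncomputable section

namespace LinearEstimation

section GaussianSums

lemma map_pi_sum_gaussianReal {ι : Type} [Fintype ι] {Ω : ι → Type} [∀ i, MeasurableSpace (Ω i)]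
    (μ : ∀ i, Measure (Ω i)) [∀ i, IsProbabilityMeasure (μ i)] (f : ∀ i, Ω i → ℝ)
    (hf : ∀ i, Measurable (f i)) (v : ι → ℝ≥0) (h : ∀ i, (μ i).map (f i) = gaussianReal 0 (v i)) :
    (Measure.pi μ).map (fun x => ∑ i, f i (x i)) = gaussianReal 0 (∑ i, v i) := by
  have hmeas : Measurable fun x : ∀ i, Ω i => ∑ i, f i (x i) :=
    Finset.measurable_sum _ fun i _ => (hf i).comp (measurable_pi_apply i)
  have : IsProbabilityMeasure ((Measure.pi μ).map fun x => ∑ i, f i (x i)) :=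
    Measure.isProbabilityMeasure_map hmeas.aemeasurable
  refine Measure.ext_of_charFun ?_
  ext t
  have hi : ∀ i, charFun ((μ i).map (f i)) t = ∫ ω, Complex.exp (t * f i ω * Complex.I) ∂(μ i) := by
    intro i
    rw [charFun_apply_real, integral_map (hf i).aemeasurable (by fun_prop)]
  rw [charFun_apply_real, integral_map hmeas.aemeasurable (by fun_prop)]
  have : ∀ x : ∀ i, Ω i, Complex.exp (t * (∑ i, f i (x i) : ℝ) * Complex.I)
      = ∏ i, Complex.exp (t * f i (x i) * Complex.I) := by
    intro x
    rw [← Complex.exp_sum]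
    push_cast
    rw [Finset.mul_sum, Finset.sum_mul]
  simp only [this]
  rw [integral_fintype_prod_eq_prod (f := fun i ω => Complex.exp (t * f i ω * Complex.I))]
  simp only [← hi, h, charFun_gaussianReal]
  rw [← Complex.exp_sum]
  congr 1
  simp [Finset.sum_mul, Finset.sum_div, Finset.sum_neg_distrib]

variable {C : Type} [Fintype C] {B : ℕ}

/-- The law of a row of the measurement matrix. -/
def rowLaw (B : ℕ) (v : C → ℝ≥0) : Measure (C → Fin B → ℝ) :=
  Measure.pi fun l => Measure.pi fun _ : Fin B => gaussianReal 0 (v l)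

instance (v : C → ℝ≥0) : IsProbabilityMeasure (rowLaw B v) := by
  unfold rowLaw
  infer_instance

/-- The scalar product of a row and a signal. -/
def rowDot (φ d : C → Fin B → ℝ) : ℝ := ∑ l, ∑ b, φ l b * d l b

/-- The variance of the scalar product of a Gaussian row and a signal. -/
def rowVar (v : C → ℝ≥0) (d : C → Fin B → ℝ) : ℝ := ∑ l, (v l : ℝ) * ∑ b, d l b ^ 2

lemma rowVar_nonneg (v : C → ℝ≥0) (d : C → Fin B → ℝ) : 0 ≤ rowVar v d := by
  unfold rowVar
  positivity

lemma rowDot_sub (φ d e : C → Fin B → ℝ) : rowDot φ (d - e) = rowDot φ d - rowDot φ e := by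
  simp only [rowDot, Pi.sub_apply, mul_sub, Finset.sum_sub_distrib]

lemma measurable_rowDot (d : C → Fin B → ℝ) : Measurable fun φ => rowDot φ d := by
  unfold rowDot
  fun_prop

lemma map_rowDot (v : C → ℝ≥0) (d : C → Fin B → ℝ) :
    (rowLaw B v).map (fun φ => rowDot φ d) = gaussianReal 0 (rowVar v d).toNNReal := by
  have h : (rowVar v d).toNNReal = ∑ l, v l * ∑ b, (Real.toNNReal (d l b ^ 2)) := by
    rw [← NNReal.coe_inj, Real.coe_toNNReal _ (rowVar_nonneg v d)]
    push_cast
    unfold rowVar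
    refine Finset.sum_congr rfl fun l _ => ?_
    congr 1
    exact Finset.sum_congr rfl fun b _ => (Real.coe_toNNReal _ (sq_nonneg _)).symm
  rw [h]
  unfold rowLaw rowDot
  refine map_pi_sum_gaussianReal (fun l => Measure.pi fun _ : Fin B => gaussianReal 0 (v l))
    (fun l x => ∑ b, x b * d l b) (fun l => by fun_prop) _ fun l => ?_
  rw [Finset.mul_sum]
  refine map_pi_sum_gaussianReal (fun _ => gaussianReal 0 (v l)) (fun b x => x * d l b)
    (fun b => by fun_prop) _ fun b => ?_
  rw [gaussianReal_map_mul_const, mul_zero]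
  congr 1
  rw [mul_comm]
  congr 1
  ext
  simp [Real.coe_toNNReal _ (sq_nonneg (d l b))]

/-- The density of a measurement with noise of variance `σ` of the signal `a`. -/
def rowPdf (σ : ℝ≥0) (a : C → Fin B → ℝ) (ω : (C → Fin B → ℝ) × ℝ) : ℝ :=
  gaussianPDFReal (rowDot ω.1 a) σ ω.2

lemma measurable_rowPdf (σ : ℝ≥0) (a : C → Fin B → ℝ) : Measurable (rowPdf σ a) :=
  measurable_uncurry_gaussianPDFReal.comp
    (((measurable_rowDot a).comp measurable_fst).prodMk (measurable_const.prodMk measurable_snd))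

lemma rowPdf_nonneg (σ : ℝ≥0) (a : C → Fin B → ℝ) (ω : (C → Fin B → ℝ) × ℝ) : 0 ≤ rowPdf σ a ω :=
  gaussianPDFReal_nonneg _ _ _

lemma rowPdf_pos {σ : ℝ≥0} (hσ : σ ≠ 0) (a : C → Fin B → ℝ) (ω : (C → Fin B → ℝ) × ℝ) :
    0 < rowPdf σ a ω := gaussianPDFReal_pos _ _ _ hσ

lemma rowPdf_eq (σ : ℝ≥0) (a : C → Fin B → ℝ) (ω : (C → Fin B → ℝ) × ℝ) :
    rowPdf σ a ω = gaussianPDFReal 0 σ (ω.2 - rowDot ω.1 a) := by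
  simp [rowPdf, gaussianPDFReal]

/-- The law of a measurement together with its row. -/
lemma map_withDensity_rowPdf (v : C → ℝ≥0) {σ : ℝ≥0} (hσ : σ ≠ 0) (a m : C → Fin B → ℝ) :
    (((rowLaw B v).prod volume).withDensity fun ω => ENNReal.ofReal (rowPdf σ a ω)).map
      (fun ω => ω.2 - rowDot ω.1 m) = gaussianReal 0 ((rowVar v (a - m)).toNNReal + σ) := by
  have hm : Measurable fun ω : (C → Fin B → ℝ) × ℝ => ω.2 - rowDot ω.1 m :=
    measurable_snd.sub ((measurable_rowDot m).comp measurable_fst)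
  have hadd : gaussianReal 0 ((rowVar v (a - m)).toNNReal + σ)
      = ((rowLaw B v).prod (gaussianReal 0 σ)).map fun ω => rowDot ω.1 (a - m) + ω.2 := by
    have h1 := gaussianReal_conv_gaussianReal (m₁ := 0) (m₂ := 0)
      (v₁ := (rowVar v (a - m)).toNNReal) (v₂ := σ)
    rw [add_zero] at h1
    rw [← h1, Measure.conv, ← map_rowDot, ← Measure.map_id (μ := gaussianReal 0 σ),
      Measure.map_prod_map _ _ (measurable_rowDot _) measurable_id, Measure.map_map, Measure.map_id]
    · rfl
    · fun_prop
    · exact ((measurable_rowDot _).comp measurable_fst).prodMk measurable_snd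
  have hm2 : Measurable fun ω : (C → Fin B → ℝ) × ℝ => rowDot ω.1 (a - m) + ω.2 :=
    ((measurable_rowDot _).comp measurable_fst).add measurable_snd
  rw [hadd]
  refine Measure.ext_of_lintegral _ fun f hf => ?_
  have hfm : Measurable fun ω : (C → Fin B → ℝ) × ℝ => f (ω.2 - rowDot ω.1 m) := hf.comp hm
  have hfm2 : Measurable fun ω : (C → Fin B → ℝ) × ℝ => f (rowDot ω.1 (a - m) + ω.2) :=
    hf.comp hm2
  rw [lintegral_map hf hm, lintegral_map hf hm2,
    lintegral_withDensity_eq_lintegral_mul _ (measurable_rowPdf σ a).ennreal_ofReal hfm,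
    lintegral_prod _ ((measurable_rowPdf σ a).ennreal_ofReal.mul hfm).aemeasurable,
    lintegral_prod _ hfm2.aemeasurable]
  refine lintegral_congr fun φ => ?_
  have h2 := gaussianReal_map_const_add (μ := 0) (v := σ) (rowDot φ a)
  rw [zero_add] at h2
  have hfy : Measurable fun y : ℝ => f (y - rowDot φ m) := hf.comp (measurable_id.sub_const _)
  have h3 : ∫⁻ t, f (rowDot φ (a - m) + t) ∂(gaussianReal 0 σ)
      = ∫⁻ y, f (y - rowDot φ m) ∂(gaussianReal (rowDot φ a) σ) := by
    rw [← h2, lintegral_map hfy (measurable_const_add _)]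
    refine lintegral_congr fun t => ?_
    congr 1
    rw [rowDot_sub]
    ring
  rw [h3, gaussianReal_of_var_ne_zero _ hσ,
    lintegral_withDensity_eq_lintegral_mul _ (measurable_gaussianPDF _ _) hfy]
  rfl

lemma integrable_rowPdf_mul (v : C → ℝ≥0) {σ : ℝ≥0} (hσ : σ ≠ 0) (a m : C → Fin B → ℝ) {F : ℝ → ℝ}
    (hF : Integrable F (gaussianReal 0 ((rowVar v (a - m)).toNNReal + σ))) :
    Integrable (fun ω => rowPdf σ a ω * F (ω.2 - rowDot ω.1 m)) ((rowLaw B v).prod volume) := by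
  have hm : Measurable fun ω : (C → Fin B → ℝ) × ℝ => ω.2 - rowDot ω.1 m :=
    measurable_snd.sub ((measurable_rowDot m).comp measurable_fst)
  rw [← map_withDensity_rowPdf v hσ a m] at hF
  have h := (integrable_withDensity_iff_integrable_smul' (measurable_rowPdf σ a).ennreal_ofReal
    (ae_of_all _ fun _ => ENNReal.ofReal_lt_top)).1 (hF.comp_measurable hm)
  simpa [ENNReal.toReal_ofReal (rowPdf_nonneg σ a _)] using h

lemma integral_rowPdf_mul (v : C → ℝ≥0) {σ : ℝ≥0} (hσ : σ ≠ 0) (a m : C → Fin B → ℝ) {F : ℝ → ℝ}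
    (hF : Integrable F (gaussianReal 0 ((rowVar v (a - m)).toNNReal + σ))) :
    ∫ ω, rowPdf σ a ω * F (ω.2 - rowDot ω.1 m) ∂((rowLaw B v).prod volume)
      = ∫ t, F t ∂(gaussianReal 0 ((rowVar v (a - m)).toNNReal + σ)) := by
  have hm : Measurable fun ω : (C → Fin B → ℝ) × ℝ => ω.2 - rowDot ω.1 m :=
    measurable_snd.sub ((measurable_rowDot m).comp measurable_fst)
  rw [← map_withDensity_rowPdf v hσ a m] at hF ⊢
  rw [integral_map hm.aemeasurable hF.1,
    integral_withDensity_eq_integral_toReal_smul (measurable_rowPdf σ a).ennreal_ofReal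
    (ae_of_all _ fun _ => ENNReal.ofReal_lt_top)]
  simp [ENNReal.toReal_ofReal (rowPdf_nonneg σ a _)]

lemma integral_sq_gaussianReal (v : ℝ≥0) : ∫ t, t ^ 2 ∂(gaussianReal 0 v) = v := by
  have h := variance_fun_id_gaussianReal (μ := 0) (v := v)
  rw [variance_of_integral_eq_zero (by fun_prop) integral_id_gaussianReal] at h
  exact h

lemma integrable_sq_gaussianReal (v : ℝ≥0) : Integrable (fun t => t ^ 2) (gaussianReal 0 v) :=
  (memLp_id_gaussianReal 2).integrable_sq

lemma integrable_cosh_gaussianReal (v : ℝ≥0) : Integrable Real.cosh (gaussianReal 0 v) := by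
  have h1 := integrable_exp_mul_gaussianReal (μ := 0) (v := v) 1
  have h2 := integrable_exp_mul_gaussianReal (μ := 0) (v := v) (-1)
  refine ((h1.add h2).div_const 2).congr (ae_of_all _ fun t => ?_)
  simp [Real.cosh_eq]

lemma integral_cosh_gaussianReal (v : ℝ≥0) :
    ∫ t, Real.cosh t ∂(gaussianReal 0 v) = Real.exp (v / 2) := by
  have h1 := integrable_exp_mul_gaussianReal (μ := 0) (v := v) 1
  have h2 := integrable_exp_mul_gaussianReal (μ := 0) (v := v) (-1)
  have e := fun t : ℝ => congrFun (mgf_fun_id_gaussianReal (μ := 0) (v := v)) t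
  have e1 := e 1
  have e2 := e (-1)
  simp only [mgf] at e1 e2
  have : ∀ t, Real.cosh t = (Real.exp (1 * t) + Real.exp (-1 * t)) / 2 := fun t => by
    simp [Real.cosh_eq]
  simp only [this]
  rw [integral_div, integral_add h1 h2, e1, e2]
  norm_num

/-- The density at the origin of a centred Gaussian of variance `x`. -/
def peak (x : ℝ) : ℝ := (√(2 * Real.pi * x))⁻¹

lemma integral_gaussianPDFReal_gaussianReal {τ : ℝ≥0} (hτ : τ ≠ 0) (ρ : ℝ≥0) :
    ∫ t, gaussianPDFReal 0 τ t ∂(gaussianReal 0 ρ) = peak (τ + ρ) := by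
  have hτ' : (0 : ℝ) < τ := by exact_mod_cast pos_iff_ne_zero.2 hτ
  rcases eq_or_ne ρ 0 with h | h
  · subst h
    simp [gaussianPDFReal, peak]
  · have hρ' : (0 : ℝ) < ρ := by exact_mod_cast pos_iff_ne_zero.2 h
    have hκ : τ * ρ / (τ + ρ) ≠ 0 := by positivity
    rw [integral_gaussianReal_eq_integral_smul h]
    have : ∀ t, gaussianPDFReal 0 ρ t • gaussianPDFReal 0 τ t
        = peak (τ + ρ) * gaussianPDFReal 0 (τ * ρ / (τ + ρ)) t := by
      intro t
      simp only [gaussianPDFReal, peak, smul_eq_mul]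
      rw [mul_mul_mul_comm, ← Real.exp_add, ← mul_assoc]
      congr 1
      · rw [← mul_inv, ← mul_inv, ← Real.sqrt_mul (by positivity), ← Real.sqrt_mul (by positivity)]
        congr 2
        push_cast
        field_simp
      · congr 1
        push_cast
        field_simp
        ring
    simp only [this]
    rw [integral_const_mul, integral_gaussianPDFReal_eq_one _ hκ, mul_one]

lemma gaussianPDFReal_le_peak (μ : ℝ) (τ : ℝ≥0) (t : ℝ) : gaussianPDFReal μ τ t ≤ peak τ := by
  unfold gaussianPDFReal peak
  refine mul_le_of_le_one_right (by positivity) (Real.exp_le_one_iff.2 ?_)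
  exact div_nonpos_of_nonpos_of_nonneg (neg_nonpos.2 (sq_nonneg _)) (by positivity)

lemma integrable_gaussianPDFReal_gaussianReal (τ ρ : ℝ≥0) :
    Integrable (gaussianPDFReal 0 τ) (gaussianReal 0 ρ) := by
  refine Integrable.of_bound (measurable_gaussianPDFReal 0 τ).aestronglyMeasurable (peak τ)
    (ae_of_all _ fun t => ?_)
  rw [Real.norm_of_nonneg (gaussianPDFReal_nonneg _ _ _)]
  exact gaussianPDFReal_le_peak _ _ _

lemma peak_lipschitz {δ : ℝ} (hδ : 0 < δ) {x y : ℝ} (hx : δ ≤ x) (hy : δ ≤ y) :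
    |peak x - peak y| ≤ peak δ / δ * |x - y| := by
  have hx0 : 0 < x := hδ.trans_le hx
  have hy0 : 0 < y := hδ.trans_le hy
  set k := 2 * Real.pi with hk
  have hk0 : 0 < k := by positivity
  unfold peak
  have sx : 0 < √(k * x) := Real.sqrt_pos.2 (by positivity)
  have sy : 0 < √(k * y) := Real.sqrt_pos.2 (by positivity)
  have sd : 0 < √(k * δ) := Real.sqrt_pos.2 (by positivity)
  have hsx : √(k * δ) ≤ √(k * x) := Real.sqrt_le_sqrt (by gcongr)
  have hsy : √(k * δ) ≤ √(k * y) := Real.sqrt_le_sqrt (by gcongr)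
  have e1 : (√(k * x))⁻¹ - (√(k * y))⁻¹
      = k * (y - x) / (√(k * x) * √(k * y) * (√(k * x) + √(k * y))) := by
    have h1 := Real.sq_sqrt (show 0 ≤ k * x by positivity)
    have h2 := Real.sq_sqrt (show 0 ≤ k * y by positivity)
    field_simp
    linear_combination h2 - h1
  rw [e1, abs_div, abs_mul, abs_of_pos hk0, abs_sub_comm y x,
    abs_of_pos (show 0 < √(k * x) * √(k * y) * (√(k * x) + √(k * y)) by positivity)]
  have h3 : √(k * δ) * √(k * δ) * √(k * δ) ≤ √(k * x) * √(k * y) * (√(k * x) + √(k * y)) := by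
    have : √(k * δ) ≤ √(k * x) + √(k * y) := by linarith
    gcongr
  calc k * |x - y| / (√(k * x) * √(k * y) * (√(k * x) + √(k * y)))
      ≤ k * |x - y| / (√(k * δ) * √(k * δ) * √(k * δ)) := by gcongr
    _ = (√(k * δ))⁻¹ / δ * |x - y| := by
        rw [Real.mul_self_sqrt (by positivity)]
        field_simp

end GaussianSums

end LinearEstimation

end

noncomputable section

namespace LinearEstimation

section Row

variable {C : Type} [Fintype C] {B : ℕ} {X : Type} [Fintype X]

/-- The experiment that consists of one noisy measurement along a random Gaussian row `φ` of the
signal `a x`; the outcome is the row together with the measurement. -/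
def rowExp {Δ : ℝ≥0} (hΔ : Δ ≠ 0) (a : X → C → Fin B → ℝ) (v : C → ℝ≥0) : Experiment X where
  Ω := (C → Fin B → ℝ) × ℝ
  law := (rowLaw B v).prod volume
  ker ω x := ⟨rowPdf Δ (a x) ω, rowPdf_nonneg _ _ _⟩
  measurable_ker := measurable_pi_lambda _ fun x => (measurable_rowPdf Δ (a x)).subtype_mk
  lintegral_ker x := by
    have h := map_withDensity_rowPdf v hΔ (a x) (a x)
    have h2 := congrArg (fun μ => μ Set.univ) h
    have hm : Measurable fun ω : (C → Fin B → ℝ) × ℝ => ω.2 - rowDot ω.1 (a x) :=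
      measurable_snd.sub ((measurable_rowDot _).comp measurable_fst)
    simp only [measure_univ] at h2
    rw [Measure.map_apply hm MeasurableSet.univ, Set.preimage_univ,
      withDensity_apply _ MeasurableSet.univ, Measure.restrict_univ] at h2
    rw [← h2]
    refine lintegral_congr fun ω => ?_
    rw [ENNReal.ofReal, Real.toNNReal_of_nonneg (rowPdf_nonneg _ _ _)]
    rfl

/-- The posterior mean of the signal. -/
def meanSignal (a : X → C → Fin B → ℝ) (p : X → ℝ≥0) : C → Fin B → ℝ :=
  fun l b => (∑ x, (p x : ℝ) * a x l b) / mass p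

/-- The posterior variance of a Gaussian measurement of the signal. -/
def postVar (a : X → C → Fin B → ℝ) (v : C → ℝ≥0) (p : X → ℝ≥0) : ℝ :=
  (∑ x, (p x : ℝ) * rowVar v (a x - meanSignal a p)) / mass p

lemma postVar_nonneg (a : X → C → Fin B → ℝ) (v : C → ℝ≥0) (p : X → ℝ≥0) : 0 ≤ postVar a v p :=
  div_nonneg (Finset.sum_nonneg fun x _ => mul_nonneg (p x).2 (rowVar_nonneg _ _)) (mass_nonneg p)

/-- The density of a measurement under the posterior. -/
def mixPdf (Δ : ℝ≥0) (a : X → C → Fin B → ℝ) (p : X → ℝ≥0) (ω : (C → Fin B → ℝ) × ℝ) : ℝ :=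
  ∑ x, (p x : ℝ) / mass p * rowPdf Δ (a x) ω

/-- The Gaussian density with the moments of the measurement under the posterior. -/
def refPdf (Δ : ℝ≥0) (a : X → C → Fin B → ℝ) (v : C → ℝ≥0) (p : X → ℝ≥0)
    (ω : (C → Fin B → ℝ) × ℝ) : ℝ :=
  rowPdf (Δ + (postVar a v p).toNNReal) (meanSignal a p) ω

/-- The integrand of the relative entropy of two densities. -/
def klTerm (q r : ℝ) : ℝ := q * Real.log (q / r) - q + r

lemma klTerm_nonneg {q r : ℝ} (hq : 0 ≤ q) (hr : 0 < r) : 0 ≤ klTerm q r := by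
  unfold klTerm
  rcases eq_or_lt_of_le hq with h | h
  · rw [← h]; simpa using hr.le
  · have h1 := Real.log_le_sub_one_of_pos (show 0 < r / q by positivity)
    rw [← inv_div, Real.log_inv] at h1
    have h2 := mul_le_mul_of_nonneg_left h1 h.le
    have h3 : q * (r / q - 1) = r - q := by field_simp
    rw [inv_div] at h2
    linarith

lemma klTerm_le {q r : ℝ} (hq : 0 ≤ q) (hr : 0 < r) : klTerm q r ≤ (q - r) ^ 2 / r := by
  unfold klTerm
  rcases eq_or_lt_of_le hq with h | h
  · rw [← h]; field_simp; simp [sq]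
  · have h1 := Real.log_le_sub_one_of_pos (show 0 < q / r by positivity)
    have h2 := mul_le_mul_of_nonneg_left h1 h.le
    have h3 : q * (q / r - 1) - q + r = (q - r) ^ 2 / r := by field_simp; ring
    linarith

variable {Δ : ℝ≥0} (hΔ : Δ ≠ 0) (a : X → C → Fin B → ℝ) (v : C → ℝ≥0) (p : X → ℝ≥0)

include hΔ in
lemma log_rowPdf_div {σ : ℝ≥0} (hσ : σ ≠ 0) (d m : C → Fin B → ℝ) (ω : (C → Fin B → ℝ) × ℝ) :
    Real.log (rowPdf Δ d ω / rowPdf σ m ω) = 1 / 2 * Real.log (σ / Δ)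
      - 1 / (2 * Δ) * (ω.2 - rowDot ω.1 d) ^ 2 + 1 / (2 * σ) * (ω.2 - rowDot ω.1 m) ^ 2 := by
  have hΔ' : (0 : ℝ) < Δ := by exact_mod_cast pos_iff_ne_zero.2 hΔ
  have hσ' : (0 : ℝ) < σ := by exact_mod_cast pos_iff_ne_zero.2 hσ
  rw [Real.log_div (rowPdf_pos hΔ _ _).ne' (rowPdf_pos hσ _ _).ne']
  unfold rowPdf gaussianPDFReal
  rw [Real.log_mul (by positivity) (by positivity), Real.log_mul (by positivity) (by positivity),
    Real.log_exp, Real.log_exp, Real.log_inv, Real.log_inv, Real.log_sqrt (by positivity),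
    Real.log_sqrt (by positivity), Real.log_mul (by positivity) hΔ'.ne',
    Real.log_mul (by positivity) hσ'.ne', Real.log_div hσ'.ne' hΔ'.ne']
  field_simp
  ring

include hΔ in
lemma integrable_rowPdf_mul_log {σ : ℝ≥0} (hσ : σ ≠ 0) (d m : C → Fin B → ℝ) :
    Integrable (fun ω => rowPdf Δ d ω * Real.log (rowPdf Δ d ω / rowPdf σ m ω))
      ((rowLaw B v).prod volume) := by
  have h0 := integrable_rowPdf_mul v hΔ d d (F := fun _ => 1) (integrable_const _)
  have h1 := integrable_rowPdf_mul v hΔ d d (integrable_sq_gaussianReal _)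
  have h2 := integrable_rowPdf_mul v hΔ d m (integrable_sq_gaussianReal _)
  refine (((h0.const_mul (1 / 2 * Real.log (σ / Δ))).sub (h1.const_mul (1 / (2 * (Δ : ℝ))))).add
    (h2.const_mul (1 / (2 * (σ : ℝ))))).congr (ae_of_all _ fun ω => ?_)
  simp only [Pi.add_apply, Pi.sub_apply, log_rowPdf_div hΔ hσ]
  ring

include hΔ in
lemma integral_rowPdf_mul_log {σ : ℝ≥0} (hσ : σ ≠ 0) (d m : C → Fin B → ℝ) :
    ∫ ω, rowPdf Δ d ω * Real.log (rowPdf Δ d ω / rowPdf σ m ω) ∂((rowLaw B v).prod volume)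
      = 1 / 2 * Real.log (σ / Δ) - 1 / 2 + (rowVar v (d - m) + Δ) / (2 * σ) := by
  have hΔ' : (0 : ℝ) < Δ := by exact_mod_cast pos_iff_ne_zero.2 hΔ
  have h0 := integrable_rowPdf_mul v hΔ d d (F := fun _ => 1) (integrable_const _)
  have h1 := integrable_rowPdf_mul v hΔ d d (integrable_sq_gaussianReal _)
  have h2 := integrable_rowPdf_mul v hΔ d m (integrable_sq_gaussianReal _)
  have e0 := integral_rowPdf_mul v hΔ d d (F := fun _ => 1) (integrable_const _)
  have e1 := integral_rowPdf_mul v hΔ d d (integrable_sq_gaussianReal _)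
  have e2 := integral_rowPdf_mul v hΔ d m (integrable_sq_gaussianReal _)
  rw [integral_sq_gaussianReal] at e1 e2
  have : ∀ ω, rowPdf Δ d ω * Real.log (rowPdf Δ d ω / rowPdf σ m ω)
      = 1 / 2 * Real.log (σ / Δ) * (rowPdf Δ d ω * 1)
        - 1 / (2 * Δ) * (rowPdf Δ d ω * (ω.2 - rowDot ω.1 d) ^ 2)
        + 1 / (2 * σ) * (rowPdf Δ d ω * (ω.2 - rowDot ω.1 m) ^ 2) := by
    intro ω
    rw [log_rowPdf_div hΔ hσ]
    ring
  simp only [this]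
  have f1 := integral_add ((h0.const_mul (1 / 2 * Real.log (σ / Δ))).sub
    (h1.const_mul (1 / (2 * (Δ : ℝ))))) (h2.const_mul (1 / (2 * (σ : ℝ))))
  have f2 := integral_sub (h0.const_mul (1 / 2 * Real.log (σ / Δ)))
    (h1.const_mul (1 / (2 * (Δ : ℝ))))
  simp only [Pi.sub_apply] at f1 f2
  rw [f1, f2, integral_const_mul, integral_const_mul, integral_const_mul, e0, e1, e2]
  have hz : rowVar v (d - d) = 0 := by simp [rowVar]
  rw [hz]
  simp only [integral_const, probReal_univ, smul_eq_mul, mul_one, Real.toNNReal_zero, zero_add,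
    NNReal.coe_add, Real.coe_toNNReal _ (rowVar_nonneg v (d - m))]
  field_simp

variable {p} (hp : 0 < mass p)

include hΔ hp in
lemma mixPdf_pos (ω : (C → Fin B → ℝ) × ℝ) : 0 < mixPdf Δ a p ω := by
  have : ∃ x, 0 < (p x : ℝ) := by
    by_contra! h
    exact hp.not_ge (Finset.sum_nonpos fun x _ => h x)
  obtain ⟨x, hx⟩ := this
  exact Finset.sum_pos' (fun y _ => mul_nonneg (by positivity) (rowPdf_nonneg _ _ _))
    ⟨x, Finset.mem_univ x, mul_pos (by positivity) (rowPdf_pos hΔ _ _)⟩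

include hΔ in
lemma refVar_ne_zero : Δ + (postVar a v p).toNNReal ≠ 0 := fun h => hΔ (add_eq_zero.1 h).1

include hp in
lemma mass_mul_mixPdf (ω : (C → Fin B → ℝ) × ℝ) :
    mass p * mixPdf Δ a p ω = ∑ x, (p x : ℝ) * rowPdf Δ (a x) ω := by
  rw [mixPdf, Finset.mul_sum]
  refine Finset.sum_congr rfl fun x _ => ?_
  field_simp

include hp in
/-- The entropy after a measurement, in terms of a relative entropy. -/
lemma entropy_rowExp (ω : (C → Fin B → ℝ) × ℝ) :
    entropy ((rowExp hΔ a v).ker ω * p) =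
      mass p * klTerm (mixPdf Δ a p ω) (refPdf Δ a v p ω)
      - ∑ x, (p x : ℝ) * (rowPdf Δ (a x) ω * Real.log (rowPdf Δ (a x) ω / refPdf Δ a v p ω))
      + ∑ x, (p x : ℝ) * Real.log (mass p / p x) * rowPdf Δ (a x) ω
      + ∑ x, (p x : ℝ) * rowPdf Δ (a x) ω - mass p * refPdf Δ a v p ω := by
  have hq := mixPdf_pos hΔ a hp ω
  have hQ : 0 < refPdf Δ a v p ω := rowPdf_pos (refVar_ne_zero hΔ a v) _ _
  have hM : mass ((rowExp hΔ a v).ker ω * p) = mass p * mixPdf Δ a p ω := by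
    rw [mass_mul_mixPdf a hp]
    exact Finset.sum_congr rfl fun x _ => mul_comm _ _
  have h1 : mass p * klTerm (mixPdf Δ a p ω) (refPdf Δ a v p ω)
      = ∑ x, (p x : ℝ) * rowPdf Δ (a x) ω * Real.log (mixPdf Δ a p ω / refPdf Δ a v p ω)
        - ∑ x, (p x : ℝ) * rowPdf Δ (a x) ω + mass p * refPdf Δ a v p ω := by
    rw [← Finset.sum_mul, ← mass_mul_mixPdf a hp, klTerm]
    ring
  have h2 : entropy ((rowExp hΔ a v).ker ω * p)
      = ∑ x, (p x : ℝ) * rowPdf Δ (a x) ω * Real.log (mixPdf Δ a p ω / refPdf Δ a v p ω)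
      - ∑ x, (p x : ℝ) * (rowPdf Δ (a x) ω * Real.log (rowPdf Δ (a x) ω / refPdf Δ a v p ω))
      + ∑ x, (p x : ℝ) * Real.log (mass p / p x) * rowPdf Δ (a x) ω := by
    rw [entropy, hM, ← Finset.sum_sub_distrib, ← Finset.sum_add_distrib]
    refine Finset.sum_congr rfl fun x _ => ?_
    have e : (((rowExp hΔ a v).ker ω * p) x : ℝ) = rowPdf Δ (a x) ω * p x := rfl
    rw [e]
    have hl := rowPdf_pos hΔ (a x) ω
    rcases eq_or_lt_of_le (p x).2 with h | h
    · have h : (p x : ℝ) = 0 := h.symm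
      simp [h]
    · have h : (0 : ℝ) < p x := h
      rw [Real.log_div (by positivity) (by positivity), Real.log_div (by positivity) (by positivity),
        Real.log_div (by positivity) (by positivity), Real.log_div (by positivity) (by positivity),
        Real.log_mul (by positivity) (by positivity), Real.log_mul (by positivity) (by positivity)]
      ring
  rw [h2, h1]
  ring

lemma integrable_rowPdf {σ : ℝ≥0} (hσ : σ ≠ 0) (d : C → Fin B → ℝ) :
    Integrable (rowPdf σ d) ((rowLaw B v).prod volume) := by
  simpa using integrable_rowPdf_mul v hσ d d (F := fun _ => 1) (integrable_const _)

lemma integral_rowPdf {σ : ℝ≥0} (hσ : σ ≠ 0) (d : C → Fin B → ℝ) :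
    ∫ ω, rowPdf σ d ω ∂((rowLaw B v).prod volume) = 1 := by
  simpa using integral_rowPdf_mul v hσ d d (F := fun _ => 1) (integrable_const _)

include hΔ hp in
lemma integrable_klTerm : Integrable
    (fun ω => klTerm (mixPdf Δ a p ω) (refPdf Δ a v p ω)) ((rowLaw B v).prod volume) := by
  have i0 : Integrable (fun ω : (C → Fin B → ℝ) × ℝ => entropy ((rowExp hΔ a v).ker ω * p))
      ((rowLaw B v).prod volume) := (rowExp hΔ a v).integrable (entropyF X) p
  have i1 := integrable_finsetSum (Finset.univ : Finset X) fun x _ =>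
    (integrable_rowPdf_mul_log hΔ v (refVar_ne_zero hΔ a v (p := p)) (a x)
      (meanSignal a p)).const_mul (p x : ℝ)
  have i2 := integrable_finsetSum (Finset.univ : Finset X) fun x _ =>
    (integrable_rowPdf v hΔ (a x)).const_mul ((p x : ℝ) * Real.log (mass p / p x))
  have i3 := integrable_finsetSum (Finset.univ : Finset X) fun x _ =>
    (integrable_rowPdf v hΔ (a x)).const_mul (p x : ℝ)
  have i4 := (integrable_rowPdf v (refVar_ne_zero hΔ a v (p := p)) (meanSignal a p)).const_mul
    (mass p)
  refine (((((i0.add i1).sub i2).sub i3).add i4).const_mul (mass p)⁻¹).congr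
    (ae_of_all _ fun ω => ?_)
  simp only [Pi.add_apply, Pi.sub_apply, entropy_rowExp hΔ a v hp ω]
  rw [eq_comm, eq_inv_mul_iff_mul_eq₀ hp.ne']
  simp only [refPdf]
  ring

include hp in
/-- The information of one measurement. -/
lemma entropy_sub_expect_rowExp :
    entropy p - (rowExp hΔ a v).expect (entropyF X) p =
      mass p * (1 / 2 * Real.log (1 + postVar a v p / Δ))
      - mass p * ∫ ω, klTerm (mixPdf Δ a p ω) (refPdf Δ a v p ω) ∂((rowLaw B v).prod volume) := by
  have hΔ' : (0 : ℝ) < Δ := by exact_mod_cast pos_iff_ne_zero.2 hΔ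
  have hE := postVar_nonneg a v p
  have i0 := (integrable_klTerm hΔ a v hp).const_mul (mass p)
  have i1' := fun x (_ : x ∈ (Finset.univ : Finset X)) =>
    (integrable_rowPdf_mul_log hΔ v (refVar_ne_zero hΔ a v (p := p)) (a x)
      (meanSignal a p)).const_mul (p x : ℝ)
  have i2' := fun x (_ : x ∈ (Finset.univ : Finset X)) =>
    (integrable_rowPdf v hΔ (a x)).const_mul ((p x : ℝ) * Real.log (mass p / p x))
  have i3' := fun x (_ : x ∈ (Finset.univ : Finset X)) =>
    (integrable_rowPdf v hΔ (a x)).const_mul (p x : ℝ)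
  have i4 := (integrable_rowPdf v (refVar_ne_zero hΔ a v (p := p)) (meanSignal a p)).const_mul
    (mass p)
  have i1 := integrable_finsetSum _ i1'
  have i2 := integrable_finsetSum _ i2'
  have i3 := integrable_finsetSum _ i3'
  have h1 : (rowExp hΔ a v).expect (entropyF X) p
      = ∫ ω, entropy ((rowExp hΔ a v).ker ω * p) ∂((rowLaw B v).prod volume) := rfl
  rw [h1]
  simp only [entropy_rowExp hΔ a v hp]
  have e := integral_sub (((i0.sub i1).add i2).add i3) i4
  have e' := integral_add ((i0.sub i1).add i2) i3
  have e'' := integral_add (i0.sub i1) i2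
  have e3 := integral_sub i0 i1
  simp only [Pi.add_apply, Pi.sub_apply] at e e' e'' e3
  have f1 := integral_finsetSum _ i1'
  have f2 := integral_finsetSum _ i2'
  have f3 := integral_finsetSum _ i3'
  simp only [integral_const_mul, integral_rowPdf v hΔ, integral_rowPdf v (refVar_ne_zero hΔ a v),
    integral_rowPdf_mul_log hΔ v (refVar_ne_zero hΔ a v)] at f1 f2 f3 e e' e'' e3
  unfold refPdf
  unfold refPdf at e e' e'' e3
  rw [e, e', e'', e3, f1, f2, f3]
  have g1 : ∑ x, (p x : ℝ) * rowVar v (a x - meanSignal a p) = mass p * postVar a v p := by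
    unfold postVar
    field_simp
  have g2 : ∑ x, (p x : ℝ) = mass p := rfl
  have g3 : ((Δ + (postVar a v p).toNNReal : ℝ≥0) : ℝ) = Δ + postVar a v p := by
    push_cast
    rw [Real.coe_toNNReal _ hE]
  simp only [g3, mul_add, mul_sub, Finset.sum_add_distrib, Finset.sum_sub_distrib, mul_div_assoc',
    ← Finset.sum_mul, ← Finset.sum_div, g1, g2, mul_one]
  have g4 : ((Δ : ℝ) + postVar a v p) / Δ = 1 + postVar a v p / Δ := by field_simp
  rw [g4]
  have g5 : (mass p * postVar a v p + mass p * ↑Δ) / (2 * (Δ + postVar a v p)) = mass p / 2 := by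
    field_simp
    ring
  have g6 : ∑ x, (p x : ℝ) * Real.log (mass p / p x) = entropy p := rfl
  rw [g6, ← mul_add 2 (Δ : ℝ) _, g5]
  ring

include hp in
/-- Among the posteriors with a given variance, the Gaussian gives the most informative
measurement. -/
lemma entropy_sub_expect_rowExp_le :
    entropy p - (rowExp hΔ a v).expect (entropyF X) p
      ≤ mass p * (1 / 2 * Real.log (1 + postVar a v p / Δ)) := by
  rw [entropy_sub_expect_rowExp hΔ a v hp]
  have : 0 ≤ ∫ ω, klTerm (mixPdf Δ a p ω) (refPdf Δ a v p ω) ∂((rowLaw B v).prod volume) :=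
    integral_nonneg fun ω => klTerm_nonneg (mixPdf_pos hΔ a hp ω).le
      (rowPdf_pos (refVar_ne_zero hΔ a v) _ _)
  have := mul_nonneg hp.le this
  linarith

end Row

end LinearEstimation

end

noncomputable section

namespace LinearEstimation

section KlBound

lemma pow_four_le_cosh (u : ℝ) : u ^ 4 / 32 ≤ Real.cosh u := by
  have h : 1 + (u / 2) ^ 2 / 2 ≤ Real.cosh (u / 2) := by
    have h1 := Real.cosh_sq (u / 4)
    have h2 := Real.cosh_two_mul (u / 4)
    have h3 : (u / 4) ^ 2 ≤ Real.sinh (u / 4) ^ 2 := by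
      rw [sq_le_sq]
      rcases le_total 0 (u / 4) with h | h
      · rw [abs_of_nonneg h, abs_of_nonneg (Real.sinh_nonneg_iff.2 h)]
        exact Real.self_le_sinh_iff.2 h
      · rw [abs_of_nonpos h, abs_of_nonpos (Real.sinh_nonpos_iff.2 h)]
        exact neg_le_neg (Real.sinh_le_self_iff.2 h)
    rw [show 2 * (u / 4) = u / 2 by ring] at h2
    nlinarith
  have h1 := Real.cosh_sq (u / 2)
  have h2 := Real.cosh_two_mul (u / 2)
  rw [show 2 * (u / 2) = u by ring] at h2
  have h3 : (1 + (u / 2) ^ 2 / 2) ^ 2 ≤ Real.cosh (u / 2) ^ 2 := by gcongr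
  nlinarith [sq_nonneg u]

lemma peak_pos {x : ℝ} (hx : 0 < x) : 0 < peak x := by
  unfold peak
  positivity

lemma peak_anti {x y : ℝ} (hx : 0 < x) (h : x ≤ y) : peak y ≤ peak x := by
  unfold peak
  gcongr

lemma exists_klTerm_le {Δ : ℝ≥0} (hΔ : Δ ≠ 0) (ρ : ℝ≥0) {ε : ℝ} (hε : 0 < ε) :
    ∃ A : ℝ, 0 ≤ A ∧ ∀ E : ℝ≥0, E ≤ ρ → ∀ u q : ℝ, 0 ≤ q → q ≤ peak Δ →
      klTerm q (gaussianPDFReal 0 (Δ + E) u)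
        ≤ A * (q - gaussianPDFReal 0 (Δ + E) u) ^ 2
          + ε * ((q + gaussianPDFReal 0 (Δ + E) u) * Real.cosh u) := by
  have hΔ' : (0 : ℝ) < Δ := by exact_mod_cast pos_iff_ne_zero.2 hΔ
  set K : ℝ := 1 + (ρ + 1) / (2 * Δ) with hK
  have hK1 : 1 ≤ K := le_add_of_nonneg_right (by positivity)
  set S : ℝ := 1 + 64 * K / ε with hS
  have hS1 : 1 ≤ S := le_add_of_nonneg_right (by positivity)
  set r₀ : ℝ := peak (Δ + ρ) * Real.exp (-S / (2 * Δ)) with hr₀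
  have hr₀' : 0 < r₀ := mul_pos (peak_pos (by positivity)) (Real.exp_pos _)
  refine ⟨1 / r₀, by positivity, fun E hE u q hq hq1 => ?_⟩
  have hE' : (E : ℝ) ≤ ρ := by exact_mod_cast hE
  have hσ : Δ + E ≠ 0 := fun h => hΔ (add_eq_zero.1 h).1
  have hr : 0 < gaussianPDFReal 0 (Δ + E) u := gaussianPDFReal_pos _ _ _ hσ
  have hrdef : gaussianPDFReal 0 (Δ + E) u = peak (Δ + E) * Real.exp (-u ^ 2 / (2 * (Δ + E))) := by
    simp [gaussianPDFReal, peak]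
  set r := gaussianPDFReal 0 (Δ + E) u with hrr
  have hcosh := Real.cosh_pos u
  rcases le_total (u ^ 2) S with hu | hu
  · have h0 : r₀ ≤ r := by
      rw [hrdef, hr₀]
      refine mul_le_mul (peak_anti (by positivity) (by linarith)) (Real.exp_le_exp.2 ?_)
        (Real.exp_pos _).le (peak_pos (by positivity)).le
      rw [neg_div, neg_div, neg_le_neg_iff]
      exact div_le_div₀ (by positivity) hu (by positivity) (by linarith [E.2])
    calc klTerm q r ≤ (q - r) ^ 2 / r := klTerm_le hq hr
      _ ≤ (q - r) ^ 2 / r₀ := by gcongr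
      _ = 1 / r₀ * (q - r) ^ 2 := by ring
      _ ≤ _ := le_add_of_nonneg_right (by positivity)
  · have h1 : K * (1 + u ^ 2) ≤ ε * Real.cosh u := by
      have h2 := pow_four_le_cosh u
      have h3 : 64 * K ≤ ε * u ^ 2 := by
        have : 64 * K / ε ≤ u ^ 2 := by linarith
        rw [div_le_iff₀ hε] at this
        linarith
      have h4 : K * (1 + u ^ 2) ≤ K * (2 * u ^ 2) := by
        refine mul_le_mul_of_nonneg_left (by linarith) (by linarith)
      have h5 : 64 * K * u ^ 2 ≤ ε * u ^ 2 * u ^ 2 := by gcongr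
      have h6 : ε * (u ^ 4 / 32) ≤ ε * Real.cosh u := by gcongr
      nlinarith
    have h2 : klTerm q r ≤ q * (K * (1 + u ^ 2)) + r * (K * (1 + u ^ 2)) := by
      have hr1 : r * 1 ≤ r * (K * (1 + u ^ 2)) := by
        refine mul_le_mul_of_nonneg_left ?_ hr.le
        nlinarith [sq_nonneg u]
      unfold klTerm
      rcases eq_or_lt_of_le hq with h | h
      · rw [← h]; simpa using hr1
      · have h3 : Real.log (q / r) ≤ K * (1 + u ^ 2) := by
          have h4 : Real.log (q / r) ≤ Real.log (peak Δ / r) := by gcongr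
          have h5 : Real.log (peak Δ / r)
              = 1 / 2 * Real.log (1 + E / Δ) + u ^ 2 / (2 * (Δ + E)) := by
            rw [hrdef, Real.log_div (peak_pos hΔ').ne' (by
              have := peak_pos (show (0:ℝ) < Δ + E by positivity); positivity),
              Real.log_mul (peak_pos (by positivity)).ne' (Real.exp_pos _).ne', Real.log_exp]
            unfold peak
            rw [Real.log_inv, Real.log_inv, Real.log_sqrt (by positivity),
              Real.log_sqrt (by positivity), Real.log_mul (by positivity) hΔ'.ne',
              Real.log_mul (show 2 * Real.pi ≠ 0 by positivity) (show (Δ : ℝ) + E ≠ 0 by positivity),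
              show (1 : ℝ) + E / Δ = (Δ + E) / Δ by field_simp, Real.log_div (by positivity) hΔ'.ne']
            ring
          have h6 : Real.log (1 + E / Δ) ≤ E / Δ := by
            have := Real.log_le_sub_one_of_pos (show (0:ℝ) < 1 + E / Δ by positivity)
            linarith
          have h7 : u ^ 2 / (2 * (Δ + E)) ≤ u ^ 2 / (2 * Δ) := by
            gcongr
            linarith [E.2]
          have h8 : (E : ℝ) / Δ ≤ ρ / Δ := by gcongr
          have h9 : K * (1 + u ^ 2) = 1 + u ^ 2 + (ρ / Δ / 2 + 1 / (2 * Δ)) * (1 + u ^ 2) := by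
            rw [hK]; field_simp
          have h10 : 0 ≤ (ρ : ℝ) / Δ := by positivity
          have h11 : (0:ℝ) ≤ 1 / (2 * Δ) := by positivity
          have h12 : u ^ 2 / (2 * Δ) = 1 / (2 * Δ) * u ^ 2 := by ring
          rw [h12] at h7
          nlinarith [sq_nonneg u, mul_nonneg h10 (sq_nonneg u)]
        have := mul_le_mul_of_nonneg_left h3 h.le
        linarith
    calc klTerm q r ≤ q * (K * (1 + u ^ 2)) + r * (K * (1 + u ^ 2)) := h2
      _ ≤ q * (ε * Real.cosh u) + r * (ε * Real.cosh u) := by gcongr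
      _ = ε * ((q + r) * Real.cosh u) := by ring
      _ ≤ _ := le_add_of_nonneg_left (by positivity)

end KlBound

section Row

variable {C : Type} [Fintype C] {B : ℕ} {X : Type} [Fintype X]
variable {Δ : ℝ≥0} (hΔ : Δ ≠ 0) (a : X → C → Fin B → ℝ) (v : C → ℝ≥0) {p : X → ℝ≥0}
  (hp : 0 < mass p)

include hp in
lemma sum_div_mass : ∑ x, (p x : ℝ) / mass p = 1 := by
  rw [← Finset.sum_div]
  exact div_self hp.ne'

lemma integrable_rowPdf_mul_rowPdf {σ τ : ℝ≥0} (hσ : σ ≠ 0) (d e : C → Fin B → ℝ) :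
    Integrable (fun ω => rowPdf σ d ω * rowPdf τ e ω) ((rowLaw B v).prod volume) := by
  simp only [rowPdf_eq τ e]
  exact integrable_rowPdf_mul v hσ d e (integrable_gaussianPDFReal_gaussianReal _ _)

lemma integral_rowPdf_mul_rowPdf {σ τ : ℝ≥0} (hσ : σ ≠ 0) (hτ : τ ≠ 0) (d e : C → Fin B → ℝ) :
    ∫ ω, rowPdf σ d ω * rowPdf τ e ω ∂((rowLaw B v).prod volume)
      = peak (σ + τ + rowVar v (d - e)) := by
  simp only [rowPdf_eq τ e]
  rw [integral_rowPdf_mul v hσ d e (integrable_gaussianPDFReal_gaussianReal _ _),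
    integral_gaussianPDFReal_gaussianReal hτ]
  congr 1
  push_cast
  rw [Real.coe_toNNReal _ (rowVar_nonneg _ _)]
  ring

/-- The dispersion of the overlaps of one and of two replicas. -/
def dispersion (a : X → C → Fin B → ℝ) (v : C → ℝ≥0) (p : X → ℝ≥0) : ℝ :=
  ∑ x, ∑ y, (p x : ℝ) / mass p * (p y / mass p) * |rowVar v (a x - a y) - 2 * postVar a v p|
    + 2 * ∑ x, (p x : ℝ) / mass p * |rowVar v (a x - meanSignal a p) - postVar a v p|

lemma sq_mixPdf_sub (ω : (C → Fin B → ℝ) × ℝ) : (mixPdf Δ a p ω - refPdf Δ a v p ω) ^ 2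
    = (∑ x, ∑ y, (p x : ℝ) / mass p * (p y / mass p) * (rowPdf Δ (a x) ω * rowPdf Δ (a y) ω))
      - 2 * (∑ x, (p x : ℝ) / mass p * (rowPdf Δ (a x) ω
        * rowPdf (Δ + (postVar a v p).toNNReal) (meanSignal a p) ω))
      + rowPdf (Δ + (postVar a v p).toNNReal) (meanSignal a p) ω
        * rowPdf (Δ + (postVar a v p).toNNReal) (meanSignal a p) ω := by
  have h1 : mixPdf Δ a p ω * mixPdf Δ a p ω = ∑ x, ∑ y, (p x : ℝ) / mass p * (p y / mass p)
      * (rowPdf Δ (a x) ω * rowPdf Δ (a y) ω) := by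
    rw [mixPdf, Finset.sum_mul_sum]
    exact Finset.sum_congr rfl fun x _ => Finset.sum_congr rfl fun y _ => by ring
  have h2 : mixPdf Δ a p ω * refPdf Δ a v p ω = ∑ x, (p x : ℝ) / mass p * (rowPdf Δ (a x) ω
      * rowPdf (Δ + (postVar a v p).toNNReal) (meanSignal a p) ω) := by
    rw [mixPdf, Finset.sum_mul]
    exact Finset.sum_congr rfl fun x _ => by rw [refPdf]; ring
  rw [← h1, ← h2, refPdf]
  ring

include hΔ hp in
lemma integrable_sq_mixPdf_sub : Integrable (fun ω => (mixPdf Δ a p ω - refPdf Δ a v p ω) ^ 2)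
    ((rowLaw B v).prod volume) := by
  have i1 := integrable_finsetSum (Finset.univ : Finset X) fun x _ =>
    integrable_finsetSum (Finset.univ : Finset X) fun y _ =>
      (integrable_rowPdf_mul_rowPdf v hΔ (τ := Δ) (a x) (a y)).const_mul
        ((p x : ℝ) / mass p * (p y / mass p))
  have i2 := integrable_finsetSum (Finset.univ : Finset X) fun x _ =>
    (integrable_rowPdf_mul_rowPdf v hΔ (τ := Δ + (postVar a v p).toNNReal) (a x)
      (meanSignal a p)).const_mul ((p x : ℝ) / mass p)
  have i3 := integrable_rowPdf_mul_rowPdf v (refVar_ne_zero hΔ a v (p := p))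
    (τ := Δ + (postVar a v p).toNNReal) (meanSignal a p) (meanSignal a p)
  exact ((i1.sub (i2.const_mul 2)).add i3).congr
    (ae_of_all _ fun ω => (sq_mixPdf_sub a v ω).symm)

include hΔ hp in
lemma integral_sq_mixPdf_sub_le :
    ∫ ω, (mixPdf Δ a p ω - refPdf Δ a v p ω) ^ 2 ∂((rowLaw B v).prod volume)
      ≤ peak (2 * Δ) / (2 * Δ) * dispersion a v p := by
  have hΔ' : (0 : ℝ) < Δ := by exact_mod_cast pos_iff_ne_zero.2 hΔ
  have hE := postVar_nonneg a v p
  have hσ := refVar_ne_zero hΔ a v (p := p)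
  have i1' := fun (x y : X) =>
      (integrable_rowPdf_mul_rowPdf v hΔ (τ := Δ) (a x) (a y)).const_mul
        ((p x : ℝ) / mass p * (p y / mass p))
  have i1'' := fun (x : X) => integrable_finsetSum (Finset.univ : Finset X) fun y _ => i1' x y
  have i1 := integrable_finsetSum (Finset.univ : Finset X) fun x _ => i1'' x
  have i2' := fun (x : X) =>
    (integrable_rowPdf_mul_rowPdf v hΔ (τ := Δ + (postVar a v p).toNNReal) (a x)
      (meanSignal a p)).const_mul ((p x : ℝ) / mass p)
  have i2 := integrable_finsetSum (Finset.univ : Finset X) fun x _ => i2' x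
  have i3 := integrable_rowPdf_mul_rowPdf v hσ
    (τ := Δ + (postVar a v p).toNNReal) (meanSignal a p) (meanSignal a p)
  simp only [sq_mixPdf_sub a v]
  have f1 := integral_add (i1.sub (i2.const_mul 2)) i3
  have f2 := integral_sub i1 (i2.const_mul 2)
  simp only [Pi.sub_apply] at f1 f2
  rw [f1, f2, integral_const_mul, integral_finsetSum _ fun x _ => i1'' x,
    integral_finsetSum _ fun x _ => i2' x]
  simp only [integral_finsetSum _ fun y _ => i1' _ y, integral_const_mul,
    integral_rowPdf_mul_rowPdf v hΔ hΔ, integral_rowPdf_mul_rowPdf v hΔ hσ,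
    integral_rowPdf_mul_rowPdf v hσ hσ]
  have hz : rowVar v (meanSignal a p - meanSignal a p) = 0 := by simp [rowVar]
  have hc : ((Δ + (postVar a v p).toNNReal : ℝ≥0) : ℝ) = Δ + postVar a v p := by
    push_cast
    rw [Real.coe_toNNReal _ hE]
  rw [hz, hc]
  set E := postVar a v p
  set z := peak (2 * Δ + 2 * E) with hzdef
  have hz1 : peak ((Δ : ℝ) + E + (Δ + E) + 0) = z := by rw [hzdef]; congr 1; ring
  have hs := sum_div_mass hp
  have hlip : ∀ t : ℝ, 0 ≤ t → |peak (2 * Δ + t) - z|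
      ≤ peak (2 * Δ) / (2 * Δ) * |t - 2 * E| := by
    intro t ht
    refine (peak_lipschitz (δ := 2 * (Δ : ℝ)) (by positivity) (by linarith) (by linarith)).trans_eq ?_
    congr 2
    ring
  have hA : ∑ x, ∑ y, (p x : ℝ) / mass p * (p y / mass p) * peak (Δ + Δ + rowVar v (a x - a y)) - z
      ≤ peak (2 * Δ) / (2 * Δ) * ∑ x, ∑ y, (p x : ℝ) / mass p * (p y / mass p)
        * |rowVar v (a x - a y) - 2 * E| := by
    have hz2 : z = ∑ x, ∑ y, (p x : ℝ) / mass p * (p y / mass p) * z := by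
      simp only [← Finset.sum_mul, ← Finset.mul_sum, hs, mul_one, one_mul]
    nth_rewrite 1 [hz2]
    rw [← Finset.sum_sub_distrib, Finset.mul_sum]
    refine Finset.sum_le_sum fun x _ => ?_
    rw [← Finset.sum_sub_distrib, Finset.mul_sum]
    refine Finset.sum_le_sum fun y _ => ?_
    rw [← mul_sub, mul_left_comm]
    refine mul_le_mul_of_nonneg_left ?_ (by have := hp.le; positivity)
    rw [← two_mul]
    exact (le_abs_self _).trans (hlip _ (rowVar_nonneg _ _))
  have hB : z - ∑ x, (p x : ℝ) / mass p * peak (Δ + (Δ + E) + rowVar v (a x - meanSignal a p))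
      ≤ peak (2 * Δ) / (2 * Δ) * ∑ x, (p x : ℝ) / mass p
        * |rowVar v (a x - meanSignal a p) - E| := by
    have hz2 : z = ∑ x, (p x : ℝ) / mass p * z := by rw [← Finset.sum_mul, hs, one_mul]
    nth_rewrite 1 [hz2]
    rw [← Finset.sum_sub_distrib, Finset.mul_sum]
    refine Finset.sum_le_sum fun x _ => ?_
    rw [← mul_sub, mul_left_comm]
    refine mul_le_mul_of_nonneg_left ?_ (by have := hp.le; positivity)
    have h1 := hlip (E + rowVar v (a x - meanSignal a p)) (add_nonneg hE (rowVar_nonneg _ _))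
    rw [show E + rowVar v (a x - meanSignal a p) - 2 * E = rowVar v (a x - meanSignal a p) - E
      by ring, show 2 * (Δ : ℝ) + (E + rowVar v (a x - meanSignal a p))
        = Δ + (Δ + E) + rowVar v (a x - meanSignal a p) by ring, abs_sub_comm] at h1
    exact (le_abs_self _).trans h1
  rw [hz1, dispersion, mul_add, mul_left_comm _ (2 : ℝ)]
  linarith

/-- If the replica overlaps concentrate, then a measurement is almost as informative as under a
Gaussian posterior. -/
lemma exists_le_entropy_sub_expect_rowExp (ρ : ℝ≥0) {ε : ℝ} (hε : 0 < ε) :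
    ∃ A : ℝ, 0 ≤ A ∧ ∀ (C : Type) [Fintype C] (B : ℕ) (X : Type) [Fintype X]
      (a : X → C → Fin B → ℝ) (v : C → ℝ≥0) (p : X → ℝ≥0), 0 < mass p →
      (∀ x, rowVar v (a x - meanSignal a p) ≤ ρ) →
      mass p * (1 / 2 * Real.log (1 + postVar a v p / Δ) - ε - A * dispersion a v p)
        ≤ entropy p - (rowExp hΔ a v).expect (entropyF X) p := by
  have hΔ' : (0 : ℝ) < Δ := by exact_mod_cast pos_iff_ne_zero.2 hΔ
  set ε' := ε / (2 * Real.exp ((Δ + ρ) / 2)) with hε'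
  have hε'0 : 0 < ε' := by positivity
  obtain ⟨A, hA0, hA⟩ := exists_klTerm_le hΔ ρ hε'0
  refine ⟨A * (peak (2 * Δ) / (2 * Δ)), mul_nonneg hA0
    (div_nonneg (peak_pos (by positivity)).le (by positivity)), ?_⟩
  intro C _ B X _ a v p hp hR
  rw [entropy_sub_expect_rowExp hΔ a v hp, ← mul_sub]
  refine mul_le_mul_of_nonneg_left ?_ hp.le
  have hE := postVar_nonneg a v p
  have hσ := refVar_ne_zero hΔ a v (p := p)
  have hs := sum_div_mass hp
  have hEρ : postVar a v p ≤ ρ := by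
    unfold postVar
    rw [div_le_iff₀ hp]
    calc ∑ x, (p x : ℝ) * rowVar v (a x - meanSignal a p) ≤ ∑ x, (p x : ℝ) * ρ :=
          Finset.sum_le_sum fun x _ => mul_le_mul_of_nonneg_left (hR x) (p x).2
      _ = ρ * mass p := by rw [← Finset.sum_mul, mul_comm]; rfl
  have i1 := integrable_sq_mixPdf_sub hΔ a v hp
  have i2' := fun x : X => (integrable_rowPdf_mul v hΔ (a x) (meanSignal a p)
    (integrable_cosh_gaussianReal _)).const_mul ((p x : ℝ) / mass p)
  have i2 := integrable_finsetSum (Finset.univ : Finset X) fun x _ => i2' x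
  have i3 := integrable_rowPdf_mul v hσ (meanSignal a p) (meanSignal a p)
    (integrable_cosh_gaussianReal _)
  have key : ∫ ω, klTerm (mixPdf Δ a p ω) (refPdf Δ a v p ω) ∂((rowLaw B v).prod volume)
      ≤ ∫ ω, (A * (mixPdf Δ a p ω - refPdf Δ a v p ω) ^ 2
        + ε' * ((∑ x, (p x : ℝ) / mass p * (rowPdf Δ (a x) ω
          * Real.cosh (ω.2 - rowDot ω.1 (meanSignal a p))))
        + rowPdf (Δ + (postVar a v p).toNNReal) (meanSignal a p) ω
          * Real.cosh (ω.2 - rowDot ω.1 (meanSignal a p)))) ∂((rowLaw B v).prod volume) := by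
    refine integral_mono (integrable_klTerm hΔ a v hp)
      ((i1.const_mul A).add ((i2.add i3).const_mul ε')) fun ω => ?_
    have hq1 : mixPdf Δ a p ω ≤ peak Δ := by
      unfold mixPdf
      calc ∑ x, (p x : ℝ) / mass p * rowPdf Δ (a x) ω ≤ ∑ x, (p x : ℝ) / mass p * peak Δ :=
            Finset.sum_le_sum fun x _ => mul_le_mul_of_nonneg_left
              (gaussianPDFReal_le_peak _ _ _) (div_nonneg (p x).2 hp.le)
        _ = peak Δ := by rw [← Finset.sum_mul, hs, one_mul]
    have h := hA (postVar a v p).toNNReal (Real.toNNReal_le_iff_le_coe.2 hEρ)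
      (ω.2 - rowDot ω.1 (meanSignal a p)) _ (mixPdf_pos hΔ a hp ω).le hq1
    rw [← rowPdf_eq] at h
    refine h.trans_eq ?_
    simp only [refPdf, ← mul_assoc]
    rw [← Finset.sum_mul]
    change _ = _ + ε' * (mixPdf Δ a p ω * _ + _)
    ring
  have f1 := integral_add (i1.const_mul A) ((i2.add i3).const_mul ε')
  have f2 := integral_add i2 i3
  simp only [Pi.add_apply] at f1 f2
  rw [f1, integral_const_mul, integral_const_mul, f2, integral_finsetSum _ fun x _ => i2' x] at key
  simp only [integral_const_mul, integral_rowPdf_mul v hΔ _ _ (integrable_cosh_gaussianReal _),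
    integral_rowPdf_mul v hσ _ _ (integrable_cosh_gaussianReal _), integral_cosh_gaussianReal]
    at key
  have hz : rowVar v (meanSignal a p - meanSignal a p) = 0 := by simp [rowVar]
  have b1 : ∑ x, (p x : ℝ) / mass p * Real.exp
      (((rowVar v (a x - meanSignal a p)).toNNReal + Δ : ℝ≥0) / 2) ≤ Real.exp ((Δ + ρ) / 2) := by
    calc _ ≤ ∑ x, (p x : ℝ) / mass p * Real.exp ((Δ + ρ) / 2) := by
          refine Finset.sum_le_sum fun x _ => mul_le_mul_of_nonneg_left (Real.exp_le_exp.2 ?_)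
            (div_nonneg (p x).2 hp.le)
          push_cast
          rw [Real.coe_toNNReal _ (rowVar_nonneg _ _)]
          linarith [hR x]
      _ = _ := by rw [← Finset.sum_mul, hs, one_mul]
  have b2 : Real.exp (((rowVar v (meanSignal a p - meanSignal a p)).toNNReal
      + (Δ + (postVar a v p).toNNReal) : ℝ≥0) / 2) ≤ Real.exp ((Δ + ρ) / 2) := by
    rw [hz]
    refine Real.exp_le_exp.2 ?_
    push_cast
    rw [Real.coe_toNNReal _ hE]
    simp only [Real.toNNReal_zero, NNReal.coe_zero, zero_add]
    linarith
  have b3 := mul_le_mul_of_nonneg_left (integral_sq_mixPdf_sub_le hΔ a v hp) hA0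
  have b4 := mul_le_mul_of_nonneg_left (add_le_add b1 b2) hε'0.le
  have b5 : ε' * (Real.exp ((Δ + ρ) / 2) + Real.exp ((Δ + ρ) / 2)) = ε := by
    rw [hε']
    field_simp
    norm_num
  rw [b5] at b4
  rw [← mul_assoc] at b3
  linarith

end Row

end LinearEstimation

end

noncomputable section

namespace LinearEstimation

section PairInformation

variable {X Y Z : Type} [Fintype X] [Fintype Y] [DecidableEq Y] [Fintype Z] [DecidableEq Z]

/-- The mutual information of two functions of the parameter. -/
def pairInfo (f : X → Y) (g : X → Z) : Functional X :=
  marginalEntropy g - (reveal f).expect (marginalEntropy g)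

lemma pairInfo_apply (f : X → Y) (g : X → Z) (p : X → ℝ≥0) :
    pairInfo f g p = ∑ x, (p x : ℝ) * Real.log (marginal (fun x => (f x, g x)) p (f x, g x) /
      (marginal f p (f x) * marginal g p (g x) / mass p)) := by
  have h1 : ∀ y x, f x = y → marginal g (fun x => if f x = y then p x else 0) (g x)
      = marginal (fun x => (f x, g x)) p (f x, g x) := by
    rintro y x rfl
    refine Finset.sum_congr rfl fun x' _ => ?_
    simp only [Prod.mk.injEq]
    split_ifs with h1 h2 h3 h4 <;> simp_all
  rw [pairInfo, Functional.sub_apply, expect_reveal_apply]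
  simp only [marginalEntropy_apply, entropy_marginal, mass_ite]
  rw [Finset.sum_comm, ← Finset.sum_sub_distrib]
  refine Finset.sum_congr rfl fun x _ => ?_
  rw [Finset.sum_eq_single (f x)]
  · rw [h1 _ _ rfl]
    rcases eq_or_lt_of_le (zero_le : 0 ≤ p x) with h | h
    · simp [← h]
    · have e0 : (0 : ℝ) < mass p := by
        have : (0 : ℝ) < p x := by exact_mod_cast h
        exact this.trans_le (le_mass p x)
      have e1 : (0 : ℝ) < marginal f p (f x) := by exact_mod_cast h.trans_le (le_marginal f p x)
      have e2 : (0 : ℝ) < marginal g p (g x) := by exact_mod_cast h.trans_le (le_marginal g p x)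
      have e3 : (0 : ℝ) < marginal (fun x => (f x, g x)) p (f x, g x) := by
        exact_mod_cast h.trans_le (le_marginal (fun x => (f x, g x)) p x)
      simp only [if_true]
      rw [Real.log_div e0.ne' e2.ne', Real.log_div e1.ne' e3.ne',
        Real.log_div e3.ne' (by positivity), Real.log_div (by positivity) e0.ne',
        Real.log_mul e1.ne' e2.ne']
      ring
  · intro y _ hy
    simp [Ne.symm hy]
  · simp

/-- The distance in variation between the joint law of two functions of the parameter and the
product of their laws. -/
def correlation (f : X → Y) (g : X → Z) (p : X → ℝ≥0) : ℝ :=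
  ∑ z : Y × Z, |(marginal (fun x => (f x, g x)) p z : ℝ)
    - marginal f p z.1 * marginal g p z.2 / mass p|

lemma abs_sub_le_of_relEntropy {t r : ℝ} (ht : 0 ≤ t) (hr : 0 ≤ r) (htr : 0 < t → 0 < r) {η : ℝ}
    (hη : 0 < η) : |t - r| ≤ η * (t + r) + (t * Real.log (t / r) - t + r) / (2 * η) := by
  have h1 : (√t - √r) ^ 2 ≤ t * Real.log (t / r) - t + r := by
    rw [sub_sq, Real.sq_sqrt ht, Real.sq_sqrt hr]
    rcases eq_or_lt_of_le ht with h | h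
    · rw [← h]; simp
    · have hr' := htr h
      have h2 := Real.log_le_sub_one_of_pos (show 0 < √r / √t by positivity)
      have h3 : Real.log (t / r) = -(2 * Real.log (√r / √t)) := by
        rw [Real.log_div h.ne' hr'.ne', Real.log_div (by positivity) (by positivity),
          Real.log_sqrt hr, Real.log_sqrt ht]
        ring
      have h4 : t * (√r / √t - 1) = √t * √r - t := by
        have h6 := Real.mul_self_sqrt ht
        have h7 : √t ≠ 0 := by positivity
        rw [mul_sub, mul_one, mul_div_assoc', sub_left_inj, div_eq_iff h7]
        linear_combination -√r * h6
      have h5 := mul_le_mul_of_nonneg_left h2 h.le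
      rw [h4] at h5
      rw [h3]
      linarith
  have h2 : t - r = (√t - √r) * (√t + √r) := by
    nlinarith [Real.mul_self_sqrt ht, Real.mul_self_sqrt hr]
  have h3 : (√t + √r) ^ 2 ≤ 2 * (t + r) := by
    nlinarith [Real.mul_self_sqrt ht, Real.mul_self_sqrt hr, sq_nonneg (√t - √r)]
  have h4 : |t - r| ≤ (√t - √r) ^ 2 / (2 * η) + η * (√t + √r) ^ 2 / 2 := by
    rw [h2, abs_mul, abs_of_nonneg (show 0 ≤ √t + √r by positivity), ← sq_abs (√t - √r)]
    rw [div_add_div _ _ (by positivity) (by norm_num), le_div_iff₀ (by positivity)]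
    nlinarith [sq_nonneg (|√t - √r| - η * (√t + √r))]
  have h5 : (√t - √r) ^ 2 / (2 * η) ≤ (t * Real.log (t / r) - t + r) / (2 * η) := by gcongr
  nlinarith

/-- A form of Pinsker's inequality. -/
lemma correlation_le (f : X → Y) (g : X → Z) (p : X → ℝ≥0) {η : ℝ} (hη : 0 < η) :
    correlation f g p ≤ 2 * η * mass p + pairInfo f g p / (2 * η) := by
  have hP := mass_nonneg p
  have hz : ∀ z : Y × Z, (0 : ℝ) < marginal (fun x => (f x, g x)) p z →
      (0 : ℝ) < marginal f p z.1 * marginal g p z.2 / mass p := by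
    intro z hz
    have hz' : marginal (fun x => (f x, g x)) p z ≠ 0 := by
      intro h
      rw [h] at hz
      exact lt_irrefl _ hz
    obtain ⟨x, -, hx⟩ := Finset.exists_ne_zero_of_sum_ne_zero hz'
    rw [Ne, ite_eq_right_iff, Classical.not_imp] at hx
    obtain ⟨rfl, hx⟩ := hx
    have h : 0 < p x := pos_iff_ne_zero.2 hx
    have e0 : (0 : ℝ) < mass p := by
      have : (0 : ℝ) < p x := by exact_mod_cast h
      exact this.trans_le (le_mass p x)
    have e1 : (0 : ℝ) < marginal f p (f x) := by exact_mod_cast h.trans_le (le_marginal f p x)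
    have e2 : (0 : ℝ) < marginal g p (g x) := by exact_mod_cast h.trans_le (le_marginal g p x)
    positivity
  have hs1 : ∑ z : Y × Z, (marginal (fun x => (f x, g x)) p z : ℝ) = mass p :=
    mass_marginal (fun x => (f x, g x)) p
  have hs2 : ∑ z : Y × Z, (marginal f p z.1 * marginal g p z.2 / mass p : ℝ) = mass p := by
    rw [← Finset.sum_div, Fintype.sum_prod_type]
    simp only [← Finset.mul_sum, ← Finset.sum_mul]
    rw [show ∑ y, (marginal f p y : ℝ) = mass (marginal f p) from rfl,
      show ∑ y, (marginal g p y : ℝ) = mass (marginal g p) from rfl, mass_marginal, mass_marginal,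
      mul_self_div_self]
  have hs3 := sum_marginal_mul (fun x => (f x, g x)) p fun z =>
    Real.log (marginal (fun x => (f x, g x)) p z / (marginal f p z.1 * marginal g p z.2 / mass p))
  rw [← pairInfo_apply] at hs3
  unfold correlation
  refine (Finset.sum_le_sum fun z _ => abs_sub_le_of_relEntropy (NNReal.coe_nonneg _)
    (by positivity) (hz z) hη).trans_eq ?_
  rw [Finset.sum_add_distrib, ← Finset.mul_sum, Finset.sum_add_distrib, hs1, hs2,
    ← Finset.sum_div _ _ (2 * η), Finset.sum_add_distrib, Finset.sum_sub_distrib, hs1, hs2, hs3]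
  ring

/-- Covariances are bounded by the distance in variation. -/
lemma abs_sum_mul_le_correlation (f : X → Y) (g : X → Z) (p : X → ℝ≥0) (F : Y → ℝ) (G : Z → ℝ)
    {α β : ℝ} (hα : 0 ≤ α) (hF : ∀ x, |F (f x)| ≤ α) (hG : ∀ x, |G (g x)| ≤ β)
    (h0 : ∑ x, (p x : ℝ) * F (f x) = 0) :
    |∑ x, (p x : ℝ) * (F (f x) * G (g x))| ≤ α * β * correlation f g p := by
  classical
  set F' : Y → ℝ := fun y => if ∃ x, f x = y then F y else 0 with hF'
  set G' : Z → ℝ := fun z => if ∃ x, g x = z then G z else 0 with hG'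
  have eF : ∀ x, F' (f x) = F (f x) := fun x => if_pos ⟨x, rfl⟩
  have eG : ∀ x, G' (g x) = G (g x) := fun x => if_pos ⟨x, rfl⟩
  rcases isEmpty_or_nonempty X with hX | ⟨⟨x₀⟩⟩
  · simp [correlation, marginal]
  have hβ : 0 ≤ β := (abs_nonneg _).trans (hG x₀)
  have bF : ∀ y, |F' y| ≤ α := by
    intro y
    simp only [hF']
    split_ifs with h
    · obtain ⟨x, rfl⟩ := h; exact hF x
    · simpa using hα
  have bG : ∀ z, |G' z| ≤ β := by
    intro z
    simp only [hG']
    split_ifs with h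
    · obtain ⟨x, rfl⟩ := h; exact hG x
    · simpa using hβ
  have h1 := sum_marginal_mul (fun x => (f x, g x)) p fun z => F' z.1 * G' z.2
  have h2 : ∑ z : Y × Z, (marginal f p z.1 * marginal g p z.2 / mass p : ℝ) * (F' z.1 * G' z.2)
      = 0 := by
    have : ∀ z : Y × Z, (marginal f p z.1 * marginal g p z.2 / mass p : ℝ) * (F' z.1 * G' z.2)
        = (marginal f p z.1 * F' z.1) * (marginal g p z.2 * G' z.2 / mass p) := fun z => by ring
    simp only [this, Fintype.sum_prod_type, ← Finset.mul_sum, ← Finset.sum_mul]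
    rw [sum_marginal_mul f p F']
    simp only [eF, h0, zero_mul]
  simp only [eF, eG] at h1
  have h3 : ∑ x, (p x : ℝ) * (F (f x) * G (g x))
      = ∑ z : Y × Z, ((marginal (fun x => (f x, g x)) p z : ℝ)
        - marginal f p z.1 * marginal g p z.2 / mass p) * (F' z.1 * G' z.2) := by
    simp only [sub_mul, Finset.sum_sub_distrib, h2, h1, sub_zero]
  rw [h3, correlation, Finset.mul_sum]
  refine (Finset.abs_sum_le_sum_abs _ _).trans (Finset.sum_le_sum fun z _ => ?_)
  rw [abs_mul, abs_mul, mul_comm]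
  exact mul_le_mul_of_nonneg_right (mul_le_mul (bF _) (bG _) (abs_nonneg _) hα) (abs_nonneg _)

end PairInformation

end LinearEstimation

end

noncomputable section

namespace LinearEstimation

section Sections

variable {C : Type} [Fintype C] [DecidableEq C] {I : Type} [Fintype I] [DecidableEq I] {B : ℕ}

/-- The signal whose sections are the atoms numbered by `x`. -/
def signal (atom : I → Fin B → ℝ) (x : C → I) : C → Fin B → ℝ := fun l => atom (x l)

variable {atom : I → Fin B → ℝ} {A : ℝ} (hA : ∀ i b, |atom i b| ≤ A) (v : C → ℝ≥0)
  {p : (C → I) → ℝ≥0}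

include hA in
lemma abs_meanSignal_le (hp : 0 < mass p) (l : C) (b : Fin B) :
    |meanSignal (signal atom) p l b| ≤ A := by
  rw [meanSignal, abs_div, abs_of_pos hp, div_le_iff₀ hp]
  refine (Finset.abs_sum_le_sum_abs _ _).trans ?_
  rw [mass, Finset.mul_sum]
  refine Finset.sum_le_sum fun x _ => ?_
  rw [abs_mul, abs_of_nonneg (NNReal.coe_nonneg _), mul_comm]
  exact mul_le_mul_of_nonneg_right (hA _ _) (NNReal.coe_nonneg _)

include hA in
lemma abs_sub_meanSignal_le (hp : 0 < mass p) (i : I) (l : C) (b : Fin B) :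
    |atom i b - meanSignal (signal atom) p l b| ≤ 2 * A := by
  have h1 := abs_sub (atom i b) (meanSignal (signal atom) p l b)
  have h2 := abs_meanSignal_le hA hp l b
  have h3 := hA i b
  linarith

include hA in
lemma sum_sq_sub_meanSignal_le (hp : 0 < mass p) (i : I) (l : C) :
    ∑ b, (atom i b - meanSignal (signal atom) p l b) ^ 2 ≤ B * (2 * A) ^ 2 := by
  refine (Finset.sum_le_sum (g := fun _ => (2 * A) ^ 2) fun b _ => ?_).trans_eq (by simp)
  exact sq_le_sq' (abs_le.1 (abs_sub_meanSignal_le hA hp i l b)).1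
    (abs_le.1 (abs_sub_meanSignal_le hA hp i l b)).2

include hA in
lemma rowVar_sub_meanSignal_le (hp : 0 < mass p) (x : C → I) :
    rowVar v (signal atom x - meanSignal (signal atom) p) ≤ (∑ l, (v l : ℝ)) * (B * (2 * A) ^ 2) := by
  rw [rowVar, Finset.sum_mul]
  exact Finset.sum_le_sum fun l _ =>
    mul_le_mul_of_nonneg_left (sum_sq_sub_meanSignal_le hA hp (x l) l) (NNReal.coe_nonneg _)

include hA in
lemma postVar_le (hp : 0 < mass p) :
    postVar (signal atom) v p ≤ (∑ l, (v l : ℝ)) * (B * (2 * A) ^ 2) := by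
  rw [postVar, div_le_iff₀ hp]
  refine (Finset.sum_le_sum fun x _ => mul_le_mul_of_nonneg_left
    (rowVar_sub_meanSignal_le hA v hp x) (NNReal.coe_nonneg _)).trans_eq ?_
  rw [← Finset.sum_mul, mul_comm]
  rfl

/-- The weighted sum of the correlations between the sections. -/
def totalCorrelation (v : C → ℝ≥0) (p : (C → I) → ℝ≥0) : ℝ :=
  ∑ l, ∑ l', (v l : ℝ) * v l' * correlation (fun x => x l) (fun x => x l') p

lemma correlation_nonneg {X Y Z : Type} [Fintype X] [Fintype Y] [DecidableEq Y] [Fintype Z]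
    [DecidableEq Z] (f : X → Y) (g : X → Z) (p : X → ℝ≥0) : 0 ≤ correlation f g p :=
  Finset.sum_nonneg fun _ _ => abs_nonneg _

include hA in
lemma sum_sq_rowVar_sub_le (hp : 0 < mass p) :
    ∑ x, (p x : ℝ) * (rowVar v (signal atom x - meanSignal (signal atom) p)
      - postVar (signal atom) v p) ^ 2 ≤ (B * (2 * A) ^ 2) ^ 2 * totalCorrelation v p := by
  set m := meanSignal (signal atom) p with hm
  set f : C → I → ℝ := fun l i => ∑ b, (atom i b - m l b) ^ 2 with hf
  set e : C → ℝ := fun l => (∑ x, (p x : ℝ) * f l (x l)) / mass p with he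
  set ρ : ℝ := B * (2 * A) ^ 2 with hρ
  have hρ0 : 0 ≤ ρ := by positivity
  have hf0 : ∀ l i, 0 ≤ f l i := fun l i => Finset.sum_nonneg fun b _ => sq_nonneg _
  have hf1 : ∀ l i, f l i ≤ ρ := fun l i => sum_sq_sub_meanSignal_le hA hp i l
  have he0 : ∀ l, 0 ≤ e l := fun l => div_nonneg
    (Finset.sum_nonneg fun x _ => mul_nonneg (NNReal.coe_nonneg _) (hf0 _ _)) hp.le
  have he1 : ∀ l, e l ≤ ρ := fun l => by
    rw [he, div_le_iff₀ hp]
    refine (Finset.sum_le_sum fun x _ => mul_le_mul_of_nonneg_left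
      (hf1 _ _) (NNReal.coe_nonneg _)).trans_eq ?_
    rw [← Finset.sum_mul, mul_comm]
    rfl
  have hF : ∀ l (i : I), |f l i - e l| ≤ ρ := fun l i => abs_le.2
    ⟨by linarith [hf0 l i, he1 l], by linarith [hf1 l i, he0 l]⟩
  have h0 : ∀ l, ∑ x, (p x : ℝ) * (f l (x l) - e l) = 0 := fun l => by
    simp only [mul_sub, Finset.sum_sub_distrib, ← Finset.sum_mul]
    rw [show ∑ x, (p x : ℝ) = mass p from rfl, he, mul_div_cancel₀ _ hp.ne', sub_self]
  have hE : postVar (signal atom) v p = ∑ l, (v l : ℝ) * e l := by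
    rw [postVar, he]
    simp only [rowVar, ← mul_div_assoc, ← Finset.sum_div, Finset.mul_sum]
    rw [Finset.sum_comm]
    congr 1
    refine Finset.sum_congr rfl fun l _ => Finset.sum_congr rfl fun x _ => ?_
    simp only [hf, Finset.mul_sum]
    refine Finset.sum_congr rfl fun b _ => ?_
    simp only [Pi.sub_apply, signal]
    ring
  have hR : ∀ x, rowVar v (signal atom x - m) - postVar (signal atom) v p
      = ∑ l, (v l : ℝ) * (f l (x l) - e l) := fun x => by
    simp only [mul_sub, Finset.sum_sub_distrib, hE]
    rfl
  have hsq : ∀ x, (rowVar v (signal atom x - m) - postVar (signal atom) v p) ^ 2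
      = ∑ l, ∑ l', (v l : ℝ) * v l' * ((f l (x l) - e l) * (f l' (x l') - e l')) := fun x => by
    rw [hR, sq, Finset.sum_mul_sum]
    refine Finset.sum_congr rfl fun l _ => Finset.sum_congr rfl fun l' _ => ?_
    ring
  calc ∑ x, (p x : ℝ) * (rowVar v (signal atom x - m) - postVar (signal atom) v p) ^ 2
      = ∑ l, ∑ l', (v l : ℝ) * v l' *
          ∑ x, (p x : ℝ) * ((f l (x l) - e l) * (f l' (x l') - e l')) := by
        simp only [hsq, Finset.mul_sum]
        rw [Finset.sum_comm]
        refine Finset.sum_congr rfl fun l _ => ?_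
        rw [Finset.sum_comm]
        refine Finset.sum_congr rfl fun l' _ => Finset.sum_congr rfl fun x _ => ?_
        ring
    _ ≤ ∑ l, ∑ l', (v l : ℝ) * v l' *
          (ρ * ρ * correlation (fun x => x l) (fun x => x l') p) := by
        refine Finset.sum_le_sum fun l _ => Finset.sum_le_sum fun l' _ => ?_
        refine mul_le_mul_of_nonneg_left ?_ (by positivity)
        exact (le_abs_self _).trans (abs_sum_mul_le_correlation (fun x : C → I => x l)
          (fun x => x l') p (fun i => f l i - e l) (fun i => f l' i - e l') hρ0
          (fun x => hF _ _) (fun x => hF _ _) (h0 l))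
    _ = ρ ^ 2 * totalCorrelation v p := by
        simp only [totalCorrelation, Finset.mul_sum]
        refine Finset.sum_congr rfl fun l _ => Finset.sum_congr rfl fun l' _ => ?_
        ring

/-- The covariance of the measurements of two signals. -/
def rowCov (v : C → ℝ≥0) (d e : C → Fin B → ℝ) : ℝ := ∑ l, (v l : ℝ) * ∑ b, d l b * e l b

lemma rowVar_sub (d e : C → Fin B → ℝ) :
    rowVar v (d - e) = rowVar v d + rowVar v e - 2 * rowCov v d e := by
  simp only [rowVar, rowCov, Finset.mul_sum, ← Finset.sum_add_distrib, ← Finset.sum_sub_distrib]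
  refine Finset.sum_congr rfl fun l _ => Finset.sum_congr rfl fun b _ => ?_
  simp only [Pi.sub_apply]
  ring

include hA in
lemma sum_sq_rowCov_le (hp : 0 < mass p) :
    ∑ x, ∑ y, (p x : ℝ) * p y * rowCov v (signal atom x - meanSignal (signal atom) p)
      (signal atom y - meanSignal (signal atom) p) ^ 2
      ≤ mass p * ((B * (2 * A) ^ 2) ^ 2 * totalCorrelation v p) := by
  classical
  set m := meanSignal (signal atom) p with hm
  set κ : ℝ := (2 * A) ^ 2 with hκ
  have hκ0 : 0 ≤ κ := by positivity
  set g : C → Fin B → I → ℝ := fun l b i => atom i b - m l b with hg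
  have hgA : ∀ l b i, |g l b i| ≤ 2 * A := fun l b i => abs_sub_meanSignal_le hA hp i l b
  have h0 : ∀ l b, ∑ x, (p x : ℝ) * g l b (x l) = 0 := fun l b => by
    simp only [hg, mul_sub, Finset.sum_sub_distrib, ← Finset.sum_mul]
    rw [show ∑ x, (p x : ℝ) = mass p from rfl, hm, meanSignal, mul_div_cancel₀ _ hp.ne']
    simp only [signal, sub_self]
  have hcov : ∀ (l l' : C) (b b' : Fin B), (∑ x, (p x : ℝ) * (g l b (x l) * g l' b' (x l'))) ^ 2
      ≤ mass p * (κ ^ 2 * correlation (fun x => x l) (fun x => x l') p) := by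
    intro l l' b b'
    rcases isEmpty_or_nonempty I with hI | ⟨⟨i₀⟩⟩
    · exact absurd hp (by
        have : ∀ x : C → I, False := fun x => hI.elim (x l)
        simp [mass, Finset.sum_eq_zero fun x _ => (this x).elim])
    have hA0 : 0 ≤ 2 * A := (abs_nonneg _).trans (hgA l b i₀)
    have h1 := abs_sum_mul_le_correlation (fun x : C → I => x l) (fun x => x l') p
      (g l b) (g l' b') hA0 (fun x => hgA _ _ _) (fun x => hgA _ _ _) (h0 l b)
    have h2 : |∑ x, (p x : ℝ) * (g l b (x l) * g l' b' (x l'))| ≤ mass p * κ := by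
      refine (Finset.abs_sum_le_sum_abs _ _).trans ?_
      rw [mass, Finset.sum_mul]
      refine Finset.sum_le_sum fun x _ => ?_
      rw [abs_mul, abs_mul, abs_of_nonneg (NNReal.coe_nonneg _), hκ, sq (2 * A)]
      exact mul_le_mul_of_nonneg_left (mul_le_mul (hgA _ _ _) (hgA _ _ _) (abs_nonneg _) hA0)
        (NNReal.coe_nonneg _)
    rw [← sq_abs, sq]
    refine (mul_le_mul h2 h1 (abs_nonneg _) (by positivity)).trans_eq ?_
    rw [hκ]; ring
  have hexp : ∀ x y, rowCov v (signal atom x - m) (signal atom y - m) ^ 2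
      = ∑ l, ∑ l', ∑ b, ∑ b', (v l : ℝ) * v l' *
        ((g l b (x l) * g l' b' (x l')) * (g l b (y l) * g l' b' (y l'))) := by
    intro x y
    rw [rowCov, sq, Finset.sum_mul_sum]
    refine Finset.sum_congr rfl fun l _ => Finset.sum_congr rfl fun l' _ => ?_
    rw [mul_mul_mul_comm, Finset.sum_mul_sum, Finset.mul_sum]
    refine Finset.sum_congr rfl fun b _ => ?_
    rw [Finset.mul_sum]
    refine Finset.sum_congr rfl fun b' _ => ?_
    simp only [Pi.sub_apply, signal, hg]
    ring
  calc ∑ x, ∑ y, (p x : ℝ) * p y * rowCov v (signal atom x - m) (signal atom y - m) ^ 2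
      = ∑ l, ∑ l', ∑ b, ∑ b', (v l : ℝ) * v l' *
          (∑ x, (p x : ℝ) * (g l b (x l) * g l' b' (x l'))) ^ 2 := by
        simp only [hexp, sq (∑ x, (p x : ℝ) * _), Finset.sum_mul_sum]
        simp only [Finset.mul_sum]
        have sw : ∀ (F : (C → I) → (C → I) → C → C → Fin B → Fin B → ℝ),
            ∑ x, ∑ y, ∑ l, ∑ l', ∑ b, ∑ b', F x y l l' b b'
              = ∑ l, ∑ l', ∑ b, ∑ b', ∑ x, ∑ y, F x y l l' b b' := by
          intro F
          have := Finset.sum_comm (s := (Finset.univ : Finset ((C → I) × (C → I))))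
            (t := (Finset.univ : Finset (C × C × Fin B × Fin B)))
            (f := fun z w => F z.1 z.2 w.1 w.2.1 w.2.2.1 w.2.2.2)
          simpa only [Fintype.sum_prod_type] using this
        rw [sw]
        refine Finset.sum_congr rfl fun l _ => Finset.sum_congr rfl fun l' _ =>
          Finset.sum_congr rfl fun b _ => Finset.sum_congr rfl fun b' _ =>
          Finset.sum_congr rfl fun x _ => Finset.sum_congr rfl fun y _ => ?_
        ring
    _ ≤ ∑ l, ∑ l', ∑ _b : Fin B, ∑ _b' : Fin B, (v l : ℝ) * v l' *
          (mass p * (κ ^ 2 * correlation (fun x => x l) (fun x => x l') p)) := by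
        refine Finset.sum_le_sum fun l _ => Finset.sum_le_sum fun l' _ =>
          Finset.sum_le_sum fun b _ => Finset.sum_le_sum fun b' _ => ?_
        exact mul_le_mul_of_nonneg_left (hcov l l' b b') (by positivity)
    _ = mass p * ((B * κ) ^ 2 * totalCorrelation v p) := by
        simp only [totalCorrelation, Finset.mul_sum, Finset.sum_const, Finset.card_univ,
          Fintype.card_fin, nsmul_eq_mul]
        refine Finset.sum_congr rfl fun l _ => Finset.sum_congr rfl fun l' _ => ?_
        ring

lemma abs_le_add_sq_div {δ : ℝ} (hδ : 0 < δ) (z : ℝ) : |z| ≤ δ + z ^ 2 / δ := by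
  rw [← sub_le_iff_le_add', le_div_iff₀ hδ, ← sq_abs]
  nlinarith [sq_nonneg (|z| - δ)]

include hA in
lemma mass_mul_dispersion_le (hp : 0 < mass p) {δ : ℝ} (hδ : 0 < δ) :
    mass p * dispersion (signal atom) v p
      ≤ 6 * δ * mass p + 6 * (B * (2 * A) ^ 2) ^ 2 / δ * totalCorrelation v p := by
  have hW := sum_sq_rowVar_sub_le hA v hp
  have hQ := sum_sq_rowCov_le hA v hp
  have hπ := sum_div_mass hp
  set m := meanSignal (signal atom) p
  set E := postVar (signal atom) v p
  set T := (B * (2 * A) ^ 2) ^ 2 * totalCorrelation v p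
  set R : (C → I) → ℝ := fun x => rowVar v (signal atom x - m) with hR
  set Q : (C → I) → (C → I) → ℝ := fun x y => rowCov v (signal atom x - m) (signal atom y - m)
    with hQdef
  set π : (C → I) → ℝ := fun x => (p x : ℝ) / mass p with hπdef
  have hπ0 : ∀ x, 0 ≤ π x := fun x => div_nonneg (NNReal.coe_nonneg _) hp.le
  have hsub : ∀ x y, rowVar v (signal atom x - signal atom y) = R x + R y - 2 * Q x y := by
    intro x y
    rw [← rowVar_sub, sub_sub_sub_cancel_right]
  have h1 : ∑ x, π x * |R x - E| ≤ δ + T / (mass p * δ) := by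
    calc ∑ x, π x * |R x - E| ≤ ∑ x, π x * (δ + (R x - E) ^ 2 / δ) :=
          Finset.sum_le_sum fun x _ => mul_le_mul_of_nonneg_left (abs_le_add_sq_div hδ _) (hπ0 x)
      _ = (∑ x, π x) * δ + (∑ x, (p x : ℝ) * (R x - E) ^ 2) / (mass p * δ) := by
          rw [Finset.sum_mul, Finset.sum_div, ← Finset.sum_add_distrib]
          refine Finset.sum_congr rfl fun x _ => ?_
          simp only [hπdef]
          field_simp
      _ ≤ δ + T / (mass p * δ) := by
          rw [hπ, one_mul]
          gcongr
  have h2 : ∑ x, ∑ y, π x * π y * |Q x y| ≤ δ + T / (mass p * δ) := by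
    calc ∑ x, ∑ y, π x * π y * |Q x y| ≤ ∑ x, ∑ y, π x * π y * (δ + Q x y ^ 2 / δ) :=
          Finset.sum_le_sum fun x _ => Finset.sum_le_sum fun y _ =>
            mul_le_mul_of_nonneg_left (abs_le_add_sq_div hδ _) (mul_nonneg (hπ0 x) (hπ0 y))
      _ = (∑ x, π x) * (∑ y, π y) * δ
          + (∑ x, ∑ y, (p x : ℝ) * p y * Q x y ^ 2) / (mass p * mass p * δ) := by
          rw [Finset.sum_mul_sum, Finset.sum_mul, Finset.sum_div, ← Finset.sum_add_distrib]
          refine Finset.sum_congr rfl fun x _ => ?_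
          rw [Finset.sum_mul, Finset.sum_div, ← Finset.sum_add_distrib]
          refine Finset.sum_congr rfl fun y _ => ?_
          simp only [hπdef]
          field_simp
      _ ≤ δ + (mass p * T) / (mass p * mass p * δ) := by
          rw [hπ, one_mul, one_mul]
          gcongr
      _ = δ + T / (mass p * δ) := by field_simp
  have h3 : dispersion (signal atom) v p
      ≤ 4 * ∑ x, π x * |R x - E| + 2 * ∑ x, ∑ y, π x * π y * |Q x y| := by
    have h4 : ∑ x, ∑ y, π x * π y * |rowVar v (signal atom x - signal atom y) - 2 * E|
        ≤ ∑ x, ∑ y, (π x * |R x - E| * π y + π x * (π y * |R y - E|)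
          + 2 * (π x * π y * |Q x y|)) := by
      refine Finset.sum_le_sum fun x _ => Finset.sum_le_sum fun y _ => ?_
      have : |rowVar v (signal atom x - signal atom y) - 2 * E|
          ≤ |R x - E| + |R y - E| + 2 * |Q x y| := by
        rw [hsub]
        have e1 := abs_le.1 (le_refl |R x - E|)
        have e2 := abs_le.1 (le_refl |R y - E|)
        have e3 := abs_le.1 (le_refl |Q x y|)
        exact abs_le.2 ⟨by linarith, by linarith⟩
      refine (mul_le_mul_of_nonneg_left this (mul_nonneg (hπ0 x) (hπ0 y))).trans_eq (by ring)
    simp only [Finset.sum_add_distrib, ← Finset.mul_sum, ← Finset.sum_mul, hπ, one_mul,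
      mul_one] at h4
    unfold dispersion
    linarith
  have h5 : dispersion (signal atom) v p ≤ 6 * (δ + T / (mass p * δ)) := by linarith
  refine (mul_le_mul_of_nonneg_left h5 hp.le).trans_eq ?_
  simp only [T]
  field_simp

end Sections

end LinearEstimation

end

noncomputable section

namespace LinearEstimation

section Rows

variable {C : Type} [Fintype C] [DecidableEq C] {I : Type} [Fintype I] [DecidableEq I] {B : ℕ}

lemma Functional.apply_eq_zero {X : Type} [Fintype X] (F : Functional X) {p : X → ℝ≥0}
    (hp : mass p = 0) : F p = 0 := by
  obtain ⟨c, hc⟩ := F.2.2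
  have := hc p
  rw [hp, mul_zero] at this
  exact abs_nonpos_iff.1 this

/-- The expectation operator of one noisy measurement along a Gaussian row of variances `v`. -/
def rowOp {Δ : ℝ≥0} (hΔ : Δ ≠ 0) (atom : I → Fin B → ℝ) (v : C → ℝ≥0) : Ops (C → I) :=
  (rowExp hΔ (signal atom) v).expect

lemma isMarkov_rowOp {Δ : ℝ≥0} (hΔ : Δ ≠ 0) (atom : I → Fin B → ℝ) (v : C → ℝ≥0) :
    (rowOp hΔ atom v).IsMarkov := Ops.isMarkov_expect _

lemma rowOp_entropyF_le {Δ : ℝ≥0} (hΔ : Δ ≠ 0) (atom : I → Fin B → ℝ) (v : C → ℝ≥0)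
    (p : (C → I) → ℝ≥0) : rowOp hΔ atom v (entropyF _) p ≤ entropyF (C → I) p :=
  expect_entropyF_le _ p

/-- One measurement is worth a bounded amount of information. -/
lemma entropyF_le_rowOp_add {Δ : ℝ≥0} (hΔ : Δ ≠ 0) {atom : I → Fin B → ℝ} {A : ℝ}
    (hA : ∀ i b, |atom i b| ≤ A) (v : C → ℝ≥0) (p : (C → I) → ℝ≥0) :
    entropyF (C → I) p ≤ rowOp hΔ atom v (entropyF _) p
      + (∑ l, (v l : ℝ)) * (B * (2 * A) ^ 2) / (2 * Δ) * mass p := by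
  rcases eq_or_lt_of_le (mass_nonneg p) with h | h
  · rw [Functional.apply_eq_zero _ h.symm, Functional.apply_eq_zero _ h.symm, ← h]
    simp
  have hΔ' : (0 : ℝ) < Δ := by exact_mod_cast pos_iff_ne_zero.2 hΔ
  have h1 := entropy_sub_expect_rowExp_le hΔ (signal atom) v h
  have h2 := postVar_le hA v h
  have h3 := postVar_nonneg (signal atom) v p
  have h4 := Real.log_le_sub_one_of_pos (show 0 < 1 + postVar (signal atom) v p / Δ by positivity)
  have h5 : 1 / 2 * Real.log (1 + postVar (signal atom) v p / Δ)
      ≤ (∑ l, (v l : ℝ)) * (B * (2 * A) ^ 2) / (2 * Δ) := by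
    have : postVar (signal atom) v p / Δ ≤ (∑ l, (v l : ℝ)) * (B * (2 * A) ^ 2) / Δ := by gcongr
    have e : (∑ l, (v l : ℝ)) * (B * (2 * A) ^ 2) / (2 * Δ)
        = 1 / 2 * ((∑ l, (v l : ℝ)) * (B * (2 * A) ^ 2) / Δ) := by field_simp
    rw [e]
    linarith
  have h6 := mul_le_mul_of_nonneg_left h5 h.le
  change entropy p - rowOp hΔ atom v (entropyF _) p ≤ _ at h1
  rw [entropyF_apply]
  linarith

variable (C I) in
/-- The operator that reveals a section chosen at random. -/
def revealRandom : Ops (C → I) :=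
  ∑ l : C, (1 / (Fintype.card C : ℝ)) • (reveal fun x : C → I => x l).expect

variable (C I) in
/-- The average entropy of a section. -/
def meanEntropy : Functional (C → I) :=
  ∑ l : C, (1 / (Fintype.card C : ℝ)) • marginalEntropy fun x : C → I => x l

variable (C I) in
/-- The average information that a section gives about another one. -/
def redundancy : Functional (C → I) := (1 - revealRandom C I) (meanEntropy C I)

lemma redundancy_apply (p : (C → I) → ℝ≥0) : redundancy C I p = 1 / (Fintype.card C : ℝ) ^ 2 *
    ∑ l : C, ∑ l' : C, pairInfo (fun x : C → I => x l) (fun x => x l') p := by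
  rcases isEmpty_or_nonempty C with hC | hC
  · simp [redundancy, meanEntropy, revealRandom, Ops.one_apply]
  have hc : (Fintype.card C : ℝ) ≠ 0 := by exact_mod_cast Fintype.card_ne_zero
  have h : redundancy C I = ∑ l : C, ∑ l' : C, (1 / (Fintype.card C : ℝ) ^ 2) •
      pairInfo (fun x : C → I => x l) (fun x => x l') := by
    unfold redundancy meanEntropy revealRandom
    simp only [Ops.sub_apply, Ops.one_apply, Ops.sum_apply, Ops.smul_apply, Ops.map_sum,
      Ops.map_smul, pairInfo, smul_sub, Finset.sum_sub_distrib, smul_smul, Finset.smul_sum]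
    congr 1
    · rw [Finset.sum_const, Finset.card_univ, ← Nat.cast_smul_eq_nsmul ℝ, Finset.smul_sum]
      refine Finset.sum_congr rfl fun l _ => ?_
      rw [smul_smul]
      congr 1
      field_simp
    · rw [Finset.sum_comm]
      refine Finset.sum_congr rfl fun l _ => Finset.sum_congr rfl fun l' _ => ?_
      congr 1
      field_simp
  rw [h]
  simp only [Functional.sum_apply, Functional.smul_apply, Finset.mul_sum]

lemma totalCorrelation_le {c : ℝ} (v : C → ℝ≥0)
    (hv : ∀ l, (v l : ℝ) * Fintype.card C ≤ c) (p : (C → I) → ℝ≥0) {η : ℝ} (hη : 0 < η) :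
    totalCorrelation v p ≤ c ^ 2 * (2 * η * mass p + redundancy C I p / (2 * η)) := by
  rcases isEmpty_or_nonempty C with hC | hC
  · have := mass_nonneg p
    simp only [totalCorrelation, redundancy_apply, Finset.univ_eq_empty, Finset.sum_empty, mul_zero,
      zero_div, add_zero]
    positivity
  have hc : (0 : ℝ) < Fintype.card C := by exact_mod_cast Fintype.card_pos
  have hv' : ∀ l, (v l : ℝ) ≤ c / Fintype.card C := fun l => by
    rw [le_div_iff₀ hc]; exact hv l
  have hc0 : 0 ≤ c / Fintype.card C := (NNReal.coe_nonneg (v (Classical.arbitrary C))).trans (hv' _)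
  calc totalCorrelation v p
      ≤ ∑ l : C, ∑ l' : C, c / Fintype.card C * (c / Fintype.card C) * (2 * η * mass p
          + pairInfo (fun x : C → I => x l) (fun x => x l') p / (2 * η)) := by
        refine Finset.sum_le_sum fun l _ => Finset.sum_le_sum fun l' _ => ?_
        exact mul_le_mul (mul_le_mul (hv' l) (hv' l') (NNReal.coe_nonneg _) hc0)
          (correlation_le _ _ p hη) (correlation_nonneg _ _ _) (by positivity)
    _ = c ^ 2 * (2 * η * mass p + redundancy C I p / (2 * η)) := by
        rw [redundancy_apply]
        simp only [← Finset.mul_sum, Finset.sum_add_distrib, ← Finset.sum_div, Finset.sum_const,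
          Finset.card_univ, nsmul_eq_mul]
        field_simp

lemma exists_rowOp_entropyF_le {Δ : ℝ≥0} (hΔ : Δ ≠ 0) (atom : I → Fin B → ℝ) {c : ℝ} (hc : 0 ≤ c)
    {ε : ℝ} (hε : 0 < ε) : ∃ K : ℝ, 0 ≤ K ∧ ∀ (C : Type) [Fintype C] [DecidableEq C] (v : C → ℝ≥0),
      (∀ l, (v l : ℝ) * Fintype.card C ≤ c) → ∀ p : (C → I) → ℝ≥0,
        rowOp hΔ atom v (entropyF _) p + mass p * (1 / 2 * Real.log (1 + postVar (signal atom) v p / Δ))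
          ≤ entropyF _ p + ε * mass p + K * redundancy C I p := by
  obtain ⟨A, hA⟩ : ∃ A : ℝ, ∀ i b, |atom i b| ≤ A := by
    refine ⟨∑ i, ∑ b, |atom i b|, fun i b => ?_⟩
    exact (Finset.single_le_sum (f := fun b => |atom i b|) (fun _ _ => abs_nonneg _)
      (Finset.mem_univ b)).trans (Finset.single_le_sum (f := fun i => ∑ b, |atom i b|)
        (fun _ _ => Finset.sum_nonneg fun _ _ => abs_nonneg _) (Finset.mem_univ i))
  set ρ : ℝ := B * (2 * A) ^ 2 with hρ
  have hρ0 : 0 ≤ ρ := by positivity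
  obtain ⟨K, hK0, hK⟩ := exists_le_entropy_sub_expect_rowExp hΔ (c * ρ).toNNReal (half_pos hε)
  set D : ℝ := 6 + 12 * ρ ^ 2 * c ^ 2 with hD
  have hD0 : 0 < D := by positivity
  set δ : ℝ := ε / (2 * (K + 1) * D) with hδ
  have hδ0 : 0 < δ := by positivity
  have hKδ : K * (δ * D) ≤ ε / 2 := by
    have : δ * D = ε / (2 * (K + 1)) := by rw [hδ]; field_simp
    rw [this, mul_div_assoc', div_le_div_iff₀ (by positivity) (by norm_num)]
    nlinarith
  refine ⟨K * (3 * ρ ^ 2 * c ^ 2 / δ ^ 3), by positivity, fun C _ _ v hv p => ?_⟩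
  rcases eq_or_lt_of_le (mass_nonneg p) with h | hp
  · simp [Functional.apply_eq_zero _ h.symm, ← h]
  have hsum : ∑ l, (v l : ℝ) ≤ c := by
    rcases isEmpty_or_nonempty C with hC | hC
    · simpa using hc
    · have hN : (0 : ℝ) < Fintype.card C := by exact_mod_cast Fintype.card_pos
      refine (Finset.sum_le_sum fun l _ => (le_div_iff₀ hN).2 (hv l)).trans_eq ?_
      rw [Finset.sum_const, Finset.card_univ, nsmul_eq_mul, mul_div_cancel₀ _ hN.ne']
  have h1 := hK C B (C → I) (signal atom) v p hp fun x => by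
    rw [Real.coe_toNNReal _ (by positivity)]
    exact (rowVar_sub_meanSignal_le hA v hp x).trans (by gcongr)
  have h2 := mass_mul_dispersion_le hA v hp hδ0
  have h3 := totalCorrelation_le v hv p (show 0 < δ ^ 2 by positivity)
  have h4 : mass p * dispersion (signal atom) v p
      ≤ δ * D * mass p + 3 * ρ ^ 2 * c ^ 2 / δ ^ 3 * redundancy C I p := by
    refine h2.trans ((add_le_add_right (mul_le_mul_of_nonneg_left h3 (by positivity)) _).trans_eq ?_)
    rw [hD]
    field_simp
    ring
  have h5 := mul_le_mul_of_nonneg_left h4 hK0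
  have h6 := mul_le_mul_of_nonneg_right hKδ hp.le
  change _ ≤ entropy p - rowOp hΔ atom v (entropyF _) p at h1
  rw [entropyF_apply]
  nlinarith

/-- A linear combination of variance profiles. -/
def mixVar {τ : Type} [Fintype τ] (w : τ → ℝ≥0) (V : τ → C → ℝ≥0) (l : C) : ℝ≥0 := ∑ t, w t * V t l

lemma postVar_mixVar {X τ : Type} [Fintype X] [Fintype τ] (a : X → C → Fin B → ℝ) (w : τ → ℝ≥0)
    (V : τ → C → ℝ≥0) (p : X → ℝ≥0) :
    postVar a (mixVar w V) p = ∑ t, (w t : ℝ) * postVar a (V t) p := by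
  have h : ∀ d : C → Fin B → ℝ, rowVar (mixVar w V) d = ∑ t, (w t : ℝ) * rowVar (V t) d := by
    intro d
    simp only [rowVar, mixVar, NNReal.coe_sum, NNReal.coe_mul, Finset.sum_mul]
    rw [Finset.sum_comm]
    simp only [mul_assoc, Finset.mul_sum]
  simp only [postVar, h, Finset.mul_sum, mul_div_assoc', ← Finset.sum_div]
  rw [Finset.sum_comm]
  congr 1
  refine Finset.sum_congr rfl fun t _ => Finset.sum_congr rfl fun x _ => ?_
  ring

/-- A measurement along a row of mixed variances is almost as informative as a measurement along
a row whose variances are drawn at random. -/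
lemma exists_rowOp_mixVar_le {Δ : ℝ≥0} (hΔ : Δ ≠ 0) (atom : I → Fin B → ℝ) {c : ℝ} (hc : 0 ≤ c)
    {ε : ℝ} (hε : 0 < ε) : ∃ K : ℝ, 0 ≤ K ∧ ∀ (C : Type) [Fintype C] [DecidableEq C]
      (τ : Type) [Fintype τ] (w : τ → ℝ≥0) (V : τ → C → ℝ≥0), ∑ t, w t = 1 →
      (∀ l, (mixVar w V l : ℝ) * Fintype.card C ≤ c) → ∀ p : (C → I) → ℝ≥0,
        rowOp hΔ atom (mixVar w V) (entropyF _) p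
          ≤ (∑ t, (w t : ℝ) • rowOp hΔ atom (V t)) (entropyF _) p
            + (ε * mass p + K * redundancy C I p) := by
  obtain ⟨K, hK0, hK⟩ := exists_rowOp_entropyF_le hΔ atom hc hε
  refine ⟨K, hK0, fun C _ _ τ _ w V hw hv p => ?_⟩
  rcases eq_or_lt_of_le (mass_nonneg p) with h | hp
  · simp [Functional.apply_eq_zero _ h.symm, ← h]
  have hΔ' : (0 : ℝ) < Δ := by exact_mod_cast pos_iff_ne_zero.2 hΔ
  have hw' : ∑ t, (w t : ℝ) = 1 := by exact_mod_cast hw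
  have h1 := hK C (mixVar w V) hv p
  have h2 : ∑ t, (w t : ℝ) * Real.log (1 + postVar (signal atom) (V t) p / Δ)
      ≤ Real.log (1 + postVar (signal atom) (mixVar w V) p / Δ) := by
    have := strictConcaveOn_log_Ioi.concaveOn.le_map_sum (t := Finset.univ)
      (w := fun t => (w t : ℝ)) (p := fun t => 1 + postVar (signal atom) (V t) p / Δ)
      (fun t _ => NNReal.coe_nonneg _) hw' (fun t _ => by
        have := postVar_nonneg (signal atom) (V t) p
        exact Set.mem_Ioi.2 (by positivity))
    simp only [smul_eq_mul, mul_add, mul_one, Finset.sum_add_distrib, hw', mul_div_assoc',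
      ← Finset.sum_div] at this
    rwa [postVar_mixVar]
  have h3 : ∀ t, entropyF _ p - mass p * (1 / 2 * Real.log (1 + postVar (signal atom) (V t) p / Δ))
      ≤ rowOp hΔ atom (V t) (entropyF _) p := fun t => by
    have := entropy_sub_expect_rowExp_le hΔ (signal atom) (V t) hp
    change entropy p - rowOp hΔ atom (V t) (entropyF _) p ≤ _ at this
    rw [entropyF_apply]
    linarith
  have h4 : (∑ t, (w t : ℝ) • rowOp hΔ atom (V t)) (entropyF _) p
      = ∑ t, (w t : ℝ) * rowOp hΔ atom (V t) (entropyF _) p := by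
    rw [Ops.sum_apply, Functional.sum_apply]
    rfl
  have h5 := Finset.sum_le_sum fun t (_ : t ∈ Finset.univ) =>
    mul_le_mul_of_nonneg_left (h3 t) (NNReal.coe_nonneg (w t))
  have h6 : ∑ t, (w t : ℝ) * (entropyF _ p
      - mass p * (1 / 2 * Real.log (1 + postVar (signal atom) (V t) p / Δ)))
      = entropyF _ p - mass p * (1 / 2 *
        ∑ t, (w t : ℝ) * Real.log (1 + postVar (signal atom) (V t) p / Δ)) := by
    simp only [mul_sub, Finset.sum_sub_distrib, ← Finset.sum_mul, hw', one_mul, Finset.mul_sum]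
    congr 1
    refine Finset.sum_congr rfl fun t _ => ?_
    ring
  rw [h6] at h5
  rw [h4]
  have h7 := mul_le_mul_of_nonneg_left h2 (show 0 ≤ mass p * (1 / 2) by positivity)
  nlinarith

end Rows

section Pinning

variable {C : Type} [Fintype C] [DecidableEq C] {I : Type} [Fintype I] [DecidableEq I] {B : ℕ}

lemma isMarkov_revealRandom [Nonempty C] : (revealRandom C I).IsMarkov := by
  refine Ops.isMarkov_sum (fun _ _ => by positivity) ?_ fun _ _ => Ops.isMarkov_expect _
  rw [Finset.sum_const, Finset.card_univ, nsmul_eq_mul, mul_one_div_cancel]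
  exact_mod_cast Fintype.card_ne_zero

lemma meanEntropy_nonneg (p : (C → I) → ℝ≥0) : 0 ≤ meanEntropy C I p := by
  rw [meanEntropy, Functional.sum_apply]
  exact Finset.sum_nonneg fun l _ => mul_nonneg (by positivity) (marginalEntropy_nonneg _ _)

lemma meanEntropy_le (p : (C → I) → ℝ≥0) :
    meanEntropy C I p ≤ Real.log (Fintype.card I) * mass p := by
  have h0 : 0 ≤ Real.log (Fintype.card I) * mass p :=
    mul_nonneg (Real.log_natCast_nonneg _) (mass_nonneg p)
  rw [meanEntropy, Functional.sum_apply]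
  simp only [Functional.smul_apply, ← Finset.mul_sum]
  rcases isEmpty_or_nonempty C with hC | hC
  · simpa using h0
  have hN : (0 : ℝ) < Fintype.card C := by exact_mod_cast Fintype.card_pos
  rw [one_div, inv_mul_le_iff₀ hN]
  refine (Finset.sum_le_sum fun l _ => marginalEntropy_le (fun x : C → I => x l) p).trans_eq ?_
  rw [Finset.sum_const, Finset.card_univ, nsmul_eq_mul]

lemma revealRandom_entropyF [Nonempty C] :
    revealRandom C I (entropyF _) = entropyF _ - meanEntropy C I := by
  have hN : (Fintype.card C : ℝ) ≠ 0 := by exact_mod_cast Fintype.card_ne_zero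
  rw [revealRandom, meanEntropy, Ops.sum_apply]
  simp only [Ops.smul_apply, expect_reveal_entropyF, smul_sub, Finset.sum_sub_distrib]
  rw [Finset.sum_const, Finset.card_univ, ← Nat.cast_smul_eq_nsmul ℝ, smul_smul,
    mul_one_div_cancel hN, one_smul]

variable (C I) in
/-- The operator that reveals a random number, less than `θ`, of random sections. -/
def pinning (θ : ℕ) : Ops (C → I) := ∑ j ∈ Finset.range θ, (1 / (θ : ℝ)) • revealRandom C I ^ j

lemma isMarkov_pinning [Nonempty C] {θ : ℕ} (hθ : 0 < θ) : (pinning C I θ).IsMarkov := by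
  refine Ops.isMarkov_sum (fun _ _ => by positivity) ?_ fun j _ => isMarkov_revealRandom.pow j
  rw [Finset.sum_const, Finset.card_range, nsmul_eq_mul, mul_one_div_cancel]
  exact_mod_cast hθ.ne'

lemma pinning_redundancy_le [Nonempty C] {θ : ℕ} (hθ : 0 < θ) (p : (C → I) → ℝ≥0) :
    pinning C I θ (redundancy C I) p ≤ Real.log (Fintype.card I) / θ * mass p := by
  have hθ' : (0 : ℝ) < θ := by exact_mod_cast hθ
  have h1 : pinning C I θ * (1 - revealRandom C I)
      = (1 / (θ : ℝ)) • (1 - revealRandom C I ^ θ) := by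
    rw [pinning, ← Finset.smul_sum, smul_mul_assoc, geom_sum_mul_neg]
  have h2 : pinning C I θ (redundancy C I) p
      = 1 / (θ : ℝ) * (meanEntropy C I p - (revealRandom C I ^ θ) (meanEntropy C I) p) := by
    rw [redundancy, ← Ops.mul_apply, h1]
    rfl
  have h3 := (isMarkov_revealRandom (C := C) (I := I)).pow θ |>.nonneg _ meanEntropy_nonneg p
  have h4 := meanEntropy_le p
  rw [h2, one_div, inv_mul_le_iff₀ hθ', ← mul_assoc, mul_div_cancel₀ _ hθ'.ne']
  linarith

lemma revealRandom_pow_entropyF_bounds [Nonempty C] (j : ℕ) (p : (C → I) → ℝ≥0) :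
    (revealRandom C I ^ j) (entropyF _) p ≤ entropyF _ p ∧
    entropyF _ p ≤ (revealRandom C I ^ j) (entropyF _) p
      + j * Real.log (Fintype.card I) * mass p := by
  induction j generalizing p with
  | zero => simp [Ops.one_apply]
  | succ j ih =>
    have h1 : (revealRandom C I ^ (j + 1)) (entropyF _) p
        = (revealRandom C I ^ j) (entropyF _) p
          - (revealRandom C I ^ j) (meanEntropy C I) p := by
      rw [pow_succ, Ops.mul_apply, revealRandom_entropyF, Ops.map_sub]
      rfl
    have hm := (isMarkov_revealRandom (C := C) (I := I)).pow j
    have h2 := hm.nonneg _ meanEntropy_nonneg p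
    have h3 := hm.mono (f := meanEntropy C I) (g := Real.log (Fintype.card I) • massF _)
      (fun q => meanEntropy_le q) p
    rw [hm.smul_mass] at h3
    have h4 := ih p
    rw [h1]
    push_cast
    constructor <;> nlinarith

lemma pinning_apply (θ : ℕ) (F : Functional (C → I)) (p : (C → I) → ℝ≥0) :
    pinning C I θ F p = ∑ j ∈ Finset.range θ, 1 / (θ : ℝ) * (revealRandom C I ^ j) F p := by
  rw [pinning, Ops.sum_apply, Functional.sum_apply]
  rfl

lemma pinning_entropyF_le [Nonempty C] {θ : ℕ} (hθ : 0 < θ) (p : (C → I) → ℝ≥0) :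
    pinning C I θ (entropyF _) p ≤ entropyF _ p := by
  have hθ' : (θ : ℝ) ≠ 0 := by exact_mod_cast hθ.ne'
  rw [pinning_apply]
  refine (Finset.sum_le_sum fun j _ => mul_le_mul_of_nonneg_left
    (revealRandom_pow_entropyF_bounds j p).1 (by positivity)).trans_eq ?_
  rw [Finset.sum_const, Finset.card_range, nsmul_eq_mul]
  field_simp

lemma entropyF_le_pinning_add [Nonempty C] {θ : ℕ} (hθ : 0 < θ) (p : (C → I) → ℝ≥0) :
    entropyF _ p ≤ pinning C I θ (entropyF _) p + θ * Real.log (Fintype.card I) * mass p := by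
  have hθ' : (θ : ℝ) ≠ 0 := by exact_mod_cast hθ.ne'
  have h : ∀ j ∈ Finset.range θ, 1 / (θ : ℝ) * (entropyF _ p
      - θ * Real.log (Fintype.card I) * mass p)
      ≤ 1 / (θ : ℝ) * (revealRandom C I ^ j) (entropyF _) p := by
    intro j hj
    refine mul_le_mul_of_nonneg_left ?_ (by positivity)
    have h1 := (revealRandom_pow_entropyF_bounds j p).2
    have h2 : (j : ℝ) * Real.log (Fintype.card I) * mass p
        ≤ θ * Real.log (Fintype.card I) * mass p := by
      have h3 := Real.log_natCast_nonneg (Fintype.card I)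
      have h4 := mass_nonneg p
      have h5 : (j : ℝ) ≤ θ := by exact_mod_cast (Finset.mem_range.1 hj).le
      gcongr
    linarith
  have h1 := Finset.sum_le_sum h
  rw [← pinning_apply, Finset.sum_const, Finset.card_range, nsmul_eq_mul, ← mul_assoc,
    mul_one_div_cancel hθ', one_mul] at h1
  linarith

lemma prod_apply_le {X ι : Type} [Fintype X] {T M : ι → Ops X} {G : Functional X} {κ : ℝ}
    (hT : ∀ i, (T i).IsMarkov) (hM : ∀ i, (M i).IsMarkov)
    (h : ∀ i (Q : Ops X), Q.IsMarkov → ∀ p, (Q * T i) G p ≤ (Q * M i) G p + κ * mass p)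
    (s : Finset ι) (Q : Ops X) (hQ : Q.IsMarkov) (p : X → ℝ≥0) :
    (Q * ∏ i ∈ s, T i) G p ≤ (Q * ∏ i ∈ s, M i) G p + s.card * κ * mass p := by
  classical
  induction s using Finset.induction_on generalizing Q with
  | empty => simp
  | insert i s hi ih =>
    rw [Finset.prod_insert hi, Finset.prod_insert hi, Finset.card_insert_of_notMem hi,
      ← mul_assoc, ← mul_assoc]
    have h1 := ih (Q * T i) (hQ.mul (hT i))
    have h2 := h i (Q * ∏ i ∈ s, M i) (hQ.mul (Ops.isMarkov_prod fun i _ => hM i)) p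
    rw [mul_right_comm Q, mul_right_comm Q (∏ i ∈ s, M i)] at h2
    push_cast
    linarith

/-- The rows of a system can be drawn at random at a small cost. -/
theorem exists_prod_rowOp_mixVar_le {Δ : ℝ≥0} (hΔ : Δ ≠ 0) (atom : I → Fin B → ℝ) {c : ℝ}
    (hc : 0 ≤ c) {ε : ℝ} (hε : 0 < ε) : ∃ K : ℝ, 0 ≤ K ∧ ∀ (C : Type) [Fintype C] [DecidableEq C]
      [Nonempty C] (R : Type) [Fintype R] (τ : Type) [Fintype τ] (w : R → τ → ℝ≥0)
      (V : τ → C → ℝ≥0), (∀ μ, ∑ t, w μ t = 1) →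
      (∀ μ l, (mixVar (w μ) V l : ℝ) * Fintype.card C ≤ c) → ∀ S : Ops (C → I), S.IsMarkov →
      ∀ θ : ℕ, 0 < θ → ∀ p : (C → I) → ℝ≥0,
        (∏ μ, rowOp hΔ atom (mixVar (w μ) V)) (S (entropyF _)) p
          ≤ (∏ μ, ∑ t, (w μ t : ℝ) • rowOp hΔ atom (V t)) (S (entropyF _)) p
            + (Fintype.card R * (ε + K * (Real.log (Fintype.card I) / θ))
              + θ * Real.log (Fintype.card I)) * mass p := by
  obtain ⟨K, hK0, hK⟩ := exists_rowOp_mixVar_le hΔ atom hc hε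
  refine ⟨K, hK0, fun C _ _ _ R _ τ _ w V hw hv S hS θ hθ p => ?_⟩
  have hT : ∀ μ, (rowOp hΔ atom (mixVar (w μ) V)).IsMarkov := fun μ => isMarkov_rowOp _ _ _
  have hM : ∀ μ, (∑ t, (w μ t : ℝ) • rowOp hΔ atom (V t)).IsMarkov := fun μ =>
    Ops.isMarkov_sum (fun _ _ => NNReal.coe_nonneg _) (by exact_mod_cast hw μ)
      fun t _ => isMarkov_rowOp _ _ _
  have hP := isMarkov_pinning (C := C) (I := I) hθ
  have hTS := (Ops.isMarkov_prod (s := Finset.univ) fun μ _ => hT μ).mul hS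
  have hMS := (Ops.isMarkov_prod (s := Finset.univ) fun μ _ => hM μ).mul hS
  have h1 := prod_apply_le (G := S (pinning C I θ (entropyF _)))
    (κ := ε + K * (Real.log (Fintype.card I) / θ)) hT hM (fun μ Q hQ q => ?_) Finset.univ 1
    Ops.isMarkov_one p
  · rw [one_mul, one_mul, Finset.card_univ] at h1
    have h2 := hTS.mono (f := entropyF _) (g := pinning C I θ (entropyF _)
      + (θ * Real.log (Fintype.card I)) • massF _) (fun q => entropyF_le_pinning_add hθ q) p
    rw [Ops.map_add, Functional.add_apply, hTS.smul_mass] at h2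
    have h3 := hMS.mono (fun q => pinning_entropyF_le (C := C) (I := I) hθ q) p
    simp only [Ops.mul_apply] at h1 h2 h3
    linarith
  · have hQ' := (hQ.mul hS).mul hP
    have h2 := hQ'.mono (f := rowOp hΔ atom (mixVar (w μ) V) (entropyF _))
      (g := (∑ t, (w μ t : ℝ) • rowOp hΔ atom (V t)) (entropyF _)
        + (ε • massF _ + K • redundancy C I)) (fun q => hK C τ (w μ) V (hw μ) (hv μ) q) q
    have h3 := (hQ.mul hS).mono (f := pinning C I θ (redundancy C I))
      (g := (Real.log (Fintype.card I) / θ) • massF _) (pinning_redundancy_le hθ) q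
    rw [(hQ.mul hS).smul_mass] at h3
    rw [Ops.map_add, Functional.add_apply, Ops.map_add, Functional.add_apply, hQ'.smul_mass,
      Ops.map_smul, Functional.smul_apply, ← Ops.mul_apply, ← Ops.mul_apply] at h2
    have e : ∀ T : Ops (C → I), Q * S * pinning C I θ * T = Q * T * (S * pinning C I θ) := fun T => by
      ring
    rw [e, e] at h2
    have h4 := mul_le_mul_of_nonneg_left h3 hK0
    have h5 : (Q * S * pinning C I θ) (redundancy C I) q
        = (Q * S) (pinning C I θ (redundancy C I)) q := rfl
    rw [h5] at h2
    change (Q * rowOp hΔ atom (mixVar (w μ) V) * (S * pinning C I θ)) (entropyF _) q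
      ≤ (Q * (∑ t, (w μ t : ℝ) • rowOp hΔ atom (V t)) * (S * pinning C I θ)) (entropyF _) q + _
    linarith

end Pinning

end LinearEstimation

end

noncomputable section

namespace LinearEstimation

section Loss

variable {X : Type} [Fintype X]

/-- The Markov operator `U` decreases the functional `G`, by at most `c` times the mass. -/
structure IsLoss (G : Functional X) (c : ℝ) (U : Ops X) : Prop where
  markov : U.IsMarkov
  le : ∀ Q : Ops X, Q.IsMarkov → ∀ p, (Q * U) G p ≤ Q G p
  le_add : ∀ Q : Ops X, Q.IsMarkov → ∀ p, Q G p ≤ (Q * U) G p + c * mass p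

variable {G : Functional X}

lemma IsLoss.one : IsLoss G 0 1 := ⟨Ops.isMarkov_one, by simp, by simp⟩

lemma IsLoss.mul {c d : ℝ} {U V : Ops X} (hU : IsLoss G c U) (hV : IsLoss G d V) :
    IsLoss G (c + d) (U * V) where
  markov := hU.markov.mul hV.markov
  le Q hQ p := by
    rw [← mul_assoc]
    exact (hV.le _ (hQ.mul hU.markov) p).trans (hU.le Q hQ p)
  le_add Q hQ p := by
    rw [← mul_assoc]
    have h1 := hV.le_add _ (hQ.mul hU.markov) p
    have h2 := hU.le_add Q hQ p
    linarith

lemma IsLoss.pow {c : ℝ} {U : Ops X} (hU : IsLoss G c U) (n : ℕ) : IsLoss G (n * c) (U ^ n) := by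
  induction n with
  | zero => simpa using IsLoss.one
  | succ n ih =>
    rw [pow_succ, Nat.cast_succ, add_mul, one_mul]
    exact ih.mul hU

lemma IsLoss.prod {ι : Type*} {s : Finset ι} {c : ι → ℝ} {U : ι → Ops X}
    (hU : ∀ i ∈ s, IsLoss G (c i) (U i)) : IsLoss G (∑ i ∈ s, c i) (∏ i ∈ s, U i) := by
  classical
  induction s using Finset.induction_on with
  | empty => simpa using IsLoss.one
  | insert i s hi ih =>
    rw [Finset.prod_insert hi, Finset.sum_insert hi]
    exact (hU i (Finset.mem_insert_self _ _)).mul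
      (ih fun j hj => hU j (Finset.mem_insert_of_mem hj))

lemma IsLoss.of_le {c : ℝ} {U S : Ops X} (hU : U.IsMarkov) (hS : S.IsMarkov)
    (h : ∀ p, U G p ≤ G p) (h' : ∀ p, G p ≤ U G p + c * mass p) : IsLoss (S G) c U where
  markov := hU
  le Q hQ p := by
    have := (hQ.mul hS).mono h p
    change ((Q * U) * S) G p ≤ (Q * S) G p
    rwa [mul_right_comm]
  le_add Q hQ p := by
    have := (hQ.mul hS).mono (g := U G + c • massF X) h' p
    rw [Ops.map_add, Functional.add_apply, (hQ.mul hS).smul_mass] at this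
    change (Q * S) G p ≤ ((Q * U) * S) G p + _
    rwa [mul_right_comm]

variable {τ : Type} [Fintype τ] {T : τ → Ops X} {c : ℝ}

lemma prod_pow_apply_le (hT : ∀ t, IsLoss G c (T t)) (n m : τ → ℕ) (p : X → ℝ≥0) :
    (∏ t, T t ^ n t) G p ≤ (∏ t, T t ^ m t) G p + c * (∑ t, ((m t - n t : ℕ) : ℝ)) * mass p := by
  have h1 : ∀ k : τ → ℕ, IsLoss G (∑ t, (k t : ℝ) * c) (∏ t, T t ^ k t) := fun k =>
    IsLoss.prod fun t _ => (hT t).pow (k t)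
  have h2 := (h1 fun t => m t - n t).le_add _ (h1 n).markov p
  have h3 := (h1 fun t => n t - m t).le _ (h1 m).markov p
  have e : (∏ t, T t ^ n t) * ∏ t, T t ^ (m t - n t) = (∏ t, T t ^ m t) * ∏ t, T t ^ (n t - m t) := by
    rw [← Finset.prod_mul_distrib, ← Finset.prod_mul_distrib]
    refine Finset.prod_congr rfl fun t _ => ?_
    rw [← pow_add, ← pow_add]
    congr 1
    omega
  rw [e, ← Finset.sum_mul, mul_comm _ c] at h2
  linarith

/-- A product of mixtures is compared with a product of pure factors by a second moment bound. -/
lemma prod_mixture_apply_le (hc : 0 ≤ c) (hT : ∀ t, IsLoss G c (T t)) {R : Type}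
    (w : R → τ → ℝ) (hw0 : ∀ μ t, 0 ≤ w μ t) (hw : ∀ μ, ∑ t, w μ t = 1) (m : τ → ℕ) {σ : ℝ}
    (hσ : 0 < σ) (p : X → ℝ≥0) (s : Finset R) (n : τ → ℕ) :
    ((∏ t, T t ^ n t) * ∏ μ ∈ s, ∑ t, w μ t • T t) G p ≤ (∏ t, T t ^ m t) G p
      + c * (∑ t, (σ + (∑ μ ∈ s, w μ t + (n t + ∑ μ ∈ s, w μ t - m t) ^ 2) / σ) / 2) * mass p := by
  classical
  induction s using Finset.induction_on generalizing n with
  | empty =>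
    have h1 := prod_pow_apply_le hT n m p
    have h2 : ∑ t, ((m t - n t : ℕ) : ℝ) ≤ ∑ t, (σ + ((n t : ℝ) - m t) ^ 2 / σ) / 2 := by
      refine Finset.sum_le_sum fun t _ => ?_
      have e : (σ + ((n t : ℝ) - m t) ^ 2 / σ) / 2 = (σ ^ 2 + ((n t : ℝ) - m t) ^ 2) / (2 * σ) := by
        field_simp
      rw [e, le_div_iff₀ (by positivity)]
      rcases le_total (m t) (n t) with h | h
      · rw [Nat.sub_eq_zero_of_le h]
        push_cast
        rw [zero_mul]
        positivity
      · rw [Nat.cast_sub h]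
        nlinarith [sq_nonneg ((m t : ℝ) - n t - σ)]
    have h3 := mul_le_mul_of_nonneg_right (mul_le_mul_of_nonneg_left h2 hc) (mass_nonneg p)
    simp only [Finset.prod_empty, mul_one, Finset.sum_empty, zero_add, add_zero]
    linarith
  | insert i s hi ih =>
    have e1 : ∀ t, (∏ t', T t' ^ n t') * T t
        = ∏ t', T t' ^ (n t' + if t' = t then 1 else 0) := fun t => by
      simp only [pow_add, Finset.prod_mul_distrib]
      congr 1
      rw [Fintype.prod_eq_single t fun t' h => by simp [h]]
      simp
    have e2 : ((∏ t, T t ^ n t) * ∏ μ ∈ insert i s, ∑ t, w μ t • T t) G p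
        = ∑ t, w i t * ((∏ t', T t' ^ (n t' + if t' = t then 1 else 0))
            * ∏ μ ∈ s, ∑ t, w μ t • T t) G p := by
      rw [Finset.prod_insert hi, ← mul_assoc, Finset.mul_sum, Finset.sum_mul, Ops.sum_apply,
        Functional.sum_apply]
      refine Finset.sum_congr rfl fun t _ => ?_
      rw [← e1, mul_smul_comm, smul_mul_assoc]
      rfl
    rw [e2]
    set a : τ → ℝ := fun t => ∑ μ ∈ s, w μ t with ha
    have h1 : ∑ t, w i t * (((∏ t', T t' ^ (n t' + if t' = t then 1 else 0))
            * ∏ μ ∈ s, ∑ t, w μ t • T t) G p)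
        ≤ ∑ t, w i t * ((∏ t, T t ^ m t) G p + c * (∑ t', (σ + (a t'
          + (((n t' + if t' = t then 1 else 0 : ℕ) : ℝ) + a t' - m t') ^ 2) / σ) / 2) * mass p) :=
      Finset.sum_le_sum fun t _ => mul_le_mul_of_nonneg_left (ih _) (hw0 i t)
    refine h1.trans ?_
    simp only [mul_add, Finset.sum_add_distrib, ← Finset.sum_mul, hw, one_mul]
    have h2 : ∑ t, w i t * (∑ t', (σ + (a t'
          + (((n t' + if t' = t then 1 else 0 : ℕ) : ℝ) + a t' - m t') ^ 2) / σ) / 2)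
        ≤ ∑ t', (σ + (∑ μ ∈ insert i s, w μ t'
          + (n t' + ∑ μ ∈ insert i s, w μ t' - m t') ^ 2) / σ) / 2 := by
      simp only [Finset.mul_sum]
      rw [Finset.sum_comm]
      refine Finset.sum_le_sum fun t' _ => ?_
      rw [Finset.sum_insert hi]
      change ∑ t, w i t * ((σ + (a t' + (((n t' + if t' = t then 1 else 0 : ℕ) : ℝ) + a t' - m t') ^ 2)
        / σ) / 2) ≤ (σ + (w i t' + a t' + (n t' + (w i t' + a t') - m t') ^ 2) / σ) / 2
      set y : ℝ := n t' + a t' - m t' with hy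
      have e3 : ∀ t, w i t * ((σ + (a t' + (((n t' + if t' = t then 1 else 0 : ℕ) : ℝ)
          + a t' - m t') ^ 2) / σ) / 2)
          = w i t * ((σ + (a t' + y ^ 2) / σ) / 2)
            + if t' = t then w i t * ((2 * y + 1) / σ / 2) else 0 := by
        intro t
        split_ifs
        · push_cast
          rw [hy]
          ring
        · push_cast
          rw [hy]
          ring
      simp only [e3, Finset.sum_add_distrib, ← Finset.sum_mul, hw, Finset.sum_ite_eq,
        Finset.mem_univ, if_true]
      have e4 : (σ + (w i t' + a t' + (n t' + (w i t' + a t') - m t') ^ 2) / σ) / 2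
          - (1 * ((σ + (a t' + y ^ 2) / σ) / 2) + w i t' * ((2 * y + 1) / σ / 2))
          = w i t' ^ 2 / σ / 2 := by
        rw [hy]
        field_simp
        ring
      have : 0 ≤ w i t' ^ 2 / σ / 2 := by positivity
      linarith
    have h3 := mul_le_mul_of_nonneg_right (mul_le_mul_of_nonneg_left h2 hc) (mass_nonneg p)
    refine add_le_add_right (le_trans (le_of_eq ?_) h3) _
    rw [Finset.mul_sum, Finset.sum_mul]
    refine Finset.sum_congr rfl fun t _ => ?_
    ring

end Loss

section Comparison

variable {C : Type} [Fintype C] [DecidableEq C] {I : Type} [Fintype I] [DecidableEq I] {B : ℕ}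

/-- A bound on the power of a difference of two sections. -/
def power (atom : I → Fin B → ℝ) : ℝ := B * (2 * ∑ i, ∑ b, |atom i b|) ^ 2

lemma power_nonneg (atom : I → Fin B → ℝ) : 0 ≤ power atom := by
  unfold power
  positivity

lemma isLoss_rowOp {Δ : ℝ≥0} (hΔ : Δ ≠ 0) (atom : I → Fin B → ℝ) {v : C → ℝ≥0} {c : ℝ}
    (hv : ∑ l, (v l : ℝ) ≤ c) {S : Ops (C → I)} (hS : S.IsMarkov) :
    IsLoss (S (entropyF _)) (c * power atom / (2 * Δ)) (rowOp hΔ atom v) := by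
  refine IsLoss.of_le (isMarkov_rowOp _ _ _) hS (rowOp_entropyF_le hΔ atom v) fun p => ?_
  have hA : ∀ i b, |atom i b| ≤ ∑ i, ∑ b, |atom i b| := fun i b =>
    (Finset.single_le_sum (f := fun b => |atom i b|) (fun _ _ => abs_nonneg _)
      (Finset.mem_univ b)).trans (Finset.single_le_sum (f := fun i => ∑ b, |atom i b|)
        (fun _ _ => Finset.sum_nonneg fun _ _ => abs_nonneg _) (Finset.mem_univ i))
  refine (entropyF_le_rowOp_add hΔ hA v p).trans ?_
  have h1 := mass_nonneg p
  have h2 := power_nonneg atom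
  unfold power at *
  gcongr

lemma isLoss_reveal (l : C) {S : Ops (C → I)} (hS : S.IsMarkov) :
    IsLoss (S (entropyF _)) (Real.log (Fintype.card I)) (reveal fun x : C → I => x l).expect := by
  refine IsLoss.of_le (Ops.isMarkov_expect _) hS (fun p => ?_) fun p => ?_
  · rw [expect_reveal_entropyF, Functional.sub_apply]
    linarith [marginalEntropy_nonneg (fun x : C → I => x l) p]
  · rw [expect_reveal_entropyF, Functional.sub_apply]
    linarith [marginalEntropy_le (fun x : C → I => x l) p]

/-- The comparison of a system with a system whose rows have prescribed variance profiles. -/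
theorem exists_prod_rowOp_le {Δ : ℝ≥0} (hΔ : Δ ≠ 0) (atom : I → Fin B → ℝ) {c : ℝ}
    (hc : 0 ≤ c) {ε : ℝ} (hε : 0 < ε) : ∃ K : ℝ, 0 ≤ K ∧ ∀ (C : Type) [Fintype C] [DecidableEq C]
      [Nonempty C] (R : Type) [Fintype R] (τ : Type) [Fintype τ] (w : R → τ → ℝ≥0)
      (V : τ → C → ℝ≥0) (U : R → C → ℝ≥0), (∀ μ, ∑ t, w μ t = 1) →
      (∀ μ l, U μ l = ∑ t, w μ t * V t l) →
      (∀ μ l, (U μ l : ℝ) * Fintype.card C ≤ c) → ∀ d : ℝ, 0 ≤ d → (∀ t, ∑ l, (V t l : ℝ) ≤ d) →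
      ∀ S : Ops (C → I), S.IsMarkov → ∀ θ : ℕ, 0 < θ → ∀ σ : ℝ, 0 < σ → ∀ (m : τ → ℕ)
      (p : (C → I) → ℝ≥0), (∏ μ, rowOp hΔ atom (U μ)) (S (entropyF _)) p
          ≤ (∏ t, rowOp hΔ atom (V t) ^ m t) (S (entropyF _)) p
            + (Fintype.card R * (ε + K * (Real.log (Fintype.card I) / θ))
              + θ * Real.log (Fintype.card I)
              + d * power atom / (2 * Δ) * ∑ t, (σ + (∑ μ, (w μ t : ℝ)
                + (∑ μ, (w μ t : ℝ) - m t) ^ 2) / σ) / 2) * mass p := by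
  obtain ⟨K, hK0, hK⟩ := exists_prod_rowOp_mixVar_le hΔ atom hc hε
  refine ⟨K, hK0, fun C _ _ _ R _ τ _ w V U hw hU hUc d hd hV S hS θ hθ σ hσ m p => ?_⟩
  obtain rfl : U = fun μ => mixVar (w μ) V := by
    funext μ l
    exact hU μ l
  have h1 := hK C R τ w V hw hUc S hS θ hθ p
  have hd' : 0 ≤ d * power atom / (2 * Δ) := by
    have := power_nonneg atom
    positivity
  have h2 := prod_mixture_apply_le hd' (fun t => isLoss_rowOp hΔ atom (hV t) hS)
    (fun μ t => (w μ t : ℝ)) (fun _ _ => NNReal.coe_nonneg _) (fun μ => by exact_mod_cast hw μ) m hσ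
    p Finset.univ 0
  simp only [Pi.zero_apply, pow_zero, Finset.prod_const_one, one_mul, Nat.cast_zero,
    zero_add] at h2
  rw [add_mul]
  linarith

end Comparison

end LinearEstimation

end

noncomputable section

namespace LinearEstimation

section Products

lemma lintegral_pi_ofReal_prod {ι : Type} [Fintype ι] {Ω : ι → Type} [∀ i, MeasurableSpace (Ω i)]
    (μ : ∀ i, Measure (Ω i)) [∀ i, SigmaFinite (μ i)] {g : ∀ i, Ω i → ℝ} (hg : ∀ i ω, 0 ≤ g i ω)
    (hi : ∀ i, Integrable (g i) (μ i)) :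
    ∫⁻ ω, ENNReal.ofReal (∏ i, g i (ω i)) ∂(Measure.pi μ)
      = ∏ i, ∫⁻ ω, ENNReal.ofReal (g i ω) ∂(μ i) := by
  rw [← ofReal_integral_eq_lintegral_ofReal (Integrable.fintype_prod_dep hi)
    (ae_of_all _ fun ω => Finset.prod_nonneg fun i _ => hg i _), integral_fintype_prod_eq_prod,
    ENNReal.ofReal_prod_of_nonneg fun i _ => integral_nonneg (hg i)]
  refine Finset.prod_congr rfl fun i _ => ?_
  exact ofReal_integral_eq_lintegral_ofReal (hi i) (ae_of_all _ (hg i))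

lemma pi_withDensity_ofReal {ι : Type} [Fintype ι] {Ω : ι → Type} [∀ i, MeasurableSpace (Ω i)]
    (μ : ∀ i, Measure (Ω i)) [∀ i, SigmaFinite (μ i)] {g : ∀ i, Ω i → ℝ} (hg : ∀ i ω, 0 ≤ g i ω)
    (hi : ∀ i, Integrable (g i) (μ i)) :
    Measure.pi (fun i => (μ i).withDensity fun ω => ENNReal.ofReal (g i ω))
      = (Measure.pi μ).withDensity fun ω => ENNReal.ofReal (∏ i, g i (ω i)) := by
  have : ∀ i, SigmaFinite ((μ i).withDensity fun ω => ENNReal.ofReal (g i ω)) := fun i =>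
    SigmaFinite.withDensity_ofReal _
  refine Measure.pi_eq fun s hs => ?_
  rw [withDensity_apply _ (MeasurableSet.univ_pi hs), Measure.restrict_pi_pi,
    lintegral_pi_ofReal_prod _ hg fun i => (hi i).restrict]
  exact Finset.prod_congr rfl fun i _ => (withDensity_apply _ (hs i)).symm

variable {X : Type} [Fintype X]

/-- The experiment that consists of a family of independent experiments. -/
def Experiment.pi {R : Type} [Fintype R] (E : R → Experiment X) [∀ μ, SigmaFinite (E μ).law] :
    Experiment X where
  Ω := ∀ μ, (E μ).Ω
  law := Measure.pi fun μ => (E μ).law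
  ker ω := ∏ μ, (E μ).ker (ω μ)
  measurable_ker := Finset.measurable_prod _ fun μ _ =>
    (E μ).measurable_ker.comp (measurable_pi_apply μ)
  lintegral_ker x := by
    have h := lintegral_pi_ofReal_prod (fun μ => (E μ).law) (g := fun μ ω => ((E μ).ker ω x : ℝ))
      (fun μ ω => NNReal.coe_nonneg _) fun μ => (E μ).integrable_ker x
    simp only [ENNReal.ofReal_coe_nnreal, (E _).lintegral_ker, Finset.prod_const_one] at h
    rw [← h]
    refine lintegral_congr fun ω => ?_
    rw [← NNReal.coe_prod, ENNReal.ofReal_coe_nnreal, Finset.prod_apply]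

lemma Experiment.expect_pi {R : Type} [Fintype R] (E : R → Experiment X)
    [∀ μ, SigmaFinite (E μ).law] : (Experiment.pi E).expect = ∏ μ, (E μ).expect := by
  have key : ∀ (R : Type) [Fintype R] (E : R → Experiment X) [∀ μ, SigmaFinite (E μ).law]
      (F : Functional X) (p : X → ℝ≥0),
      ∫ ω, F ((∏ μ, (E μ).ker (ω μ)) * p) ∂(Measure.pi fun μ => (E μ).law)
        = (∏ μ, (E μ).expect) F p := by
    intro R _
    refine Fintype.induction_empty_option (P := fun R _ => ∀ (E : R → Experiment X)
      [∀ μ, SigmaFinite (E μ).law] (F : Functional X) (p : X → ℝ≥0),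
      ∫ ω, F ((∏ μ, (E μ).ker (ω μ)) * p) ∂(Measure.pi fun μ => (E μ).law)
        = (∏ μ, (E μ).expect) F p) ?_ ?_ ?_ R
    · intro α β _ e ih
      let _ : Fintype α := Fintype.ofEquiv β e.symm
      intro E _ F p
      have h := ih (fun a => E (e a)) F p
      rw [Fintype.prod_equiv e (fun a => (E (e a)).expect) (fun b => (E b).expect) fun _ => rfl] at h
      rw [← h, ← Measure.pi_map_piCongrLeft e fun b => (E b).law, integral_map_equiv]
      refine integral_congr_ae (ae_of_all _ fun ω => ?_)
      simp only
      rw [← Fintype.prod_equiv e (fun a => (E (e a)).ker (ω a)) _ fun a => ?_]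
      congr 1
      exact (MeasurableEquiv.piCongrLeft_apply_apply (β := fun b => (E b).Ω) e ω a).symm
    · intro E _ F p
      rw [Measure.pi_of_empty (fun μ : PEmpty => (E μ).law), integral_dirac]
      simp [Ops.one_apply]
    · intro α _ ih E _ F p
      have e1 : (∏ μ, (E μ).expect) F p
          = (∏ a, (E (some a)).expect) ((E none).expect F) p := by
        rw [Fintype.prod_option, mul_comm, Ops.mul_apply]
      rw [e1, ← ih (fun a => E (some a)), ← Measure.pi_map_piOptionEquivProd fun μ => (E μ).law,
        integral_map_equiv]
      have hi := ((Experiment.pi fun a => E (some a)).prod (E none)).integrable F p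
      refine Eq.trans ?_ ((integral_prod _ hi).trans ?_)
      · refine integral_congr_ae (ae_of_all _ fun ω => ?_)
        simp only
        rw [Fintype.prod_option, mul_comm ((E none).ker _)]
        rfl
      · refine integral_congr_ae (ae_of_all _ fun ω => ?_)
        simp only [Ops.expect_apply]
        refine integral_congr_ae (ae_of_all _ fun ω' => ?_)
        simp only
        rw [← mul_assoc, mul_comm ((E none).ker ω')]
        rfl
  exact Subtype.ext (LinearMap.ext fun F => Functional.ext (key R E F))

end Products

section Revealing

variable {C : Type} [Fintype C] [DecidableEq C] {I : Type} [Fintype I] [DecidableEq I]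

/-- The operator that reveals the sections of a set. -/
def revealSet (K : Finset C) : Ops (C → I) := ∏ l ∈ K, (reveal fun x : C → I => x l).expect

lemma isMarkov_revealSet (K : Finset C) : (revealSet (I := I) K).IsMarkov :=
  Ops.isMarkov_prod fun _ _ => Ops.isMarkov_expect _

/-- The mass of the signals that coincide with a given one on a set of sections. -/
def condMass (K : Finset C) (p : (C → I) → ℝ≥0) (s : C → I) : ℝ≥0 :=
  ∑ x, if ∀ l ∈ K, x l = s l then p x else 0

lemma le_condMass (K : Finset C) (p : (C → I) → ℝ≥0) (s : C → I) : p s ≤ condMass K p s := by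
  refine le_trans (le_of_eq ?_) (Finset.single_le_sum
    (f := fun x => if ∀ l ∈ K, x l = s l then p x else 0) (fun _ _ => zero_le) (Finset.mem_univ s))
  simp

lemma revealSet_entropyF_apply (K : Finset C) (p : (C → I) → ℝ≥0) :
    revealSet K (entropyF (C → I)) p = ∑ s, (p s : ℝ) * Real.log (condMass K p s / p s) := by
  induction K using Finset.induction_on generalizing p with
  | empty => simp [revealSet, Ops.one_apply, entropy, condMass, mass]
  | insert i K hi ih =>
    rw [revealSet, Finset.prod_insert hi, Ops.mul_apply, expect_reveal_apply]
    change ∑ y, revealSet K (entropyF (C → I)) (fun x => if x i = y then p x else 0) = _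
    simp only [ih]
    rw [Finset.sum_comm]
    refine Finset.sum_congr rfl fun s _ => ?_
    rw [Finset.sum_eq_single (s i) (fun y _ hy => by simp [Ne.symm hy]) (by simp)]
    simp only [if_true]
    congr 4
    refine Finset.sum_congr rfl fun x _ => ?_
    by_cases h1 : x i = s i <;> by_cases h2 : ∀ l ∈ K, x l = s l <;> simp [h1, h2]

end Revealing

end LinearEstimation

end

noncomputable section

namespace LinearEstimation

section Identification

variable {R C : Type} [Fintype R] [Fintype C] [DecidableEq C] {B : ℕ}

/-- The law of a signal with i.i.d. sections. -/
def prior (P₀ : DiscretePrior B) (C : Type) [Fintype C] (s : C → Fin P₀.n) : ℝ≥0 :=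
  ∏ l, (P₀.weight (s l)).toNNReal

lemma coe_prior (P₀ : DiscretePrior B) (s : C → Fin P₀.n) : (prior P₀ C s : ℝ) = priorProb P₀ s := by
  simp [prior, priorProb, NNReal.coe_prod, P₀.weight_nonneg]

lemma mass_prior (P₀ : DiscretePrior B) : mass (prior P₀ C) = 1 := by
  simp only [mass, coe_prior, priorProb]
  rw [← Fintype.piFinset_univ, ← Finset.prod_univ_sum]
  simp [P₀.weight_sum]

lemma likelihood_eq (P₀ : DiscretePrior B) {Δ : ℝ} (hΔ : 0 < Δ) (φ : R → C → Fin B → ℝ) (y : R → ℝ)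
    (s : C → Fin P₀.n) :
    likelihood P₀ Δ φ y s = ∏ μ, rowPdf Δ.toNNReal (signal P₀.atom s) (φ μ, y μ) := by
  simp only [likelihood, rowPdf, gaussianPDFReal, Finset.prod_mul_distrib, Finset.prod_const,
    Finset.card_univ, Real.coe_toNNReal _ hΔ.le, inv_pow, ← Real.exp_sum]
  congr 2
  rw [Finset.mul_sum]
  refine Finset.sum_congr rfl fun μ _ => ?_
  change _ = -(y μ - measurement P₀ φ s μ) ^ 2 / (2 * Δ)
  ring

lemma map_observation_row {σ : ℝ≥0} (hσ : σ ≠ 0) (v : C → ℝ≥0) (a : C → Fin B → ℝ) :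
    ((rowLaw B v).prod (gaussianReal 0 1)).map (fun ω => (ω.1, rowDot ω.1 a + ω.2 * √σ))
      = ((rowLaw B v).prod volume).withDensity fun ω => ENNReal.ofReal (rowPdf σ a ω) := by
  have hm : Measurable fun ω : (C → Fin B → ℝ) × ℝ => (ω.1, rowDot ω.1 a + ω.2 * √σ) :=
    measurable_fst.prodMk
      (((measurable_rowDot a).comp measurable_fst).add (measurable_snd.mul_const _))
  refine Measure.ext_of_lintegral _ fun f hf => ?_
  rw [lintegral_map hf hm, lintegral_withDensity_eq_lintegral_mul _
    (measurable_rowPdf σ a).ennreal_ofReal hf,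
    lintegral_prod (fun ω => f (ω.1, rowDot ω.1 a + ω.2 * √σ)) (hf.comp hm).aemeasurable,
    lintegral_prod _ ((measurable_rowPdf σ a).ennreal_ofReal.mul hf).aemeasurable]
  refine lintegral_congr fun φ => ?_
  have h1 : (gaussianReal 0 1).map (fun z => rowDot φ a + z * √σ) = gaussianReal (rowDot φ a) σ := by
    have e : (fun z : ℝ => rowDot φ a + z * √σ) = (fun z => rowDot φ a + z) ∘ fun z => z * √σ := rfl
    rw [e, ← Measure.map_map (by fun_prop) (by fun_prop), gaussianReal_map_mul_const,
      gaussianReal_map_const_add]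
    congr 1
    · simp
    · ext
      simp
  have hf' : Measurable fun y => f (φ, y) := hf.comp measurable_prodMk_left
  have h2 := lintegral_map hf' (μ := gaussianReal 0 1)
    (show Measurable fun z : ℝ => rowDot φ a + z * √σ by fun_prop)
  rw [← h2, h1, gaussianReal_of_var_ne_zero _ hσ,
    lintegral_withDensity_eq_lintegral_mul _ (measurable_gaussianPDF _ _) hf']
  rfl

instance (v : C → ℝ≥0) : SigmaFinite ((rowLaw B v).prod (volume : Measure ℝ)) := inferInstance

lemma integral_observation (P₀ : DiscretePrior B) {Δ : ℝ} (hΔ : 0 < Δ) (V : R → C → ℝ≥0)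
    (s : C → Fin P₀.n) {F : (R → C → Fin B → ℝ) × (R → ℝ) → ℝ} (hF : Measurable F) :
    ∫ q, F (q.1, observation P₀ Δ q.1 s q.2) ∂((matrixLaw B V).prod (noiseLaw R))
      = ∫ ω, (∏ μ, rowPdf Δ.toNNReal (signal P₀.atom s) (ω μ))
          * F (fun μ => (ω μ).1, fun μ => (ω μ).2)
          ∂(Measure.pi fun μ => (rowLaw B (V μ)).prod volume) := by
  have hσ : Δ.toNNReal ≠ 0 := (Real.toNNReal_pos.2 hΔ).ne'
  set σ := Δ.toNNReal
  set a := signal P₀.atom s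
  have h1 := measurePreserving_arrowProdEquivProdArrow (C → Fin B → ℝ) ℝ R
    (fun μ => rowLaw B (V μ)) (fun _ => gaussianReal 0 1)
  have h2 : (matrixLaw B V).prod (noiseLaw R) = (Measure.pi fun μ => rowLaw B (V μ)).prod
      (Measure.pi fun _ : R => gaussianReal 0 1) := rfl
  rw [h2, ← h1.integral_comp']
  set g : (C → Fin B → ℝ) × ℝ → (C → Fin B → ℝ) × ℝ := fun ω => (ω.1, rowDot ω.1 a + ω.2 * √σ)
  have hg : Measurable g := measurable_fst.prodMk
      (((measurable_rowDot a).comp measurable_fst).add (measurable_snd.mul_const _))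
  set G : (R → (C → Fin B → ℝ) × ℝ) → ℝ := fun ω => F (fun μ => (ω μ).1, fun μ => (ω μ).2)
  have hG : Measurable G := hF.comp (by fun_prop)
  have h3 : Measure.map (fun ω (μ : R) => g (ω μ))
      (Measure.pi fun μ => (rowLaw B (V μ)).prod (gaussianReal 0 1))
      = (Measure.pi fun μ => (rowLaw B (V μ)).prod volume).withDensity
        fun ω => ENNReal.ofReal (∏ μ, rowPdf σ a (ω μ)) := by
    have : ∀ μ, IsProbabilityMeasure
        (((rowLaw B (V μ)).prod (gaussianReal 0 1)).map g) := fun μ =>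
      Measure.isProbabilityMeasure_map hg.aemeasurable
    rw [Measure.pi_map_pi fun μ => hg.aemeasurable]
    simp only [g, map_observation_row hσ]
    exact pi_withDensity_ofReal _ (fun μ ω => rowPdf_nonneg _ _ _) fun μ => integrable_rowPdf _ hσ a
  have hm : Measurable fun (ω : R → (C → Fin B → ℝ) × ℝ) (μ : R) => g (ω μ) :=
    measurable_pi_lambda _ fun μ => hg.comp (measurable_pi_apply μ)
  have h4 := integral_map (μ := Measure.pi fun μ => (rowLaw B (V μ)).prod (gaussianReal 0 1))
    hm.aemeasurable hG.aestronglyMeasurable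
  have hd : Measurable fun ω : R → (C → Fin B → ℝ) × ℝ => ∏ μ, rowPdf σ a (ω μ) :=
    Finset.measurable_prod _ fun μ _ => (measurable_rowPdf σ a).comp (measurable_pi_apply μ)
  rw [h3, integral_withDensity_eq_integral_toReal_smul
    hd.ennreal_ofReal (ae_of_all _ fun _ => ENNReal.ofReal_lt_top)] at h4
  refine Eq.trans ?_ (h4.symm.trans ?_)
  · refine integral_congr_ae (ae_of_all _ fun ω => ?_)
    have e : √(σ : ℝ) = √Δ := by rw [Real.coe_toNNReal _ hΔ.le]
    simp only [G, g, e]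
    rfl
  · refine integral_congr_ae (ae_of_all _ fun ω => ?_)
    simp only
    rw [ENNReal.toReal_ofReal (Finset.prod_nonneg fun μ _ => rowPdf_nonneg _ _ _), smul_eq_mul]

lemma pin_comm_weight (P₀ : DiscretePrior B) (K : Finset C) (x x' : C → Fin P₀.n) :
    prior P₀ C (pin K x x') * prior P₀ C (pin K x' x) = prior P₀ C x * prior P₀ C x' := by
  unfold prior
  rw [← Finset.prod_mul_distrib, ← Finset.prod_mul_distrib]
  refine Finset.prod_congr rfl fun l _ => ?_
  by_cases h : l ∈ K
  · simp only [pin, h, if_true]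
  · simp only [pin, h, if_false]
    rw [mul_comm]

/-- The posterior mass of the signals compatible with the known sections. -/
lemma condMass_mul_prior (P₀ : DiscretePrior B) (K : Finset C) (k : (C → Fin P₀.n) → ℝ≥0)
    (s : C → Fin P₀.n) : condMass K (k * prior P₀ C) s
      = condMass K (prior P₀ C) s * ∑ x, prior P₀ C x * k (pin K s x) := by
  have h1 : ∑ x, prior P₀ C x = 1 := by
    have := mass_prior P₀ (C := C)
    unfold mass at this
    exact_mod_cast this
  have pp : ∀ x x' : C → Fin P₀.n, pin K (pin K x x') (pin K x' x) = x := fun x x' => by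
    funext l
    by_cases h : l ∈ K <;> simp [pin, h]
  let e : (C → Fin P₀.n) × (C → Fin P₀.n) ≃ (C → Fin P₀.n) × (C → Fin P₀.n) :=
    { toFun := fun z => (pin K z.1 z.2, pin K z.2 z.1)
      invFun := fun z => (pin K z.1 z.2, pin K z.2 z.1)
      left_inv := fun z => by simp only [pp]
      right_inv := fun z => by simp only [pp] }
  have h2 : ∑ z : (C → Fin P₀.n) × (C → Fin P₀.n), (if ∀ l ∈ K, z.1 l = s l then
        (prior P₀ C z.1) * (prior P₀ C z.2 * k (pin K s z.2)) else 0)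
      = ∑ z : (C → Fin P₀.n) × (C → Fin P₀.n), (if ∀ l ∈ K, z.1 l = s l then
        k z.1 * prior P₀ C z.1 * prior P₀ C z.2 else 0) := by
    refine Fintype.sum_equiv e _ _ fun z => ?_
    have hiff : (∀ l ∈ K, (e z).1 l = s l) ↔ ∀ l ∈ K, z.1 l = s l :=
      forall₂_congr fun l hl => by simp [e, pin, hl]
    simp only [hiff]
    split_ifs with h
    · have hpin : pin K s z.2 = (e z).1 := by
        funext l
        by_cases hl : l ∈ K
        · simp [pin, e, hl, h l hl]
        · simp [pin, e, hl]
      have hw := pin_comm_weight P₀ K z.1 z.2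
      rw [hpin, mul_assoc (k _), show prior P₀ C (e z).1 * prior P₀ C (e z).2
        = prior P₀ C z.1 * prior P₀ C z.2 from hw]
      ring
    · rfl
  rw [Fintype.sum_prod_type, Fintype.sum_prod_type] at h2
  unfold condMass
  rw [Finset.sum_mul]
  refine Eq.trans ?_ (h2.symm.trans ?_)
  · refine Finset.sum_congr rfl fun x _ => ?_
    split_ifs with h
    · simp only [← Finset.mul_sum, h1, mul_one]
      rfl
    · simp
  · refine Finset.sum_congr rfl fun x _ => ?_
    split_ifs with h
    · rw [Finset.mul_sum]
    · simp

lemma measurable_condMass (K : Finset C) {I : Type} [Fintype I] [DecidableEq I] (s : C → I) :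
    Measurable fun p : (C → I) → ℝ≥0 => condMass K p s := by
  refine Finset.measurable_sum _ fun x _ => ?_
  split_ifs
  · exact measurable_pi_apply x
  · exact measurable_const

variable (P₀ : DiscretePrior B) {Δ : ℝ} (hΔ : 0 < Δ) (V : R → C → ℝ≥0) (known : Finset C)

lemma measurable_measurement (s : C → Fin P₀.n) (μ : R) :
    Measurable fun z : (R → C → Fin B → ℝ) × (R → ℝ) => measurement P₀ z.1 s μ := by
  unfold measurement
  fun_prop

lemma measurable_likelihood (s : C → Fin P₀.n) :
    Measurable fun z : (R → C → Fin B → ℝ) × (R → ℝ) => likelihood P₀ Δ z.1 z.2 s := by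
  unfold likelihood
  have := fun μ => measurable_measurement P₀ (R := R) s μ
  fun_prop

lemma measurable_log_ratio (s : C → Fin P₀.n) :
    Measurable fun z : (R → C → Fin B → ℝ) × (R → ℝ) =>
      Real.log (likelihood P₀ Δ z.1 z.2 s / evidence P₀ Δ known z.1 z.2 s) := by
  unfold evidence
  refine Real.measurable_log.comp ((measurable_likelihood P₀ s).div ?_)
  exact Finset.measurable_sum _ fun x _ => (measurable_likelihood P₀ _).const_mul _

include hΔ in
lemma toNNReal_ne_zero : Δ.toNNReal ≠ 0 := (Real.toNNReal_pos.2 hΔ).ne'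

/-- The mutual information is the decrease of the entropy. -/
theorem mutualInfo_eq : mutualInfo P₀ Δ V known = 1 / (Fintype.card C : ℝ) *
    (revealSet known (entropyF _) (prior P₀ C)
      - (∏ μ, rowOp (toNNReal_ne_zero hΔ) P₀.atom (V μ)) (revealSet known (entropyF _))
        (prior P₀ C)) := by
  set π := prior P₀ C with hπ
  let E : R → Experiment (C → Fin P₀.n) := fun μ =>
    rowExp (toNNReal_ne_zero hΔ) (signal P₀.atom) (V μ)
  have : ∀ μ, SigmaFinite (E μ).law := fun μ =>
    inferInstanceAs (SigmaFinite ((rowLaw B (V μ)).prod volume))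
  set H := revealSet known (entropyF (C → Fin P₀.n)) with hH
  set k := (Experiment.pi E).ker with hk
  have hkc : ∀ (ω : (Experiment.pi E).Ω) s,
      (k ω s : ℝ) = ∏ μ, rowPdf Δ.toNNReal (signal P₀.atom s) (ω μ) := by
    intro ω s
    simp only [hk, Experiment.pi, Finset.prod_apply, NNReal.coe_prod]
    rfl
  have hk0 : ∀ ω s, 0 < (k ω s : ℝ) := fun ω s => by
    rw [hkc]
    exact Finset.prod_pos fun μ _ => rowPdf_pos (toNNReal_ne_zero hΔ) _ _
  set h : (C → Fin P₀.n) → (Experiment.pi E).Ω → ℝ := fun s ω =>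
    ((k ω * π) s : ℝ) * Real.log (condMass known (k ω * π) s / (k ω * π) s) with hh
  have hh0 : ∀ s ω, 0 ≤ h s ω := by
    intro s ω
    rcases eq_or_lt_of_le (NNReal.coe_nonneg ((k ω * π) s)) with e | e
    · simp only [hh, ← e, zero_mul, le_refl]
    · refine mul_nonneg e.le (Real.log_nonneg ((one_le_div e).2 ?_))
      exact_mod_cast le_condMass known (k ω * π) s
  have hsum : ∀ ω, H (k ω * π) = ∑ s, h s ω := fun ω => revealSet_entropyF_apply known _
  have hHi := (Experiment.pi E).integrable H π
  have hmk : Measurable fun ω => k ω * π := measurable_pi_lambda _ fun x =>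
    ((measurable_pi_apply x).comp (Experiment.pi E).measurable_ker).mul_const _
  have hi : ∀ s, Integrable (h s) (Experiment.pi E).law := fun s => by
    refine hHi.mono' ?_ (ae_of_all _ fun ω => ?_)
    · have m1 : Measurable fun ω => (k ω * π) s := (measurable_pi_apply s).comp hmk
      have m2 : Measurable fun ω => condMass known (k ω * π) s :=
        (measurable_condMass known s).comp hmk
      exact (m1.coe_nnreal_real.mul (Real.measurable_log.comp
        (m2.coe_nnreal_real.div m1.coe_nnreal_real))).aestronglyMeasurable
    · rw [Real.norm_of_nonneg (hh0 s ω)]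
      refine (Finset.single_le_sum (f := fun s => h s ω) (fun s _ => hh0 s ω)
        (Finset.mem_univ s)).trans_eq (hsum ω).symm
  have hint : ∀ s, priorProb P₀ s * ∫ q : (R → C → Fin B → ℝ) × (R → ℝ),
      Real.log (likelihood P₀ Δ q.1 (observation P₀ Δ q.1 s q.2) s /
        evidence P₀ Δ known q.1 (observation P₀ Δ q.1 s q.2) s)
        ∂((matrixLaw B V).prod (noiseLaw R))
      = (π s : ℝ) * Real.log (condMass known π s / π s) - ∫ ω, h s ω ∂(Experiment.pi E).law := by
    intro s
    have e1 := integral_observation P₀ hΔ V s (measurable_log_ratio P₀ (Δ := Δ) known s)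
    refine (congrArg (priorProb P₀ s * ·) e1).trans ?_
    have e2 : ∫ ω, ((π s : ℝ) * Real.log (condMass known π s / π s)) * (k ω s : ℝ) - h s ω
        ∂(Experiment.pi E).law
        = (π s : ℝ) * Real.log (condMass known π s / π s) - ∫ ω, h s ω ∂(Experiment.pi E).law := by
      rw [integral_sub (((Experiment.pi E).integrable_ker s).const_mul _) (hi s),
        integral_const_mul, (Experiment.pi E).integral_ker, mul_one]
    rw [← e2, ← integral_const_mul]
    refine integral_congr_ae (ae_of_all _ fun ω => ?_)
    obtain ⟨q, hq⟩ : ∃ q : (C → Fin P₀.n) → ℝ≥0, q = k ω := ⟨_, rfl⟩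
    have hqc : ∀ x, (q x : ℝ) = ∏ μ, rowPdf Δ.toNNReal (signal P₀.atom x) (ω μ) := fun x => by
      rw [hq]
      exact hkc ω x
    have hq0 : 0 < (q s : ℝ) := by
      rw [hq]
      exact hk0 ω s
    have hl : ∀ x, likelihood P₀ Δ (fun μ => (ω μ).1) (fun μ => (ω μ).2) x = (q x : ℝ) :=
      fun x => by rw [hqc, likelihood_eq P₀ hΔ]
    have he : evidence P₀ Δ known (fun μ => (ω μ).1) (fun μ => (ω μ).2) s
        = ((∑ x, π x * q (pin known s x) : ℝ≥0) : ℝ) := by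
      rw [NNReal.coe_sum]
      refine Finset.sum_congr rfl fun x _ => ?_
      rw [hl, NNReal.coe_mul, hπ, coe_prior]
    have hc : condMass known (q * π) s = condMass known π s * ∑ x, π x * q (pin known s x) :=
      condMass_mul_prior P₀ known q s
    have hr : (fun ω => (π s : ℝ) * Real.log (condMass known π s / π s) * (k ω s : ℝ) - h s ω) ω
        = (π s : ℝ) * Real.log (condMass known π s / π s) * (q s : ℝ)
          - ((q * π) s : ℝ) * Real.log (condMass known (q * π) s / (q * π) s) := by
      rw [hq]
    refine Eq.trans ?_ hr.symm
    change priorProb P₀ s * ((∏ μ, rowPdf Δ.toNNReal (signal P₀.atom s) (ω μ)) *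
      Real.log (likelihood P₀ Δ (fun μ => (ω μ).1) (fun μ => (ω μ).2) s /
        evidence P₀ Δ known (fun μ => (ω μ).1) (fun μ => (ω μ).2) s)) = _
    rw [hl, he, ← hqc, ← coe_prior, ← hπ, hc, Pi.mul_apply, NNReal.coe_mul, NNReal.coe_mul]
    have hE : (0 : ℝ) ≤ ((∑ x, π x * q (pin known s x) : ℝ≥0) : ℝ) := NNReal.coe_nonneg _
    rcases eq_or_lt_of_le (NNReal.coe_nonneg (π s)) with e | e
    · simp [← e]
    · have p1 : (0 : ℝ) < condMass known π s := e.trans_le (by exact_mod_cast le_condMass known π s)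
      have p2 : (0 : ℝ) < ((∑ x, π x * q (pin known s x) : ℝ≥0) : ℝ) := by
        have h3 : (q * π) s ≤ condMass known (q * π) s := le_condMass known _ s
        have h4 : (0 : ℝ) < (condMass known (q * π) s : ℝ) :=
          (mul_pos hq0 e).trans_le (by exact_mod_cast h3)
        rw [hc, NNReal.coe_mul] at h4
        exact pos_of_mul_pos_right h4 p1.le
      generalize ((∑ x, π x * q (pin known s x) : ℝ≥0) : ℝ) = ev at p2
      rw [Real.log_div hq0.ne' p2.ne', Real.log_div p1.ne' e.ne', Real.log_div (by positivity)
        (by positivity), Real.log_mul p1.ne' p2.ne', Real.log_mul hq0.ne' e.ne']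
      ring
  have hop : (∏ μ, rowOp (toNNReal_ne_zero hΔ) P₀.atom (V μ)) H π
      = ∑ s, ∫ ω, h s ω ∂(Experiment.pi E).law := by
    rw [← integral_finsetSum _ fun s _ => hi s]
    have : ∏ μ, rowOp (toNNReal_ne_zero hΔ) P₀.atom (V μ) = (Experiment.pi E).expect :=
      (Experiment.expect_pi E).symm
    rw [this, Ops.expect_apply]
    exact integral_congr_ae (ae_of_all _ hsum)
  rw [mutualInfo, hop, hH, revealSet_entropyF_apply, ← Finset.sum_sub_distrib]
  congr 1
  exact Finset.sum_congr rfl fun s _ => hint s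

end Identification

end LinearEstimation

end

noncomputable section

namespace LinearEstimation

section Marginals

variable {X Y : Type} [Fintype X] [Fintype Y] [DecidableEq Y]

/-- The functional of a measure that evaluates a functional of its image. -/
def Functional.comap (f : X → Y) (F : Functional Y) : Functional X :=
  ⟨fun p => F (marginal f p), (measurable_functional F).comp (measurable_marginal f), by
    obtain ⟨c, hc⟩ := F.2.2
    exact ⟨c, fun p => by rw [← mass_marginal f p]; exact hc _⟩⟩

lemma Functional.comap_apply (f : X → Y) (F : Functional Y) (p : X → ℝ≥0) :
    F.comap f p = F (marginal f p) := rfl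

/-- The operator `U` acts on the functionals of the image under `f` as the operator `U'`. -/
def Intertwines (f : X → Y) (U : Ops X) (U' : Ops Y) : Prop :=
  ∀ F : Functional Y, U (F.comap f) = (U' F).comap f

lemma Intertwines.one (f : X → Y) : Intertwines f (1 : Ops X) 1 := fun _ => rfl

lemma Intertwines.mul {f : X → Y} {U V : Ops X} {U' V' : Ops Y} (hU : Intertwines f U U')
    (hV : Intertwines f V V') : Intertwines f (U * V) (U' * V') := fun F => by
  rw [Ops.mul_apply, hV, hU]
  rfl

lemma Intertwines.pow {f : X → Y} {U : Ops X} {U' : Ops Y} (hU : Intertwines f U U') (k : ℕ) :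
    Intertwines f (U ^ k) (U' ^ k) := by
  induction k with
  | zero => simpa using Intertwines.one f
  | succ k ih => rw [pow_succ, pow_succ]; exact ih.mul hU

lemma Intertwines.prod {f : X → Y} {ι : Type*} {s : Finset ι} {U : ι → Ops X} {U' : ι → Ops Y}
    (h : ∀ i ∈ s, Intertwines f (U i) (U' i)) : Intertwines f (∏ i ∈ s, U i) (∏ i ∈ s, U' i) := by
  classical
  induction s using Finset.induction_on with
  | empty => simpa using Intertwines.one f
  | insert i s hi ih =>
    rw [Finset.prod_insert hi, Finset.prod_insert hi]
    exact (h i (Finset.mem_insert_self _ _)).mul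
      (ih fun j hj => h j (Finset.mem_insert_of_mem hj))

lemma marginal_comp_mul (f : X → Y) (k : Y → ℝ≥0) (p : X → ℝ≥0) :
    marginal f ((fun x => k (f x)) * p) = k * marginal f p := by
  funext y
  simp only [marginal, Pi.mul_apply, Finset.mul_sum]
  refine Finset.sum_congr rfl fun x _ => ?_
  split_ifs with h
  · rw [h]
  · simp

lemma intertwines_reveal {Z : Type} [Fintype Z] [DecidableEq Z] (f : X → Y) (g : Y → Z) :
    Intertwines f (reveal fun x => g (f x)).expect (reveal g).expect := by
  intro F
  ext p
  rw [expect_reveal_apply, Functional.comap_apply, expect_reveal_apply]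
  refine Finset.sum_congr rfl fun z _ => ?_
  rw [Functional.comap_apply]
  have h := marginal_comp_mul f (fun y => if g y = z then 1 else 0) p
  have e1 : (fun x => (if g (f x) = z then 1 else 0 : ℝ≥0)) * p
      = fun x => if g (f x) = z then p x else 0 := by
    funext x
    simp
  rw [← e1, h]
  refine congrArg F.1 (funext fun y => ?_)
  simp

/-- The Markov operator `U` decreases the functional `D`. -/
structure Decreases (D : Functional X) (U : Ops X) : Prop where
  markov : U.IsMarkov
  le : ∀ p, U D p ≤ D p

lemma Decreases.one (D : Functional X) : Decreases D 1 := ⟨Ops.isMarkov_one, fun _ => le_rfl⟩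

lemma Decreases.mul {D : Functional X} {U V : Ops X} (hU : Decreases D U) (hV : Decreases D V) :
    Decreases D (U * V) :=
  ⟨hU.markov.mul hV.markov, fun p => (hU.markov.mono hV.le p).trans (hU.le p)⟩

lemma Decreases.pow {D : Functional X} {U : Ops X} (hU : Decreases D U) (k : ℕ) :
    Decreases D (U ^ k) := by
  induction k with
  | zero => simpa using Decreases.one D
  | succ k ih => rw [pow_succ]; exact ih.mul hU

lemma Decreases.prod {D : Functional X} {ι : Type*} {s : Finset ι} {U : ι → Ops X}
    (h : ∀ i ∈ s, Decreases D (U i)) : Decreases D (∏ i ∈ s, U i) := by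
  classical
  induction s using Finset.induction_on with
  | empty => simpa using Decreases.one D
  | insert i s hi ih =>
    rw [Finset.prod_insert hi]
    exact (h i (Finset.mem_insert_self _ _)).mul
      (ih fun j hj => h j (Finset.mem_insert_of_mem hj))

lemma decreases_expect (E : Experiment X) (f : X → Y) : Decreases (marginalEntropy f) E.expect :=
  ⟨Ops.isMarkov_expect E, expect_marginalEntropy_le E f⟩

end Marginals

section Subsystems

variable {C₀ C : Type} [Fintype C₀] [DecidableEq C₀] [Fintype C] [DecidableEq C] {I : Type}
  [Fintype I] [DecidableEq I] {B : ℕ} {ι : C₀ → C} (hι : Function.Injective ι)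

include hι in
lemma map_pi_comp_injective {Ω : Type} [MeasurableSpace Ω] (μ : C → Measure Ω)
    [∀ l, IsProbabilityMeasure (μ l)] :
    (Measure.pi μ).map (fun φ a => φ (ι a)) = Measure.pi fun a => μ (ι a) := by
  refine (Measure.pi_eq fun s hs => ?_).symm
  have hm : Measurable fun (φ : C → Ω) a => φ (ι a) :=
    measurable_pi_lambda _ fun a => measurable_pi_apply (ι a)
  rw [Measure.map_apply hm (MeasurableSet.univ_pi hs)]
  have e : (fun (φ : C → Ω) a => φ (ι a)) ⁻¹' Set.univ.pi s
      = Set.univ.pi fun l => {y | ∀ a, ι a = l → y ∈ s a} := by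
    ext φ
    simp only [Set.mem_preimage, Set.mem_pi, Set.mem_univ, true_imp_iff, Set.mem_ofPred_eq]
    exact ⟨fun h l a hl => hl ▸ h a, fun h a => h _ a rfl⟩
  rw [e, Measure.pi_pi]
  refine (Fintype.prod_of_injective ι hι _ _ (fun l hl => ?_) fun a => ?_).symm
  · have : {y : Ω | ∀ a, ι a = l → y ∈ s a} = Set.univ :=
      Set.eq_univ_of_forall fun y a ha => absurd ⟨a, ha⟩ hl
    rw [this, measure_univ]
  · congr 1
    ext y
    exact ⟨fun hy a' ha' => hι ha' ▸ hy, fun hy => hy a rfl⟩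

lemma ae_rowLaw_eq_zero (v : C → ℝ≥0) :
    ∀ᵐ φ ∂(rowLaw B v), ∀ l, v l = 0 → φ l = 0 := by
  rw [ae_all_iff]
  intro l
  by_cases h : v l = 0
  · have h1 : ∀ᵐ r ∂(Measure.pi fun _ : Fin B => gaussianReal 0 (v l)), r = 0 := by
      have h0 : ∀ᵐ r ∂(gaussianReal 0 (v l)), r = 0 := by
        rw [h, gaussianReal_zero_var]
        exact (ae_dirac_iff measurableSet_eq).2 rfl
      have h1 : ∀ᵐ r ∂(Measure.pi fun _ : Fin B => gaussianReal 0 (v l)), ∀ b, r b = 0 :=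
        ae_all_iff.2 fun b => (Measure.quasiMeasurePreserving_eval
          (μ := fun _ : Fin B => gaussianReal 0 (v l)) b).ae h0
      filter_upwards [h1] with r hr using funext hr
    have h2 := (Measure.quasiMeasurePreserving_eval
      (μ := fun l => Measure.pi fun _ : Fin B => gaussianReal 0 (v l)) l).ae h1
    filter_upwards [h2] with φ hφ _ using hφ
  · exact ae_of_all _ fun φ h' => absurd h' h

include hι in
lemma rowDot_comp_injective {φ a : C → Fin B → ℝ} (h : ∀ l ∉ Set.range ι, φ l = 0) :
    rowDot φ a = rowDot (fun j => φ (ι j)) fun j => a (ι j) := by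
  unfold rowDot
  refine (Fintype.sum_of_injective ι hι _ _ (fun l hl => ?_) fun a => rfl).symm
  simp [h l hl]

include hι in
lemma map_rowLaw_prod (v : C → ℝ≥0) :
    ((rowLaw B v).prod volume).map (Prod.map (fun (φ : C → Fin B → ℝ) j => φ (ι j)) id)
      = (rowLaw B fun j => v (ι j)).prod (volume : Measure ℝ) := by
  have hm : Measurable fun (φ : C → Fin B → ℝ) j => φ (ι j) :=
    measurable_pi_lambda _ fun a => measurable_pi_apply (ι a)
  rw [← Measure.map_prod_map _ _ hm measurable_id, Measure.map_id]
  congr 1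
  exact map_pi_comp_injective hι _

include hι in
lemma rowPdf_comp_injective (σ : ℝ≥0) (atom : I → Fin B → ℝ) {ω : (C → Fin B → ℝ) × ℝ}
    (h : ∀ l ∉ Set.range ι, ω.1 l = 0) (x : C → I) :
    rowPdf σ (signal atom x) ω
      = rowPdf σ (signal atom fun j => x (ι j)) (Prod.map (fun φ j => φ (ι j)) id ω) := by
  unfold rowPdf
  rw [rowDot_comp_injective hι h]
  rfl

include hι in
lemma intertwines_rowOp {Δ : ℝ≥0} (hΔ : Δ ≠ 0) (atom : I → Fin B → ℝ) {v : C → ℝ≥0}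
    (hv : ∀ l ∉ Set.range ι, v l = 0) :
    Intertwines (fun (x : C → I) j => x (ι j)) (rowOp hΔ atom v)
      (rowOp hΔ atom fun j => v (ι j)) := by
  intro F
  ext p
  obtain ⟨E, hE⟩ : ∃ E, E = rowExp hΔ (signal atom (C := C)) v := ⟨_, rfl⟩
  obtain ⟨E₀, hE₀⟩ : ∃ E₀, E₀ = rowExp hΔ (signal atom (C := C₀)) fun j => v (ι j) := ⟨_, rfl⟩
  rw [rowOp, rowOp, ← hE, ← hE₀, Ops.expect_apply, Functional.comap_apply, Ops.expect_apply]
  have hG : Measurable fun ω => F (E₀.ker ω * marginal (fun (x : C → I) j => x (ι j)) p) :=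
    (measurable_functional F).comp (E₀.measurable_ker_mul.comp measurable_prodMk_left)
  subst hE hE₀
  have hm : Measurable (Prod.map (fun (φ : C → Fin B → ℝ) j => φ (ι j)) (id : ℝ → ℝ)) :=
    (measurable_pi_lambda _ fun a => measurable_pi_apply (ι a)).prodMap measurable_id
  have h2 := integral_map (μ := (rowLaw B v).prod volume) hm.aemeasurable
    (f := fun ω => F ((rowExp hΔ (signal atom (C := C₀)) fun j => v (ι j)).ker ω
      * marginal (fun (x : C → I) j => x (ι j)) p)) hG.aestronglyMeasurable
  rw [map_rowLaw_prod hι] at h2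
  refine Eq.trans ?_ h2.symm
  have h3 : ∀ᵐ ω ∂((rowLaw B v).prod (volume : Measure ℝ)), ∀ l, v l = 0 → ω.1 l = 0 :=
    Measure.quasiMeasurePreserving_fst.ae (ae_rowLaw_eq_zero v)
  refine integral_congr_ae ?_
  filter_upwards [h3] with ω hω
  rw [Functional.comap_apply, ← marginal_comp_mul]
  refine congrArg F.1 (congrArg (marginal _) (congrArg (· * p) (funext fun x => NNReal.eq ?_)))
  exact rowPdf_comp_injective hι Δ atom (fun l hl => hω l (hv l hl)) x

include hι in
/-- The sections of a subsystem are i.i.d. -/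
lemma marginal_prior (P₀ : DiscretePrior B) :
    marginal (fun (x : C → Fin P₀.n) j => x (ι j)) (prior P₀ C) = prior P₀ C₀ := by
  funext y
  have hw : ∑ i, (P₀.weight i).toNNReal = 1 := by
    rw [← NNReal.coe_inj, NNReal.coe_sum]
    simp [P₀.weight_nonneg, P₀.weight_sum]
  set w : Fin P₀.n → ℝ≥0 := fun i => (P₀.weight i).toNNReal with hwdef
  have h1 : ∀ x : C → Fin P₀.n, (if (fun j => x (ι j)) = y then prior P₀ C x else 0)
      = ∏ l, (if ∀ j, ι j = l → x l = y j then w (x l) else 0) := by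
    intro x
    by_cases h : (fun j => x (ι j)) = y
    · rw [if_pos h]
      refine Finset.prod_congr rfl fun l _ => ?_
      rw [if_pos]
      rintro j rfl
      exact congrFun h j
    · rw [if_neg h]
      obtain ⟨j, hj⟩ := Function.ne_iff.1 h
      refine (Finset.prod_eq_zero (Finset.mem_univ (ι j)) (if_neg fun h' => hj (h' j rfl))).symm
  unfold marginal
  simp only [h1]
  rw [← Fintype.piFinset_univ, ← Finset.prod_univ_sum (fun _ => Finset.univ)
    fun l i => if ∀ j, ι j = l → i = y j then w i else 0]
  refine (Fintype.prod_of_injective ι hι _ _ (fun l hl => ?_) fun j => ?_).symm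
  · rw [← hw]
    refine Finset.sum_congr rfl fun i _ => if_pos fun j hj => absurd ⟨j, hj⟩ hl
  · rw [Finset.sum_eq_single (y j)]
    · rw [if_pos fun j' hj' => by rw [hι hj']]
    · intro i _ hi
      exact if_neg fun h => hi (h j rfl)
    · simp

end Subsystems

section Decoupling

variable {C : Type} [Fintype C] [DecidableEq C] {B : ℕ}

/-- A system whose rows act on the sections of one group only is not better, for the observer, than
the separate groups. -/
theorem prod_rowOp_le_sum (P₀ : DiscretePrior B) {Δ : ℝ≥0} (hΔ : Δ ≠ 0) {G : Type} [Fintype G]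
    {C' : G → Type} [∀ g, Fintype (C' g)] [∀ g, DecidableEq (C' g)] {ι : ∀ g, C' g → C}
    (hι : ∀ g, Function.Injective (ι g)) (hcover : ∀ l, ∃ g j, ι g j = l) {τ : Type} [Fintype τ]
    {V : G → τ → C → ℝ≥0} (hV : ∀ g t, ∀ l ∉ Set.range (ι g), V g t l = 0) (m : G → τ → ℕ)
    (K : Finset C) :
    (∏ g, ∏ t, rowOp hΔ P₀.atom (V g t) ^ m g t) (revealSet K (entropyF _)) (prior P₀ C)
      ≤ ∑ g, (∏ t, rowOp hΔ P₀.atom (fun j => V g t (ι g j)) ^ m g t)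
          (revealSet (K.preimage (ι g) (hι g).injOn) (entropyF _)) (prior P₀ (C' g)) := by
  classical
  set π := prior P₀ C
  set f : ∀ g, (C → Fin P₀.n) → C' g → Fin P₀.n := fun g x j => x (ι g j) with hf
  set Q : G → Ops (C → Fin P₀.n) := fun g => ∏ t, rowOp hΔ P₀.atom (V g t) ^ m g t with hQ
  have hinj : Function.Injective fun x g => f g x := by
    intro x y hxy
    funext l
    obtain ⟨g, j, rfl⟩ := hcover l
    exact congrFun (congrFun hxy g) j
  have hQd : ∀ g g', Decreases (marginalEntropy (f g)) (Q g') := fun g g' =>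
    Decreases.prod fun t _ => (decreases_expect _ _).pow _
  have hQm : ∀ g, (Q g).IsMarkov := fun g => Ops.isMarkov_prod fun t _ => (isMarkov_rowOp _ _ _).pow _
  have hm : ((∏ g, Q g) * revealSet K).IsMarkov :=
    (Ops.isMarkov_prod fun g _ => hQm g).mul (isMarkov_revealSet K)
  have h1 := hm.mono (f := entropyF _) (g := ∑ g, marginalEntropy (f g)) (fun p => by
    rw [Functional.sum_apply]
    exact entropy_le_sum_marginalEntropy f hinj p) π
  rw [Ops.map_sum, Functional.sum_apply] at h1
  refine le_trans h1 (Finset.sum_le_sum fun g _ => ?_)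
  set S := K.preimage (ι g) (hι g).injOn with hS
  have e1 : revealSet (I := Fin P₀.n) K = (∏ j ∈ S, (reveal fun x : C → Fin P₀.n => x (ι g j)).expect)
      * ∏ l ∈ K with l ∉ Set.range (ι g), (reveal fun x : C → Fin P₀.n => x l).expect := by
    rw [revealSet, ← Finset.prod_filter_mul_prod_filter_not K (fun l => l ∈ Set.range (ι g)), hS,
      Finset.prod_preimage' (ι g) K (hι g).injOn
        fun l => (reveal fun x : C → Fin P₀.n => x l).expect]
  have e2 : (∏ g, Q g) = Q g * ∏ g' ∈ Finset.univ.erase g, Q g' :=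
    (Finset.mul_prod_erase _ _ (Finset.mem_univ g)).symm
  set A := Q g * ∏ j ∈ S, (reveal fun x : C → Fin P₀.n => x (ι g j)).expect with hA
  have hAm : A.IsMarkov := (hQm g).mul (Ops.isMarkov_prod fun _ _ => Ops.isMarkov_expect _)
  have hD : Decreases (marginalEntropy (f g)) ((∏ g' ∈ Finset.univ.erase g, Q g')
      * ∏ l ∈ K with l ∉ Set.range (ι g), (reveal fun x : C → Fin P₀.n => x l).expect) :=
    (Decreases.prod fun g' _ => hQd g g').mul (Decreases.prod fun l _ => decreases_expect _ _)
  have e3 : (∏ g, Q g) * revealSet K = A * ((∏ g' ∈ Finset.univ.erase g, Q g')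
      * ∏ l ∈ K with l ∉ Set.range (ι g), (reveal fun x : C → Fin P₀.n => x l).expect) := by
    rw [e1, e2, hA]
    ring
  rw [e3]
  refine (hAm.mono hD.le π).trans_eq ?_
  have hI : Intertwines (f g) A ((∏ t, rowOp hΔ P₀.atom (fun j => V g t (ι g j)) ^ m g t)
      * revealSet S) :=
    (Intertwines.prod fun t _ => (intertwines_rowOp (hι g) hΔ P₀.atom (hV g t)).pow _).mul
      (Intertwines.prod fun j _ => intertwines_reveal (f g) fun y => y j)
  have h2 := hI (entropyF _)
  have h3 : marginalEntropy (f g) = (entropyF (C' g → Fin P₀.n)).comap (f g) := rfl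
  rw [h3, h2, Functional.comap_apply, marginal_prior (hι g)]
  rfl

end Decoupling

section PriorEntropy

variable {C : Type} [Fintype C] [DecidableEq C] {B : ℕ}

/-- The entropy of a section. -/
def sectionEntropy (P₀ : DiscretePrior B) : ℝ := ∑ i, P₀.weight i * -Real.log (P₀.weight i)

lemma condMass_prior (P₀ : DiscretePrior B) (K : Finset C) (s : C → Fin P₀.n) :
    condMass K (prior P₀ C) s = ∏ l ∈ K, (P₀.weight (s l)).toNNReal := by
  have h := congrFun (marginal_prior (ι := fun a : K => (a : C)) Subtype.val_injective P₀)
    fun a => s a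
  rw [prior, Finset.prod_coe_sort K fun l => (P₀.weight (s l)).toNNReal] at h
  rw [← h]
  refine Finset.sum_congr rfl fun x _ => ?_
  congr 1
  simp only [funext_iff, Subtype.forall]

lemma sum_prior_mul (P₀ : DiscretePrior B) (l : C) (g : Fin P₀.n → ℝ) :
    ∑ s, (prior P₀ C s : ℝ) * g (s l) = ∑ i, P₀.weight i * g i := by
  have h := sum_marginal_mul (fun (x : C → Fin P₀.n) (_ : Unit) => x l) (prior P₀ C) fun y => g (y ())
  rw [marginal_prior (ι := fun _ : Unit => l) (fun _ _ _ => rfl) P₀] at h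
  rw [← h]
  refine Fintype.sum_equiv (Equiv.funUnique Unit _) _ _ fun y => ?_
  simp [prior, P₀.weight_nonneg]

lemma revealSet_entropyF_prior (P₀ : DiscretePrior B) (K : Finset C) :
    revealSet K (entropyF _) (prior P₀ C)
      = ((Fintype.card C : ℝ) - K.card) * sectionEntropy P₀ := by
  rw [revealSet_entropyF_apply]
  have h : ∀ s, (prior P₀ C s : ℝ) * Real.log (condMass K (prior P₀ C) s / prior P₀ C s)
      = ∑ l ∈ Kᶜ, (prior P₀ C s : ℝ) * -Real.log (P₀.weight (s l)) := by
    intro s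
    rcases eq_or_lt_of_le (NNReal.coe_nonneg (prior P₀ C s)) with e | e
    · simp [← e]
    · have hw : ∀ l, P₀.weight (s l) ≠ 0 := by
        intro l h0
        rw [coe_prior, priorProb, Finset.prod_eq_zero (Finset.mem_univ l) h0] at e
        exact lt_irrefl _ e
      rw [← Finset.mul_sum]
      congr 1
      rw [condMass_prior, coe_prior, priorProb, NNReal.coe_prod]
      simp only [Real.coe_toNNReal _ (P₀.weight_nonneg _)]
      rw [Real.log_div (Finset.prod_ne_zero_iff.2 fun l _ => hw l)
        (Finset.prod_ne_zero_iff.2 fun l _ => hw l), Real.log_prod fun l _ => hw l,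
        Real.log_prod fun l _ => hw l, ← Finset.sum_add_sum_compl K]
      simp
  simp only [h]
  rw [Finset.sum_comm]
  simp only [sum_prior_mul P₀ _ fun i => -Real.log (P₀.weight i)]
  rw [Finset.sum_const, Finset.card_compl, nsmul_eq_mul, Nat.cast_sub (Finset.card_le_univ K)]
  rfl

end PriorEntropy

end LinearEstimation

end

noncomputable section

namespace LinearEstimation

section BlockSystems

variable {B : ℕ} (P₀ : DiscretePrior B) {Δ : ℝ≥0} (hΔ : Δ ≠ 0)

/-- The comparison theorem for signals with i.i.d. sections. -/
theorem exists_prod_rowOp_prior_le {c : ℝ} (hc : 0 ≤ c) {δ : ℝ} (hδ : 0 < δ) :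
    ∃ T : ℝ, 0 ≤ T ∧ ∀ (C : Type) [Fintype C] [DecidableEq C] [Nonempty C] (R : Type) [Fintype R]
      (τ : Type) [Fintype τ] (w : R → τ → ℝ≥0) (V : τ → C → ℝ≥0) (U : R → C → ℝ≥0),
      (∀ μ, ∑ t, w μ t = 1) → (∀ μ l, U μ l = ∑ t, w μ t * V t l) →
      (∀ μ l, (U μ l : ℝ) * Fintype.card C ≤ c) → ∀ d : ℝ, 0 ≤ d → (∀ t, ∑ l, (V t l : ℝ) ≤ d) →
      ∀ (K : Finset C) (σ : ℝ), 0 < σ → ∀ m : τ → ℕ,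
        (∏ μ, rowOp hΔ P₀.atom (U μ)) (revealSet K (entropyF _)) (prior P₀ C)
          ≤ (∏ t, rowOp hΔ P₀.atom (V t) ^ m t) (revealSet K (entropyF _)) (prior P₀ C)
            + (δ * Fintype.card R + T + d * power P₀.atom / (2 * Δ) * ∑ t, (σ + (∑ μ, (w μ t : ℝ)
                + (∑ μ, (w μ t : ℝ) - m t) ^ 2) / σ) / 2) := by
  obtain ⟨K, hK0, hK⟩ := exists_prod_rowOp_le hΔ P₀.atom hc (half_pos hδ)
  have hlog := Real.log_natCast_nonneg (Fintype.card (Fin P₀.n))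
  obtain ⟨θ, hθ⟩ := exists_nat_gt (K * Real.log (Fintype.card (Fin P₀.n)) / (δ / 2))
  have hθ0 : (0 : ℝ) < θ := lt_of_le_of_lt (by positivity) hθ
  have hθ' : 0 < θ := by exact_mod_cast hθ0
  refine ⟨θ * Real.log (Fintype.card (Fin P₀.n)), by positivity,
    fun C _ _ _ R _ τ _ w V U hw hU hc d hd hV S σ hσ m => ?_⟩
  have h := hK C R τ w V U hw hU hc d hd hV _ (isMarkov_revealSet S) θ hθ' σ hσ m (prior P₀ C)
  rw [mass_prior, mul_one] at h
  have h1 : K * (Real.log (Fintype.card (Fin P₀.n)) / θ) ≤ δ / 2 := by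
    rw [← mul_div_assoc, div_le_iff₀ hθ0]
    rw [div_lt_iff₀ (by positivity)] at hθ
    linarith
  have h2 : (Fintype.card R : ℝ) * (δ / 2 + K * (Real.log (Fintype.card (Fin P₀.n)) / θ))
      ≤ δ * Fintype.card R := by
    have : (0 : ℝ) ≤ Fintype.card R := Nat.cast_nonneg _
    nlinarith
  linarith

lemma prod_rowOp_entropyF_equiv {C₀ C R : Type} [Fintype C₀] [DecidableEq C₀] [Fintype C]
    [DecidableEq C] (e : C₀ ≃ C) (V : R → C → ℝ≥0) (s : Finset R) :
    (∏ μ ∈ s, rowOp hΔ P₀.atom (V μ)) (entropyF _) (prior P₀ C)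
      = (∏ μ ∈ s, rowOp hΔ P₀.atom fun j => V μ (e j)) (entropyF _) (prior P₀ C₀) := by
  set f : (C → Fin P₀.n) → C₀ → Fin P₀.n := fun x j => x (e j) with hf
  have hfi : Function.Injective f := fun x y h => by
    funext l
    simpa [hf] using congrFun h (e.symm l)
  have h1 : entropyF (C → Fin P₀.n) = (entropyF (C₀ → Fin P₀.n)).comap f := by
    ext p
    rw [Functional.comap_apply, entropyF_apply, entropyF_apply, entropy_marginal, entropy]
    refine Finset.sum_congr rfl fun x _ => ?_
    have : marginal f p (f x) = p x := by
      simp only [marginal, hfi.eq_iff]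
      simp
    rw [this]
  have h2 : Intertwines f (∏ μ ∈ s, rowOp hΔ P₀.atom (V μ))
      (∏ μ ∈ s, rowOp hΔ P₀.atom fun j => V μ (e j)) :=
    Intertwines.prod fun μ _ => intertwines_rowOp e.injective hΔ P₀.atom
      fun l hl => absurd (e.surjective l) hl
  rw [h1, h2, Functional.comap_apply, marginal_prior e.injective]

/-- The variances of a row of a block matrix. -/
def blockVar {Γ : ℕ} (J : Fin Γ → Fin Γ → ℝ≥0) (ℓ : ℕ) (r : Fin Γ) (l : Fin Γ × Fin ℓ) : ℝ≥0 :=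
  J r l.1 / ((Γ : ℝ≥0) * (ℓ : ℝ≥0))

/-- The remaining entropy of the signal in a block system. -/
def blockEntropy {Γ : ℕ} (J : Fin Γ → Fin Γ → ℝ≥0) (seed : Finset (Fin Γ)) (ℓ m : ℕ) : ℝ :=
  (∏ r, rowOp hΔ P₀.atom (blockVar J ℓ r) ^ m) (revealSet (seed ×ˢ Finset.univ) (entropyF _))
    (prior P₀ (Fin Γ × Fin ℓ))

lemma prod_fst_eq_prod_pow {M α : Type} [CommMonoid M] [Fintype α] (f : α → M) (m : ℕ) :
    ∏ μ : α × Fin m, f μ.1 = ∏ r, f r ^ m := by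
  simp [Fintype.prod_prod_type]

lemma blockMI_eq {Δ : ℝ} (hΔ : 0 < Δ) {Γ : ℕ} (J : Fin Γ → Fin Γ → ℝ≥0) (seed : Finset (Fin Γ))
    (ℓ m : ℕ) : blockMI P₀ Δ J seed ℓ m = 1 / (Γ * ℓ : ℝ) * ((Γ - seed.card) * ℓ * sectionEntropy P₀
      - blockEntropy P₀ (toNNReal_ne_zero hΔ) J seed ℓ m) := by
  rw [blockMI, mutualInfo_eq P₀ hΔ, revealSet_entropyF_prior, blockEntropy,
    ← prod_fst_eq_prod_pow]
  simp only [Finset.card_product, Fintype.card_prod, Fintype.card_fin, Finset.card_univ]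
  push_cast
  rw [← sub_mul]
  rfl

lemma csMI_eq {Δ : ℝ} (hΔ : 0 < Δ) (L M : ℕ) : csMI P₀ Δ L M = 1 / (L : ℝ) * (L * sectionEntropy P₀
      - blockEntropy P₀ (toNNReal_ne_zero hΔ) (Γ := 1) (fun _ _ => 1) ∅ L M) := by
  rw [csMI, mutualInfo_eq P₀ hΔ, revealSet_entropyF_prior, blockEntropy]
  simp only [revealSet, Finset.prod_empty, Finset.empty_product, Ops.one_apply, Fintype.card_fin,
    Finset.card_empty, Nat.cast_zero, sub_zero]
  congr 2
  rw [prod_rowOp_entropyF_equiv P₀ _ (Equiv.uniqueProd (Fin L) (Fin 1))]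
  simp only [Finset.prod_const, Finset.card_univ, Fintype.card_fin, Finset.univ_unique,
    Finset.prod_singleton]
  have e : blockVar (Γ := 1) (fun _ _ => 1) L default = fun _ => 1 / (L : ℝ≥0) := by
    funext l
    simp [blockVar]
  rw [e]

lemma card_mul_cast_pos {Γ ℓ : ℕ} (hΓ : 0 < Γ) (hℓ : 0 < ℓ) : (0 : ℝ) < Γ * ℓ := by
  have h1 : (0 : ℝ) < Γ := by exact_mod_cast hΓ
  have h2 : (0 : ℝ) < ℓ := by exact_mod_cast hℓ
  positivity

lemma sum_blockVar_le {Γ : ℕ} {J : Fin Γ → Fin Γ → ℝ≥0} {d : ℝ} (hd : 0 ≤ d)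
    (hJ : ∀ r, ∑ c, (J r c : ℝ) ≤ Γ * d) (ℓ : ℕ) (r : Fin Γ) :
    ∑ l, (blockVar J ℓ r l : ℝ) ≤ d := by
  have hΓ : 0 < Γ := r.pos
  have hΓ' : (0 : ℝ) < Γ := by exact_mod_cast hΓ
  rcases Nat.eq_zero_or_pos ℓ with h | h
  · subst h; simpa using hd
  have hℓ : (0 : ℝ) < ℓ := by exact_mod_cast h
  simp only [blockVar, Fintype.sum_prod_type, NNReal.coe_div, NNReal.coe_mul, NNReal.coe_natCast,
    Finset.sum_const, Finset.card_univ, Fintype.card_fin, nsmul_eq_mul]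
  rw [← Finset.mul_sum, ← Finset.sum_div, mul_div_assoc', div_le_iff₀ (by positivity)]
  nlinarith [hJ r]

lemma isLoss_blockRow {Γ : ℕ} {J : Fin Γ → Fin Γ → ℝ≥0} {d : ℝ} (hd : 0 ≤ d)
    (hJ : ∀ r, ∑ c, (J r c : ℝ) ≤ Γ * d) (ℓ : ℕ) (r : Fin Γ)
    {S : Ops (Fin Γ × Fin ℓ → Fin P₀.n)} (hS : S.IsMarkov) :
    IsLoss (S (entropyF _)) (d * power P₀.atom / (2 * Δ)) (rowOp hΔ P₀.atom (blockVar J ℓ r)) :=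
  isLoss_rowOp hΔ P₀.atom (sum_blockVar_le hd hJ ℓ r) hS

lemma blockEntropy_nonneg {Γ : ℕ} (J : Fin Γ → Fin Γ → ℝ≥0) (seed : Finset (Fin Γ)) (ℓ m : ℕ) :
    0 ≤ blockEntropy P₀ hΔ J seed ℓ m := by
  refine ((Ops.isMarkov_prod fun r _ => (isMarkov_rowOp hΔ P₀.atom _).pow m).mul
    (isMarkov_revealSet _)).nonneg (entropyF _) (fun p => entropy_nonneg p) _

/-- The remaining entropy is a Lipschitz function of the number of measurements. -/
lemma abs_blockEntropy_sub_le {Γ : ℕ} {J : Fin Γ → Fin Γ → ℝ≥0} {d : ℝ} (hd : 0 ≤ d)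
    (hJ : ∀ r, ∑ c, (J r c : ℝ) ≤ Γ * d) (seed : Finset (Fin Γ)) (ℓ m m' : ℕ) :
    |blockEntropy P₀ hΔ J seed ℓ m - blockEntropy P₀ hΔ J seed ℓ m'|
      ≤ d * power P₀.atom / (2 * Δ) * Γ * |(m : ℝ) - m'| := by
  wlog h : m ≤ m' generalizing m m'
  · rw [abs_sub_comm, abs_sub_comm (m : ℝ)]
    exact this m' m (le_of_not_ge h)
  obtain ⟨k, rfl⟩ := Nat.exists_eq_add_of_le h
  have hS := isMarkov_revealSet (I := Fin P₀.n) (seed ×ˢ (Finset.univ : Finset (Fin ℓ)))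
  have hL := IsLoss.prod (s := Finset.univ) fun r _ => (isLoss_blockRow P₀ hΔ hd hJ ℓ r hS).pow k
  have hM : (∏ r, rowOp hΔ P₀.atom (blockVar J ℓ r) ^ m).IsMarkov :=
    Ops.isMarkov_prod fun r _ => (isMarkov_rowOp hΔ P₀.atom _).pow m
  have h1 := hL.le _ hM (prior P₀ _)
  have h2 := hL.le_add _ hM (prior P₀ _)
  rw [← Finset.prod_mul_distrib] at h1 h2
  simp only [← pow_add] at h1 h2
  rw [mass_prior, mul_one, Finset.sum_const, Finset.card_univ, Fintype.card_fin,
    nsmul_eq_mul] at h2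
  change blockEntropy P₀ hΔ J seed ℓ (m + k) ≤ blockEntropy P₀ hΔ J seed ℓ m at h1
  change blockEntropy P₀ hΔ J seed ℓ m ≤ blockEntropy P₀ hΔ J seed ℓ (m + k) + _ at h2
  rw [abs_of_nonneg (by linarith)]
  push_cast
  rw [sub_add_cancel_left, abs_neg, abs_of_nonneg (Nat.cast_nonneg k)]
  linarith

lemma blockVar_mul_card_le {Γ : ℕ} {J : Fin Γ → Fin Γ → ℝ≥0} {c : ℝ} (hJ : ∀ r c', (J r c' : ℝ) ≤ c)
    (hΓ : 0 < Γ) {ℓ : ℕ} (hℓ : 0 < ℓ) (r : Fin Γ) (l : Fin Γ × Fin ℓ) :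
    (blockVar J ℓ r l : ℝ) * Fintype.card (Fin Γ × Fin ℓ) ≤ c := by
  have := card_mul_cast_pos hΓ hℓ
  simp only [blockVar, NNReal.coe_div, NNReal.coe_mul, NNReal.coe_natCast, Fintype.card_prod,
    Fintype.card_fin, Nat.cast_mul]
  rw [div_mul_cancel₀ _ this.ne']
  exact hJ _ _

lemma entropyF_apply_le {C I : Type} [Fintype C] [DecidableEq C] [Fintype I] {U : Ops (C → I)}
    (hU : U.IsMarkov) (p : (C → I) → ℝ≥0) :
    U (entropyF _) p ≤ Fintype.card C * Real.log (Fintype.card I) * mass p := by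
  refine (hU.mono (g := (Fintype.card C * Real.log (Fintype.card I)) • massF _)
    (fun q => ?_) p).trans_eq (hU.smul_mass _ p)
  refine (entropy_le q).trans_eq ?_
  rw [Fintype.card_fun, Nat.cast_pow, Real.log_pow]
  rfl

end BlockSystems

end LinearEstimation

end

noncomputable section

namespace LinearEstimation

section Comparisons

variable {B : ℕ} (P₀ : DiscretePrior B) {Δ : ℝ≥0} (hΔ : Δ ≠ 0)

/-- A large block system is compared with independent copies of a small one. -/
theorem exists_blockEntropy_le_copies {Γ : ℕ} (hΓ : 0 < Γ) (J : Fin Γ → Fin Γ → ℝ≥0)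
    (seed : Finset (Fin Γ)) {d : ℝ} (hd : 0 ≤ d) (hJ : ∀ r, ∑ c, (J r c : ℝ) ≤ Γ * d) {δ : ℝ}
    (hδ : 0 < δ) : ∃ T : ℝ, 0 ≤ T ∧ ∀ ℓ k m n : ℕ, 0 < ℓ → 0 < k → ∀ σ : ℝ, 0 < σ →
      blockEntropy P₀ hΔ J seed ℓ m ≤ (ℓ / k : ℕ) * blockEntropy P₀ hΔ J seed k n
        + (Γ * k * Real.log P₀.n + (δ * (Γ * m) + T + d * power P₀.atom / (2 * Δ)
          * (Γ * ((ℓ / k : ℕ) * ((σ + ((m * k / ℓ : ℝ) + (m * k / ℓ - n) ^ 2) / σ) / 2)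
            + (σ + ((m * (ℓ % k : ℕ) / ℓ : ℝ) + (m * (ℓ % k : ℕ) / ℓ) ^ 2) / σ) / 2)))) := by
  have hJd : ∀ r c, (J r c : ℝ) ≤ Γ * d := fun r c =>
    (Finset.single_le_sum (f := fun c => (J r c : ℝ)) (fun _ _ => NNReal.coe_nonneg _)
      (Finset.mem_univ c)).trans (hJ r)
  have hΓ' : (0 : ℝ) < Γ := by exact_mod_cast hΓ
  obtain ⟨T, hT0, hT⟩ := exists_prod_rowOp_prior_le P₀ hΔ (c := Γ * d) (by positivity) hδ
  refine ⟨T, hT0, fun ℓ k m n hℓ hk σ hσ => ?_⟩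
  have : Nonempty (Fin Γ × Fin ℓ) := ⟨(⟨0, hΓ⟩, ⟨0, hℓ⟩)⟩
  have hℓ' : (0 : ℝ) < ℓ := by exact_mod_cast hℓ
  have hℓn : (ℓ : ℝ≥0) ≠ 0 := by exact_mod_cast hℓ.ne'
  have hΓn : (Γ : ℝ≥0) ≠ 0 := by exact_mod_cast hΓ.ne'
  set q := ℓ / k with hq
  set s := ℓ % k with hs
  let size : Option (Fin q) → ℕ := fun g => g.elim s fun _ => k
  have hsize : ∑ g, size g = ℓ := by
    rw [Fintype.sum_option]
    simp only [size, Option.elim, Finset.sum_const, Finset.card_univ, Fintype.card_fin, smul_eq_mul]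
    rw [hq, hs, mul_comm]
    exact Nat.mod_add_div ℓ k
  have e : Fin ℓ ≃ Σ g, Fin (size g) := Fintype.equivOfCardEq (by
    rw [Fintype.card_sigma]
    simp only [Fintype.card_fin, hsize])
  let V : Option (Fin q) → Fin Γ → Fin Γ × Fin ℓ → ℝ≥0 := fun g r l =>
    if (e l.2).1 = g then J r l.1 / ((Γ : ℝ≥0) * (size g : ℝ≥0)) else 0
  let w : Fin Γ × Fin m → Option (Fin q) × Fin Γ → ℝ≥0 := fun μ t =>
    if μ.1 = t.2 then (size t.1 : ℝ≥0) / ℓ else 0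
  let ι : ∀ g, Fin Γ × Fin (size g) → Fin Γ × Fin ℓ := fun g z => (z.1, e.symm ⟨g, z.2⟩)
  have hι : ∀ g, Function.Injective (ι g) := by
    rintro g ⟨a, i⟩ ⟨b, j⟩ h
    simp only [ι, Prod.mk.injEq, EmbeddingLike.apply_eq_iff_eq, Sigma.mk.injEq, heq_eq_eq,
      true_and] at h
    exact Prod.ext h.1 h.2
  have hVι : ∀ g r j, V g r (ι g j) = blockVar J (size g) r j := by
    intro g r j
    simp only [V, ι, Equiv.apply_symm_apply, if_true, blockVar]
  have hV0 : ∀ g r, ∀ l ∉ Set.range (ι g), V g r l = 0 := by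
    intro g r l hl
    refine if_neg fun h => ?_
    have h' : (e l.2).1 = g := h
    subst h'
    exact hl ⟨(l.1, (e l.2).2), by simp [ι]⟩
  have hVsum : ∀ t : Option (Fin q) × Fin Γ, ∑ l, (V t.1 t.2 l : ℝ) ≤ d := by
    rintro ⟨g, r⟩
    rw [← Fintype.sum_of_injective (ι g) (hι g) (fun j => (blockVar J (size g) r j : ℝ)) _
      (fun l hl => by rw [hV0 g r l hl, NNReal.coe_zero]) fun j => by rw [hVι]]
    exact sum_blockVar_le hd hJ _ r
  have hw1 : ∀ μ, ∑ t, w μ t = 1 := by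
    intro μ
    simp only [w, Fintype.sum_prod_type, Finset.sum_ite_eq, Finset.mem_univ, if_true]
    rw [← Finset.sum_div, ← Nat.cast_sum, hsize, div_self hℓn]
  have hmix : ∀ (μ : Fin Γ × Fin m) l, blockVar J ℓ μ.1 l = ∑ t, w μ t * V t.1 t.2 l := by
    intro μ l
    have hpos : ((size (e l.2).1 : ℕ) : ℝ≥0) ≠ 0 := by
      have := (e l.2).2.pos
      exact_mod_cast this.ne'
    rw [Fintype.sum_prod_type, Finset.sum_eq_single (e l.2).1
      (fun g _ hg => Finset.sum_eq_zero fun r _ => by simp [V, Ne.symm hg]) (by simp),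
      Finset.sum_eq_single μ.1 (fun r _ hr => by simp [w, Ne.symm hr]) (by simp)]
    simp only [w, V, if_true, blockVar]
    field_simp
  have hcount : ∀ t : Option (Fin q) × Fin Γ, ∑ μ, (w μ t : ℝ) = m * (size t.1 : ℝ) / ℓ := by
    intro t
    rw [Fintype.sum_prod_type, Finset.sum_eq_single t.2
      (fun r _ hr => Finset.sum_eq_zero fun i _ => by simp [w, hr]) (by simp)]
    simp only [w, if_true, Finset.sum_const, Finset.card_univ, Fintype.card_fin, nsmul_eq_mul,
      NNReal.coe_div, NNReal.coe_natCast]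
    ring
  let tgt : Option (Fin q) → ℕ := fun g => g.elim 0 fun _ => n
  have h1 := hT (Fin Γ × Fin ℓ) (Fin Γ × Fin m) (Option (Fin q) × Fin Γ) w (fun t => V t.1 t.2)
    (fun μ => blockVar J ℓ μ.1) hw1 hmix
    (fun μ l => blockVar_mul_card_le hJd hΓ hℓ μ.1 l) d hd hVsum
    (seed ×ˢ Finset.univ) σ hσ (fun t => tgt t.1)
  have h2 := prod_rowOp_le_sum P₀ hΔ hι (fun l => ⟨(e l.2).1, (l.1, (e l.2).2), by simp [ι]⟩) hV0
    (fun g _ => tgt g) (seed ×ˢ Finset.univ)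
  rw [← Fintype.prod_prod_type' (f := fun g r => rowOp hΔ P₀.atom (V g r) ^ tgt g)] at h2
  rw [prod_fst_eq_prod_pow fun r => rowOp hΔ P₀.atom (blockVar J ℓ r)] at h1
  refine (h1.trans (add_le_add_left h2 _)).trans ?_
  simp only [hVι, hcount]
  have hpre : ∀ g, (seed ×ˢ (Finset.univ : Finset (Fin ℓ))).preimage (ι g) (hι g).injOn
      = seed ×ˢ Finset.univ := by
    intro g
    ext z
    simp [ι]
  simp only [hpre]
  rw [Fintype.sum_option, Fintype.sum_prod_type, Fintype.sum_option]
  have h3 : (∏ t, rowOp hΔ P₀.atom (fun j => blockVar J (size none) t j) ^ tgt none)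
      (revealSet (seed ×ˢ Finset.univ) (entropyF _)) (prior P₀ (Fin Γ × Fin (size none)))
      ≤ Γ * k * Real.log P₀.n := by
    refine (entropyF_apply_le ((Ops.isMarkov_prod fun t _ => (isMarkov_rowOp hΔ _ _).pow _).mul
      (isMarkov_revealSet _)) _).trans ?_
    rw [mass_prior, mul_one]
    have h4 : ((size none : ℕ) : ℝ) ≤ k := by
      simp only [size, Option.elim]
      exact_mod_cast (Nat.mod_lt ℓ hk).le
    simp only [Fintype.card_prod, Fintype.card_fin, Nat.cast_mul]
    have := Real.log_natCast_nonneg P₀.n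
    gcongr
  have h5 : ∀ i : Fin q, (∏ t, rowOp hΔ P₀.atom (fun j => blockVar J (size (some i)) t j)
      ^ tgt (some i)) (revealSet (seed ×ˢ Finset.univ) (entropyF _))
        (prior P₀ (Fin Γ × Fin (size (some i)))) = blockEntropy P₀ hΔ J seed k n := fun _ => rfl
  simp only [h5]
  simp only [size, tgt, Option.elim, Finset.sum_const, Finset.card_univ, Fintype.card_fin,
    nsmul_eq_mul, Fintype.card_prod, Nat.cast_mul, Nat.cast_zero, sub_zero]
  refine (add_le_add_left (add_le_add_left h3 _) _).trans_eq ?_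
  ring

/-- The uncoupled system is compared with a coupled system of the same size. -/
theorem exists_blockEntropy_one_le {Γ : ℕ} (hΓ : 0 < Γ) (J : Fin Γ → Fin Γ → ℝ≥0) {d : ℝ}
    (hd : 0 ≤ d) (hJ : ∀ r, ∑ c, (J r c : ℝ) ≤ Γ * d) (hcol : ∀ c, ∑ r, J r c = Γ) {δ : ℝ}
    (hδ : 0 < δ) : ∃ T : ℝ, 0 ≤ T ∧ ∀ ℓ m : ℕ, 0 < ℓ → ∀ σ : ℝ, 0 < σ →
      blockEntropy P₀ hΔ (Γ := 1) (fun _ _ => 1) ∅ (Γ * ℓ) (Γ * m) ≤ blockEntropy P₀ hΔ J ∅ ℓ m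
        + (δ * (Γ * m) + T + d * power P₀.atom / (2 * Δ) * (Γ * ((σ + m / σ) / 2))) := by
  have hΓ' : (0 : ℝ) < Γ := by exact_mod_cast hΓ
  have hΓn : (Γ : ℝ≥0) ≠ 0 := by exact_mod_cast hΓ.ne'
  obtain ⟨T, hT0, hT⟩ := exists_prod_rowOp_prior_le P₀ hΔ (c := 1) zero_le_one hδ
  refine ⟨T, hT0, fun ℓ m hℓ σ hσ => ?_⟩
  have : Nonempty (Fin Γ × Fin ℓ) := ⟨(⟨0, hΓ⟩, ⟨0, hℓ⟩)⟩
  have hℓn : (ℓ : ℝ≥0) ≠ 0 := by exact_mod_cast hℓ.ne'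
  have hpos := card_mul_cast_pos hΓ hℓ
  have h1 := hT (Fin Γ × Fin ℓ) (Fin Γ × Fin m) (Fin Γ) (fun _ _ => 1 / (Γ : ℝ≥0))
    (fun r => blockVar J ℓ r) (fun _ _ => 1 / ((Γ : ℝ≥0) * (ℓ : ℝ≥0)))
    (fun μ => by simp [hΓn])
    (fun μ l => by
      rw [← Finset.mul_sum]
      simp only [blockVar]
      rw [← Finset.sum_div, hcol]
      field_simp)
    (fun μ l => by
      simp only [Fintype.card_prod, Fintype.card_fin, NNReal.coe_div, NNReal.coe_mul,
        NNReal.coe_natCast, Nat.cast_mul, NNReal.coe_one]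
      rw [one_div_mul_cancel hpos.ne'])
    d hd (fun r => sum_blockVar_le hd hJ ℓ r) ∅ σ hσ (fun _ => m)
  have e : Fin 1 × Fin (Γ * ℓ) ≃ Fin Γ × Fin ℓ := Fintype.equivOfCardEq (by simp)
  have h2 : (∏ μ : Fin Γ × Fin m, rowOp hΔ P₀.atom
      (fun _ : Fin Γ × Fin ℓ => 1 / ((Γ : ℝ≥0) * (ℓ : ℝ≥0)))) (revealSet ∅ (entropyF _)) (prior P₀ _)
      = blockEntropy P₀ hΔ (Γ := 1) (fun _ _ => 1) ∅ (Γ * ℓ) (Γ * m) := by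
    refine (prod_rowOp_entropyF_equiv P₀ hΔ e _ _).trans ?_
    have e2 : blockVar (Γ := 1) (fun _ _ => 1) (Γ * ℓ) default
        = fun _ => 1 / ((Γ : ℝ≥0) * (ℓ : ℝ≥0)) := by
      funext l
      simp [blockVar]
    rw [blockEntropy]
    simp only [Finset.prod_const, Finset.card_univ, Fintype.card_fin, Finset.univ_unique,
      Finset.prod_singleton, Fintype.card_prod, e2]
    rfl
  rw [h2] at h1
  refine h1.trans (le_of_eq ?_)
  have h3 : ∑ _μ : Fin Γ × Fin m, ((1 / (Γ : ℝ≥0) : ℝ≥0) : ℝ) = m := by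
    simp only [Finset.sum_const, Finset.card_univ, Fintype.card_prod, Fintype.card_fin,
      nsmul_eq_mul, NNReal.coe_div, NNReal.coe_one, NNReal.coe_natCast, Nat.cast_mul]
    field_simp
  simp only [h3, Fintype.card_prod, Fintype.card_fin, Finset.sum_const, Finset.card_univ,
    nsmul_eq_mul, Nat.cast_mul, sub_self]
  rw [blockEntropy, Finset.empty_product]
  ring

/-- A coupled system is compared with uncoupled copies. -/
theorem exists_blockEntropy_le_one {Γ : ℕ} (hΓ : 0 < Γ) (J : Fin Γ → Fin Γ → ℝ≥0)
    (hrow : ∀ r, ∑ c, J r c = Γ) (hcol : ∀ c, ∑ r, J r c = Γ) {δ : ℝ}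
    (hδ : 0 < δ) : ∃ T : ℝ, 0 ≤ T ∧ ∀ ℓ m : ℕ, 0 < ℓ → ∀ σ : ℝ, 0 < σ →
      blockEntropy P₀ hΔ J ∅ ℓ m ≤ Γ * blockEntropy P₀ hΔ (Γ := 1) (fun _ _ => 1) ∅ ℓ m
        + (δ * (Γ * m) + T + 1 * power P₀.atom / (2 * Δ) * (Γ * ((σ + m / σ) / 2))) := by
  have hΓ' : (0 : ℝ) < Γ := by exact_mod_cast hΓ
  have hΓn : (Γ : ℝ≥0) ≠ 0 := by exact_mod_cast hΓ.ne'
  have hJd : ∀ r c, (J r c : ℝ) ≤ Γ := fun r c => by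
    have h := Finset.single_le_sum (f := fun c => J r c) (fun _ _ => zero_le)
      (Finset.mem_univ c)
    rw [hrow] at h
    exact_mod_cast h
  obtain ⟨T, hT0, hT⟩ := exists_prod_rowOp_prior_le P₀ hΔ (c := Γ) hΓ'.le hδ
  refine ⟨T, hT0, fun ℓ m hℓ σ hσ => ?_⟩
  have : Nonempty (Fin Γ × Fin ℓ) := ⟨(⟨0, hΓ⟩, ⟨0, hℓ⟩)⟩
  have hℓn : (ℓ : ℝ≥0) ≠ 0 := by exact_mod_cast hℓ.ne'
  let V : Fin Γ → Fin Γ × Fin ℓ → ℝ≥0 := fun g l => if l.1 = g then 1 / (ℓ : ℝ≥0) else 0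
  let ι : Fin Γ → Fin 1 × Fin ℓ → Fin Γ × Fin ℓ := fun g z => (g, z.2)
  have hι : ∀ g, Function.Injective (ι g) := fun g y z h =>
    Prod.ext (Subsingleton.elim _ _) (congrArg Prod.snd h : (ι g y).2 = (ι g z).2)
  have hV0 : ∀ g (_ : Fin 1), ∀ l ∉ Set.range (ι g), V g l = 0 := fun g _ l hl =>
    if_neg fun h => hl ⟨(0, l.2), Prod.ext h.symm rfl⟩
  have h1 := hT (Fin Γ × Fin ℓ) (Fin Γ × Fin m) (Fin Γ) (fun μ g => J μ.1 g / (Γ : ℝ≥0))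
    V (fun μ => blockVar J ℓ μ.1)
    (fun μ => by rw [← Finset.sum_div, hrow, div_self hΓn])
    (fun μ l => by
      simp only [V, mul_ite, mul_zero, Finset.sum_ite_eq, Finset.mem_univ, if_true, blockVar]
      field_simp)
    (fun μ l => blockVar_mul_card_le hJd hΓ hℓ μ.1 l)
    1 zero_le_one (fun g => by
      rw [Fintype.sum_prod_type, Finset.sum_eq_single g
        (fun r _ hr => Finset.sum_eq_zero fun i _ => by simp [V, hr]) (by simp)]
      simp only [V, if_true, Finset.sum_const, Finset.card_univ, Fintype.card_fin,
        nsmul_eq_mul, NNReal.coe_div, NNReal.coe_natCast, NNReal.coe_one]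
      rw [mul_one_div_cancel]
      exact_mod_cast hℓ.ne') ∅ σ hσ (fun _ => m)
  have h2 := prod_rowOp_le_sum P₀ hΔ hι (fun l => ⟨l.1, (0, l.2), rfl⟩) (V := fun g (_ : Fin 1) => V g)
    hV0 (fun _ _ => m) ∅
  have hVι : ∀ g, (fun j => V g (ι g j)) = blockVar (Γ := 1) (fun _ _ => 1) ℓ 0 := by
    intro g
    funext j
    simp [V, ι, blockVar]
  simp only [Finset.univ_unique, Finset.prod_singleton, hVι] at h2
  rw [prod_fst_eq_prod_pow fun r => rowOp hΔ P₀.atom (blockVar J ℓ r)] at h1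
  have h3 : ∀ g, ∑ μ : Fin Γ × Fin m, ((J μ.1 g / (Γ : ℝ≥0) : ℝ≥0) : ℝ) = m := by
    intro g
    simp only [Fintype.sum_prod_type, Finset.sum_const, Finset.card_univ, Fintype.card_fin,
      nsmul_eq_mul]
    rw [← Finset.mul_sum, ← NNReal.coe_sum, ← Finset.sum_div, hcol, div_self hΓn, NNReal.coe_one,
      mul_one]
  have h4 : blockEntropy P₀ hΔ J ∅ ℓ m = (∏ r, rowOp hΔ P₀.atom (blockVar J ℓ r) ^ m)
      (revealSet ∅ (entropyF _)) (prior P₀ (Fin Γ × Fin ℓ)) := by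
    rw [blockEntropy, Finset.empty_product]
  have h5 : blockEntropy P₀ hΔ (Γ := 1) (fun _ _ => 1) ∅ ℓ m
      = (rowOp hΔ P₀.atom (blockVar (Γ := 1) (fun _ _ => 1) ℓ 0) ^ m)
      (revealSet ∅ (entropyF _)) (prior P₀ (Fin 1 × Fin ℓ)) := by
    rw [blockEntropy, Finset.empty_product]
    simp
  rw [h4]
  refine (h1.trans (add_le_add_left h2 _)).trans (le_of_eq ?_)
  simp only [h3, Fintype.card_prod, Fintype.card_fin, Finset.sum_const, Finset.card_univ,
    nsmul_eq_mul, Nat.cast_mul, sub_self, Finset.preimage_empty]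
  rw [h5]
  ring

end Comparisons

end LinearEstimation

end

noncomputable section

namespace LinearEstimation

section Limits

lemma exists_tendsto_of_eventually_le_add {u : ℕ → ℝ} (h0 : ∀ n, 0 ≤ u n)
    (h : ∀ ε > 0, ∃ k₀, ∀ k ≥ k₀, ∀ᶠ ℓ in atTop, u ℓ ≤ u k + ε) :
    ∃ x, Tendsto u atTop (𝓝 x) := by
  have hb : IsBoundedUnder (· ≥ ·) atTop u := isBoundedUnder_of ⟨0, h0⟩
  have ha : IsBoundedUnder (· ≤ ·) atTop u := by
    obtain ⟨k₀, hk⟩ := h 1 one_pos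
    exact ⟨u k₀ + 1, hk k₀ le_rfl⟩
  refine ⟨limsup u atTop, tendsto_of_le_liminf_of_limsup_le ?_ le_rfl ha hb⟩
  refine le_of_forall_pos_le_add fun ε hε => ?_
  obtain ⟨k₀, hk⟩ := h ε hε
  rw [← sub_le_iff_le_add]
  refine le_liminf_of_le ha.isCoboundedUnder_ge ?_
  filter_upwards [eventually_ge_atTop k₀] with k hk'
  rw [sub_le_iff_le_add]
  exact limsup_le_of_le hb.isCoboundedUnder_le (hk k hk')

variable {B : ℕ} (P₀ : DiscretePrior B) {Δ : ℝ≥0} (hΔ : Δ ≠ 0)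

/-- The remaining entropy per section of a block system with `⌊β ℓ⌋` measurements per block. -/
def entropyRate {Γ : ℕ} (J : Fin Γ → Fin Γ → ℝ≥0) (seed : Finset (Fin Γ)) (β : ℝ) (ℓ : ℕ) : ℝ :=
  blockEntropy P₀ hΔ J seed ℓ ⌊β * ℓ⌋₊ / (Γ * ℓ)

lemma floor_bounds {β : ℝ} (hβ : 0 ≤ β) (ℓ : ℕ) :
    (⌊β * ℓ⌋₊ : ℝ) ≤ β * ℓ ∧ β * ℓ - 1 < (⌊β * ℓ⌋₊ : ℝ) :=
  ⟨Nat.floor_le (by positivity), Nat.sub_one_lt_floor _⟩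

lemma tendsto_blockEntropy_div {Γ : ℕ} (hΓ : 0 < Γ) {J : Fin Γ → Fin Γ → ℝ≥0}
    {seed : Finset (Fin Γ)} {β x : ℝ} (hβ : 0 ≤ β)
    (hx : Tendsto (entropyRate P₀ hΔ J seed β) atTop (𝓝 x))
    {u m : ℕ → ℕ} (hu : Tendsto u atTop atTop)
    (hm : Tendsto (fun i => (m i : ℝ) / u i) atTop (𝓝 β)) :
    Tendsto (fun i => blockEntropy P₀ hΔ J seed (u i) (m i) / (Γ * u i)) atTop (𝓝 x) := by
  have hΓ' : (0 : ℝ) < Γ := by exact_mod_cast hΓ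
  obtain ⟨d, hd, hJ⟩ : ∃ d : ℝ, 0 ≤ d ∧ ∀ r, ∑ c, (J r c : ℝ) ≤ Γ * d := by
    refine ⟨(∑ r, ∑ c, (J r c : ℝ)) / Γ, by positivity, fun r => ?_⟩
    rw [mul_div_cancel₀ _ hΓ'.ne']
    exact Finset.single_le_sum (f := fun r => ∑ c, (J r c : ℝ)) (fun _ _ => by positivity)
      (Finset.mem_univ r)
  have h1 : Tendsto (fun i => (⌊β * u i⌋₊ : ℝ) / u i) atTop (𝓝 β) :=
    (tendsto_nat_floor_mul_div_atTop hβ).comp (tendsto_natCast_atTop_atTop.comp hu)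
  have h2 : Tendsto (fun i => d * power P₀.atom / (2 * Δ) *
      |(m i : ℝ) / u i - (⌊β * u i⌋₊ : ℝ) / u i|) atTop (𝓝 0) := by
    have := ((hm.sub h1).abs).const_mul (d * power P₀.atom / (2 * Δ))
    simpa using this
  have h3 : Tendsto (fun i => blockEntropy P₀ hΔ J seed (u i) (m i) / (Γ * u i)
      - entropyRate P₀ hΔ J seed β (u i)) atTop (𝓝 0) := by
    refine squeeze_zero_norm' ?_ h2
    filter_upwards [hu.eventually_gt_atTop 0] with i hi
    have hi' : (0 : ℝ) < u i := by exact_mod_cast hi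
    rw [entropyRate, ← sub_div, Real.norm_eq_abs, abs_div, abs_of_pos (by positivity : (0 : ℝ) < Γ * u i),
      div_le_iff₀ (by positivity), ← sub_div, abs_div, abs_of_pos hi']
    refine (abs_blockEntropy_sub_le P₀ hΔ hd hJ seed (u i) (m i) ⌊β * u i⌋₊).trans_eq ?_
    field_simp
  have h4 := h3.add (hx.comp hu)
  simpa using h4

/-- The numerical estimate behind the approximate subadditivity of the remaining entropy. -/
lemma subadditivity_error_le {Γ ℓ k m n q s A β δ η ε t b : ℝ} (hΓ : 0 < Γ) (hℓ : 0 < ℓ)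
    (hk : 1 ≤ k) (hA : 0 ≤ A) (hβ : 0 < β) (hη : 0 < η) (hm0 : 0 ≤ m) (hm1 : m ≤ β * ℓ)
    (hm2 : β * ℓ - 1 < m) (hn1 : n ≤ β * k) (hn2 : β * k - 1 < n) (hq0 : 0 ≤ q) (hqk : q * k ≤ ℓ)
    (hs0 : 0 ≤ s) (hsk : s ≤ k) (hkℓ : k ≤ ℓ) (hb : 0 ≤ b) (hδ : δ * β ≤ ε / 4) (hδ0 : 0 ≤ δ)
    (hAη : A * η ≤ ε / 4) (hk' : A * (β + 1) / (2 * η) ≤ k * (ε / 4))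
    (ht : t + A * (Γ * ((η * k + (β * k + (β * k) ^ 2) / (η * k)) / 2)) ≤ Γ * ℓ * (ε / 4)) :
    q * b + δ * (Γ * m) + t
        + A * (Γ * (q * ((η * k + (m * k / ℓ + (m * k / ℓ - n) ^ 2) / (η * k)) / 2)))
        + A * (Γ * ((η * k + (m * s / ℓ + (m * s / ℓ) ^ 2) / (η * k)) / 2))
      ≤ (b / (Γ * k) + ε) * (Γ * ℓ) := by
  have hk0 : 0 < k := by linarith
  have hε : 0 ≤ ε := by
    have : 0 ≤ δ * β := by positivity
    linarith
  have ha1 : m * k / ℓ ≤ β * k := by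
    rw [div_le_iff₀ hℓ]
    calc m * k ≤ β * ℓ * k := by gcongr
      _ = β * k * ℓ := by ring
  have ha2 : β * k - 1 ≤ m * k / ℓ := by
    rw [le_div_iff₀ hℓ]
    have := mul_le_mul_of_nonneg_right hm2.le hk0.le
    linarith
  have ha3 : (m * k / ℓ - n) ^ 2 ≤ 1 := by
    rw [sq_le_one_iff_abs_le_one, abs_le]
    constructor <;> linarith
  have hb1 : m * s / ℓ ≤ β * k := by
    rw [div_le_iff₀ hℓ]
    calc m * s ≤ β * ℓ * k := by gcongr
      _ = β * k * ℓ := by ring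
  have hb0 : 0 ≤ m * s / ℓ := by positivity
  have e1 : (η * k + (m * k / ℓ + (m * k / ℓ - n) ^ 2) / (η * k)) / 2
      ≤ k * ((η + (β + 1) / (η * k)) / 2) := by
    have : (m * k / ℓ + (m * k / ℓ - n) ^ 2) / (η * k) ≤ k * ((β + 1) / (η * k)) := by
      rw [mul_div_assoc']
      gcongr
      linarith
    linarith
  have e2 : (η * k + (m * s / ℓ + (m * s / ℓ) ^ 2) / (η * k)) / 2
      ≤ (η * k + (β * k + (β * k) ^ 2) / (η * k)) / 2 := by gcongr
  have e3 : δ * (Γ * m) ≤ Γ * ℓ * (ε / 4) := by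
    calc δ * (Γ * m) ≤ δ * (Γ * (β * ℓ)) := by gcongr
      _ = Γ * ℓ * (δ * β) := by ring
      _ ≤ Γ * ℓ * (ε / 4) := by gcongr
  have e4 : A * ((η + (β + 1) / (η * k)) / 2) ≤ ε / 2 - ε / 8 := by
    have f : A * ((β + 1) / (η * k) / 2) ≤ ε / 4 := by
      have : A * ((β + 1) / (η * k) / 2) = A * (β + 1) / (2 * η) / k := by field_simp
      rw [this, div_le_iff₀ hk0]
      linarith
    have : A * ((η + (β + 1) / (η * k)) / 2) = A * η / 2 + A * ((β + 1) / (η * k) / 2) := by ring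
    linarith
  have e6 : A * (Γ * (q * ((η * k + (m * k / ℓ + (m * k / ℓ - n) ^ 2) / (η * k)) / 2)))
      ≤ Γ * ℓ * (ε / 2 - ε / 8) := by
    calc A * (Γ * (q * ((η * k + (m * k / ℓ + (m * k / ℓ - n) ^ 2) / (η * k)) / 2)))
        ≤ A * (Γ * (q * (k * ((η + (β + 1) / (η * k)) / 2)))) := by gcongr
      _ = Γ * (q * k) * (A * ((η + (β + 1) / (η * k)) / 2)) := by ring
      _ ≤ Γ * (q * k) * (ε / 2 - ε / 8) := by gcongr
      _ ≤ Γ * ℓ * (ε / 2 - ε / 8) := by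
        refine mul_le_mul_of_nonneg_right ?_ (by linarith)
        gcongr
  have e7 : A * (Γ * ((η * k + (m * s / ℓ + (m * s / ℓ) ^ 2) / (η * k)) / 2))
      ≤ A * (Γ * ((η * k + (β * k + (β * k) ^ 2) / (η * k)) / 2)) := by gcongr
  have e8 : q * b ≤ b / (Γ * k) * (Γ * ℓ) := by
    have : b / (Γ * k) * (Γ * ℓ) = ℓ * b / k := by field_simp
    rw [this, le_div_iff₀ hk0]
    calc q * b * k = q * k * b := by ring
      _ ≤ ℓ * b := by gcongr
  have hp : 0 ≤ Γ * ℓ * ε := by positivity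
  linarith

/-- The remaining entropy per section has a limit. -/
theorem exists_tendsto_entropyRate {Γ : ℕ} (hΓ : 0 < Γ) (J : Fin Γ → Fin Γ → ℝ≥0)
    (seed : Finset (Fin Γ)) {β : ℝ} (hβ : 0 < β) :
    ∃ x, Tendsto (entropyRate P₀ hΔ J seed β) atTop (𝓝 x) := by
  have hΓ' : (0 : ℝ) < Γ := by exact_mod_cast hΓ
  obtain ⟨d, hd, hJ⟩ : ∃ d : ℝ, 0 ≤ d ∧ ∀ r, ∑ c, (J r c : ℝ) ≤ Γ * d := by
    refine ⟨(∑ r, ∑ c, (J r c : ℝ)) / Γ, by positivity, fun r => ?_⟩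
    rw [mul_div_cancel₀ _ hΓ'.ne']
    exact Finset.single_le_sum (f := fun r => ∑ c, (J r c : ℝ)) (fun _ _ => by positivity)
      (Finset.mem_univ r)
  set A := d * power P₀.atom / (2 * Δ) with hA
  have hA0 : 0 ≤ A := by
    have := power_nonneg P₀.atom
    positivity
  refine exists_tendsto_of_eventually_le_add (fun ℓ => div_nonneg (blockEntropy_nonneg P₀ hΔ _ _ _ _)
    (by positivity)) fun ε hε => ?_
  set δ := ε / (4 * β) with hδ
  set η := ε / (4 * (A + 1)) with hη
  have hδ0 : 0 < δ := by positivity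
  have hη0 : 0 < η := by positivity
  have hAη : A * η ≤ ε / 4 := by
    rw [hη, mul_div_assoc', div_le_div_iff₀ (by positivity) (by norm_num)]
    linarith [mul_comm A ε]
  obtain ⟨T, hT0, hT⟩ := exists_blockEntropy_le_copies P₀ hΔ hΓ J seed hd hJ hδ0
  obtain ⟨k₁, hk₁⟩ := exists_nat_gt (A * (β + 1) / (2 * η) / (ε / 4))
  refine ⟨k₁ + 1, fun k hk => ?_⟩
  have hk0 : 0 < k := by omega
  have hk2 : (k₁ : ℝ) ≤ k := by exact_mod_cast (by omega : k₁ ≤ k)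
  have hk' : (1 : ℝ) ≤ k := by exact_mod_cast hk0
  rw [div_lt_iff₀ (by positivity)] at hk₁
  set D := Γ * k * Real.log P₀.n + T
  obtain ⟨ℓ₀, hℓ₀⟩ := exists_nat_gt
    ((D + A * (Γ * ((η * k + (β * k + (β * k) ^ 2) / (η * k)) / 2))) / Γ / (ε / 4))
  rw [div_lt_iff₀ (by positivity), div_lt_iff₀ hΓ'] at hℓ₀
  filter_upwards [eventually_ge_atTop (ℓ₀ + k)] with ℓ hℓ
  have hℓ0 : 0 < ℓ := by omega
  have hℓ' : (0 : ℝ) < ℓ := by exact_mod_cast hℓ0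
  have hl : (ℓ₀ : ℝ) ≤ ℓ := by exact_mod_cast (by omega : ℓ₀ ≤ ℓ)
  have h := hT ℓ k ⌊β * ℓ⌋₊ ⌊β * k⌋₊ hℓ0 hk0 (η * k) (by positivity)
  rw [entropyRate, div_le_iff₀ (by positivity)]
  refine h.trans (le_trans (le_of_eq ?_) (subadditivity_error_le (q := ((ℓ / k : ℕ) : ℝ))
    (s := ((ℓ % k : ℕ) : ℝ)) (m := (⌊β * ℓ⌋₊ : ℕ)) (n := (⌊β * k⌋₊ : ℕ)) (t := D) hΓ' hℓ' hk' hA0 hβ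
    hη0 (Nat.cast_nonneg _) (floor_bounds hβ.le ℓ).1 (floor_bounds hβ.le ℓ).2
    (floor_bounds hβ.le k).1 (floor_bounds hβ.le k).2 (Nat.cast_nonneg _)
    (by exact_mod_cast Nat.div_mul_le_self ℓ k) (Nat.cast_nonneg _)
    (by exact_mod_cast (Nat.mod_lt ℓ hk0).le) (by exact_mod_cast (by omega : k ≤ ℓ))
    (blockEntropy_nonneg P₀ hΔ J seed k ⌊β * k⌋₊) (le_of_eq ?_) hδ0.le hAη ?_ ?_))
  · ring
  · rw [hδ]
    field_simp
  · exact hk₁.le.trans (by gcongr)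
  · calc _ ≤ ℓ₀ * (ε / 4) * Γ := hℓ₀.le
      _ ≤ ℓ * (ε / 4) * Γ := by gcongr
      _ = Γ * ℓ * (ε / 4) := by ring

lemma exists_error_le {Γ : ℕ} (hΓ : 0 < Γ) {A β ε : ℝ} (hA : 0 ≤ A) (hβ : 0 < β) (hε : 0 < ε) :
    ∃ δ > 0, ∃ η > 0, ∀ T : ℝ, 0 ≤ T → ∀ᶠ ℓ : ℕ in atTop,
      (δ * (Γ * (⌊β * ℓ⌋₊ : ℝ)) + T + A * (Γ * ((η * ℓ + (⌊β * ℓ⌋₊ : ℝ) / (η * ℓ)) / 2)))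
        / (Γ * ℓ) ≤ ε := by
  have hΓ' : (0 : ℝ) < Γ := by exact_mod_cast hΓ
  refine ⟨ε / (4 * β), by positivity, ε / (4 * (A + 1)), by positivity, fun T hT => ?_⟩
  set δ := ε / (4 * β) with hδ
  set η := ε / (4 * (A + 1)) with hη
  have hδ0 : 0 < δ := by positivity
  have hη0 : 0 < η := by positivity
  obtain ⟨ℓ₀, hℓ₀⟩ := exists_nat_gt ((T + A * (Γ * (β / η))) / Γ / (ε / 4))
  filter_upwards [eventually_ge_atTop (ℓ₀ + 1)] with ℓ hℓ
  have hℓ' : (0 : ℝ) < ℓ := by exact_mod_cast (by omega : 0 < ℓ)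
  have hl : (ℓ₀ : ℝ) ≤ ℓ := by exact_mod_cast (by omega : ℓ₀ ≤ ℓ)
  obtain ⟨m1, m2⟩ := floor_bounds hβ.le ℓ
  set m : ℝ := ((⌊β * ℓ⌋₊ : ℕ) : ℝ) with hm
  have hm0 : 0 ≤ m := Nat.cast_nonneg _
  rw [div_lt_iff₀ (by positivity), div_lt_iff₀ hΓ'] at hℓ₀
  rw [div_le_iff₀ (by positivity)]
  have e1 : δ * (Γ * m) ≤ Γ * ℓ * (ε / 4) := by
    have : δ * β = ε / 4 := by rw [hδ]; field_simp
    calc δ * (Γ * m) ≤ δ * (Γ * (β * ℓ)) := by gcongr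
      _ = Γ * ℓ * (ε / 4) := by rw [← this]; ring
  have e2 : m / (η * ℓ) ≤ β / η := by
    rw [div_le_div_iff₀ (by positivity) hη0]
    nlinarith
  have e3 : A * (Γ * ((η * ℓ + m / (η * ℓ)) / 2)) ≤ Γ * ℓ * (A * η) + A * (Γ * (β / η)) := by
    have f1 : A * (Γ * ((η * ℓ + m / (η * ℓ)) / 2)) ≤ A * (Γ * ((η * ℓ + β / η) / 2)) := by gcongr
    have f2 : 0 ≤ A * (Γ * (η * ℓ)) := by positivity
    have f3 : 0 ≤ A * (Γ * (β / η)) := by positivity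
    nlinarith
  have e4 : A * η ≤ ε / 4 := by
    rw [hη, mul_div_assoc', div_le_div_iff₀ (by positivity) (by norm_num)]
    nlinarith
  have e5 : Γ * ℓ * (A * η) ≤ Γ * ℓ * (ε / 4) := by gcongr
  have e6 : (ℓ₀ : ℝ) * (ε / 4) * Γ ≤ Γ * ℓ * (ε / 4) := by
    calc (ℓ₀ : ℝ) * (ε / 4) * Γ ≤ ℓ * (ε / 4) * Γ := by gcongr
      _ = Γ * ℓ * (ε / 4) := by ring
  have hp : 0 ≤ Γ * ℓ * ε := by positivity
  nlinarith

/-- Coupled and uncoupled systems have the same limiting entropy. -/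
theorem tendsto_entropyRate_coupled {Γ : ℕ} (hΓ : 0 < Γ) (J : Fin Γ → Fin Γ → ℝ≥0)
    (hrow : ∀ r, ∑ c, J r c = Γ) (hcol : ∀ c, ∑ r, J r c = Γ) {β x : ℝ} (hβ : 0 < β)
    (hx : Tendsto (entropyRate P₀ hΔ (Γ := 1) (fun _ _ => 1) ∅ β) atTop (𝓝 x)) :
    Tendsto (entropyRate P₀ hΔ J ∅ β) atTop (𝓝 x) := by
  have hΓ' : (0 : ℝ) < Γ := by exact_mod_cast hΓ
  have hJ : ∀ r, ∑ c, (J r c : ℝ) ≤ Γ * 1 := fun r => by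
    rw [← NNReal.coe_sum, hrow, mul_one]
    rfl
  have hA0 : 0 ≤ 1 * power P₀.atom / (2 * Δ) := by
    have := power_nonneg P₀.atom
    positivity
  have hΓℓ : Tendsto (fun ℓ : ℕ => Γ * ℓ) atTop atTop :=
    tendsto_id.const_mul_atTop' hΓ
  have hfl : Tendsto (fun ℓ : ℕ => (⌊β * ℓ⌋₊ : ℝ) / ℓ) atTop (𝓝 β) :=
    (tendsto_nat_floor_mul_div_atTop hβ.le).comp tendsto_natCast_atTop_atTop
  have hlow := tendsto_blockEntropy_div P₀ hΔ one_pos hβ.le hx (m := fun ℓ => Γ * ⌊β * ℓ⌋₊) hΓℓ (by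
    refine hfl.congr fun ℓ => ?_
    push_cast
    rw [mul_div_mul_left _ _ hΓ'.ne'])
  refine tendsto_order.2 ⟨fun a ha => ?_, fun a ha => ?_⟩
  · set ε := (x - a) / 2 with hε
    have hε0 : 0 < ε := by rw [hε]; linarith
    obtain ⟨δ, hδ, η, hη, h⟩ := exists_error_le hΓ hA0 hβ hε0
    obtain ⟨T, hT0, hT⟩ := exists_blockEntropy_one_le P₀ hΔ hΓ J zero_le_one hJ hcol hδ
    filter_upwards [h T hT0, hlow.eventually (lt_mem_nhds (show x - ε < x by linarith)),
      eventually_gt_atTop 0] with ℓ h1 h2 hℓ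
    have hℓ' : (0 : ℝ) < ℓ := by exact_mod_cast hℓ
    have h3 := div_le_div_of_nonneg_right (hT ℓ ⌊β * ℓ⌋₊ hℓ (η * ℓ) (by positivity))
      (show (0 : ℝ) ≤ Γ * ℓ by positivity)
    rw [add_div] at h3
    push_cast at h2
    rw [one_mul] at h2
    rw [entropyRate]
    linarith
  · set ε := (a - x) / 2 with hε
    have hε0 : 0 < ε := by rw [hε]; linarith
    obtain ⟨δ, hδ, η, hη, h⟩ := exists_error_le hΓ hA0 hβ hε0
    obtain ⟨T, hT0, hT⟩ := exists_blockEntropy_le_one P₀ hΔ hΓ J hrow hcol hδ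
    filter_upwards [h T hT0, hx.eventually (gt_mem_nhds (show x < x + ε by linarith)),
      eventually_gt_atTop 0] with ℓ h1 h2 hℓ
    have hℓ' : (0 : ℝ) < ℓ := by exact_mod_cast hℓ
    have h3 := div_le_div_of_nonneg_right (hT ℓ ⌊β * ℓ⌋₊ hℓ (η * ℓ) (by positivity))
      (show (0 : ℝ) ≤ Γ * ℓ by positivity)
    rw [add_div, mul_div_mul_left _ _ hΓ'.ne'] at h3
    rw [entropyRate, Nat.cast_one, one_mul] at h2
    rw [entropyRate]
    linarith

end Limits

end LinearEstimation

end

noncomputable section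

namespace LinearEstimation

section Windows

lemma card_cyclic_window {Γ w : ℕ} (h : 2 * w + 1 ≤ Γ) :
    ((Finset.range Γ).filter fun i => i ≤ w ∨ (Γ - i) % Γ ≤ w).card = 2 * w + 1 := by
  have e : (Finset.range Γ).filter (fun i => i ≤ w ∨ (Γ - i) % Γ ≤ w)
      = Finset.range (w + 1) ∪ Finset.Ico (Γ - w) Γ := by
    ext i
    simp only [Finset.mem_filter, Finset.mem_range, Finset.mem_union, Finset.mem_Ico]
    rcases Nat.eq_zero_or_pos i with hi | hi
    · subst hi
      simp only [Nat.sub_zero, Nat.mod_self]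
      omega
    · by_cases hi' : i < Γ
      · rw [Nat.mod_eq_of_lt (by omega : Γ - i < Γ)]
        omega
      · omega
  rw [e, Finset.card_union_of_disjoint, Finset.card_range, Nat.card_Ico]
  · omega
  · rw [Finset.disjoint_left]
    intro i hi hi'
    simp only [Finset.mem_range, Finset.mem_Ico] at hi hi'
    omega

lemma periodicVariance_comm (Γ w : ℕ) (r c : Fin Γ) :
    periodicVariance Γ w r c = periodicVariance Γ w c r := by
  simp only [periodicVariance, or_comm]

lemma sum_periodicVariance {Γ w : ℕ} (h : 2 * w + 1 ≤ Γ) (r : Fin Γ) :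
    ∑ c, periodicVariance Γ w r c = Γ := by
  have : NeZero Γ := ⟨by omega⟩
  rw [← Equiv.sum_comp (Equiv.addLeft r)]
  have e : ∀ d : Fin Γ, periodicVariance Γ w r (Equiv.addLeft r d)
      = if d.val ≤ w ∨ (Γ - d.val) % Γ ≤ w then (Γ : ℝ≥0) / (2 * w + 1) else 0 := fun d => by
    simp only [periodicVariance, Equiv.coe_addLeft, sub_add_cancel_left, add_sub_cancel_left,
      Fin.val_neg', or_comm]
  simp only [e]
  rw [Fin.sum_univ_eq_sum_range
    (fun i => if i ≤ w ∨ (Γ - i) % Γ ≤ w then (Γ : ℝ≥0) / (2 * w + 1) else 0) Γ,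
    ← Finset.sum_filter, Finset.sum_const, card_cyclic_window h, nsmul_eq_mul]
  push_cast
  field_simp

lemma sum_periodicVariance_left {Γ w : ℕ} (h : 2 * w + 1 ≤ Γ) (c : Fin Γ) :
    ∑ r, periodicVariance Γ w r c = Γ := by
  simp only [fun r => periodicVariance_comm Γ w r c, sum_periodicVariance h]

lemma card_window_le {Γ : ℕ} (w : ℕ) (r : Fin Γ) :
    (Finset.univ.filter fun c : Fin Γ => r.val ≤ c.val + w ∧ c.val ≤ r.val + w).card
      ≤ 2 * w + 1 := by
  calc (Finset.univ.filter fun c : Fin Γ => r.val ≤ c.val + w ∧ c.val ≤ r.val + w).card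
      ≤ (Finset.Icc (r.val - w) (r.val + w)).card := by
        refine Finset.card_le_card_of_injOn Fin.val (fun c hc => ?_)
          (Fin.val_injective.injOn)
        simp only [Finset.coe_filter, Finset.mem_univ, true_and, Set.mem_ofPred_eq] at hc
        simp only [Finset.coe_Icc, Set.mem_Icc]
        omega
    _ ≤ 2 * w + 1 := by
        rw [Nat.card_Icc]
        omega

/-- The blocks at distance less than `k` from an end. -/
def boundary (Γ k : ℕ) : Finset (Fin Γ) := Finset.univ.filter fun r => r.val < k ∨ Γ ≤ r.val + k

lemma mem_boundary {Γ k : ℕ} {r : Fin Γ} : r ∈ boundary Γ k ↔ r.val < k ∨ Γ ≤ r.val + k := by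
  simp [boundary]

lemma card_boundary_le (Γ k : ℕ) : (boundary Γ k).card ≤ 2 * k := by
  calc (boundary Γ k).card ≤ (Finset.range k ∪ Finset.Ico (Γ - k) Γ).card := by
        refine Finset.card_le_card_of_injOn Fin.val (fun c hc => ?_) Fin.val_injective.injOn
        rw [Finset.mem_coe, mem_boundary] at hc
        simp only [Finset.coe_union, Finset.coe_range, Finset.coe_Ico, Set.mem_union, Set.mem_Iio,
          Set.mem_Ico]
        omega
    _ ≤ (Finset.range k).card + (Finset.Ico (Γ - k) Γ).card := Finset.card_union_le _ _
    _ ≤ 2 * k := by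
        rw [Finset.card_range, Nat.card_Ico]
        omega

namespace IsSeededDesign

variable {w K Γ : ℕ} {J : Fin Γ → Fin Γ → ℝ≥0} {seed : Finset (Fin Γ)}

lemma card_seed_le (h : IsSeededDesign w K J seed) : seed.card ≤ 2 * K :=
  (Finset.card_le_card fun c hc => mem_boundary.2 (h.seed_boundary c hc)).trans
    (card_boundary_le Γ K)

lemma sum_le (h : IsSeededDesign w K J seed) (r : Fin Γ) : ∑ c, (J r c : ℝ) ≤ Γ * (K : ℝ) := by
  have h1 : ∑ c, (J r c : ℝ)
      = ∑ c with (r.val ≤ c.val + w ∧ c.val ≤ r.val + w), (J r c : ℝ) := by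
    rw [Finset.sum_filter]
    refine Finset.sum_congr rfl fun c _ => ?_
    split_ifs with hc
    · rfl
    · rw [h.outside r c hc, NNReal.coe_zero]
  have h2 : ∀ c, (J r c : ℝ) ≤ K * ((Γ : ℝ) / (2 * w + 1)) := fun c => by
    exact_mod_cast h.bounded r c
  have h3 : ((Finset.univ.filter fun c : Fin Γ => r.val ≤ c.val + w ∧ c.val ≤ r.val + w).card : ℝ)
      ≤ 2 * w + 1 := by exact_mod_cast card_window_le w r
  rw [h1]
  refine (Finset.sum_le_card_nsmul _ _ _ fun c _ => h2 c).trans ?_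
  rw [nsmul_eq_mul]
  refine (mul_le_mul_of_nonneg_right h3 (by positivity)).trans_eq ?_
  field_simp

lemma eq_periodicVariance (h : IsSeededDesign w K J seed) {r : Fin Γ}
    (hr : r ∉ boundary Γ (K + w)) : J r = periodicVariance Γ w r := by
  funext c
  rw [mem_boundary, not_or, not_lt, not_le] at hr
  obtain ⟨h1, h2⟩ := hr
  have hc := c.isLt
  have key : ((r - c).val ≤ w ∨ (c - r).val ≤ w) ↔ (r.val ≤ c.val + w ∧ c.val ≤ r.val + w) := by
    rcases lt_trichotomy c r with hcr | hcr | hcr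
    · rw [Fin.coe_sub_iff_le.2 hcr.le, Fin.coe_sub_iff_lt.2 hcr]
      have : c.val < r.val := hcr
      omega
    · subst hcr
      rw [Fin.coe_sub_iff_le.2 le_rfl]
      omega
    · rw [Fin.coe_sub_iff_le.2 hcr.le, Fin.coe_sub_iff_lt.2 hcr]
      have : r.val < c.val := hcr
      omega
  rw [periodicVariance]
  split_ifs with hw
  · rw [key] at hw
    exact h.bulk r c hw.1 hw.2 (by omega) (by omega)
  · rw [key] at hw
    exact h.outside r c hw

end IsSeededDesign

end Windows

section MutualInformation

variable {B : ℕ} (P₀ : DiscretePrior B)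

section Comparison

variable {Δ : ℝ≥0} (hΔ : Δ ≠ 0)

/-- Revealing some blocks and modifying some rows of blocks have a small effect. -/
lemma abs_blockEntropy_sub_blockEntropy_le {Γ : ℕ} {J J' : Fin Γ → Fin Γ → ℝ≥0} {d : ℝ}
    (hd : 0 ≤ d) (hJ : ∀ r, ∑ c, (J r c : ℝ) ≤ Γ * d) (hJ' : ∀ r, ∑ c, (J' r c : ℝ) ≤ Γ * d)
    {s : Finset (Fin Γ)} (hs : ∀ r ∉ s, J r = J' r) (seed : Finset (Fin Γ)) (ℓ m : ℕ) :
    |blockEntropy P₀ hΔ J seed ℓ m - blockEntropy P₀ hΔ J' ∅ ℓ m|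
      ≤ s.card * (m * (d * power P₀.atom / (2 * Δ))) + seed.card * ℓ * Real.log P₀.n := by
  set G := entropyF (Fin Γ × Fin ℓ → Fin P₀.n)
  set π := prior P₀ (Fin Γ × Fin ℓ)
  set Q := ∏ r ∈ sᶜ, rowOp hΔ P₀.atom (blockVar J ℓ r) ^ m with hQ
  have hQM : Q.IsMarkov := Ops.isMarkov_prod fun r _ => (isMarkov_rowOp hΔ P₀.atom _).pow m
  have hrow : ∀ (J : Fin Γ → Fin Γ → ℝ≥0), (∀ r, ∑ c, (J r c : ℝ) ≤ Γ * d) →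
      IsLoss G (s.card * (m * (d * power P₀.atom / (2 * Δ))))
        (∏ r ∈ s, rowOp hΔ P₀.atom (blockVar J ℓ r) ^ m) := fun J hJ => by
    have := IsLoss.prod (s := s) fun r _ =>
      (isLoss_blockRow P₀ hΔ hd hJ ℓ r (S := 1) Ops.isMarkov_one).pow m
    rw [Finset.sum_const, nsmul_eq_mul] at this
    exact this
  have hseed : IsLoss G (seed.card * ℓ * Real.log P₀.n)
      (revealSet (seed ×ˢ (Finset.univ : Finset (Fin ℓ)))) := by
    have := IsLoss.prod (s := seed ×ˢ (Finset.univ : Finset (Fin ℓ))) fun l _ =>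
      isLoss_reveal (I := Fin P₀.n) l (S := 1) Ops.isMarkov_one
    rw [Finset.sum_const, nsmul_eq_mul, Finset.card_product, Finset.card_univ, Fintype.card_fin,
      Fintype.card_fin, Nat.cast_mul] at this
    exact this
  have e1 : blockEntropy P₀ hΔ J seed ℓ m = (Q * ((∏ r ∈ s, rowOp hΔ P₀.atom (blockVar J ℓ r) ^ m)
      * revealSet (seed ×ˢ (Finset.univ : Finset (Fin ℓ)))) : Ops _) G π := by
    rw [← mul_assoc, Finset.prod_compl_mul_prod]
    rfl
  have e2 : blockEntropy P₀ hΔ J' ∅ ℓ m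
      = (Q * ∏ r ∈ s, rowOp hΔ P₀.atom (blockVar J' ℓ r) ^ m) G π := by
    have : Q = ∏ r ∈ sᶜ, rowOp hΔ P₀.atom (blockVar J' ℓ r) ^ m :=
      Finset.prod_congr rfl fun r hr => by
        have : blockVar J ℓ r = blockVar J' ℓ r := by
          funext l
          rw [blockVar, blockVar, hs r (Finset.mem_compl.1 hr)]
        rw [this]
    rw [this, Finset.prod_compl_mul_prod, blockEntropy, Finset.empty_product]
    rfl
  have h1 := ((hrow J hJ).mul hseed).le Q hQM π
  have h2 := ((hrow J hJ).mul hseed).le_add Q hQM π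
  have h3 := (hrow J' hJ').le Q hQM π
  have h4 := (hrow J' hJ').le_add Q hQM π
  have hπ : mass π = 1 := mass_prior P₀
  rw [hπ, mul_one, ← e1] at h2
  rw [hπ, mul_one, ← e2] at h4
  rw [← e1] at h1
  rw [← e2] at h3
  have h5 : 0 ≤ seed.card * ℓ * Real.log P₀.n :=
    mul_nonneg (by positivity) (Real.log_natCast_nonneg _)
  rw [abs_le]
  constructor <;> linarith

lemma abs_limit_sub_limit_le {w K Γ : ℕ} (hw : 2 * w + 1 ≤ Γ) {J : Fin Γ → Fin Γ → ℝ≥0}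
    {seed : Finset (Fin Γ)} (h : IsSeededDesign w K J seed) {β x y : ℝ} (hβ : 0 < β)
    (hx : Tendsto (entropyRate P₀ hΔ (periodicVariance Γ w) ∅ β) atTop (𝓝 x))
    (hy : Tendsto (entropyRate P₀ hΔ J seed β) atTop (𝓝 y)) :
    |y - x| ≤ (2 * (K + w) * (β * ((K + 1) * power P₀.atom / (2 * Δ)))
      + 2 * K * Real.log P₀.n) / Γ := by
  have hΓ' : (0 : ℝ) < Γ := by exact_mod_cast (by omega : 0 < Γ)
  have hA := power_nonneg P₀.atom
  have hlog := Real.log_natCast_nonneg P₀.n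
  refine le_of_tendsto (hy.sub hx).abs ?_
  filter_upwards [eventually_gt_atTop 0] with ℓ hℓ
  have hℓ' : (0 : ℝ) < ℓ := by exact_mod_cast hℓ
  have h1 : ∀ r, ∑ c, (J r c : ℝ) ≤ Γ * ((K : ℝ) + 1) := fun r =>
    (h.sum_le r).trans (by gcongr; linarith)
  have h2 : ∀ r, ∑ c, (periodicVariance Γ w r c : ℝ) ≤ Γ * ((K : ℝ) + 1) := fun r => by
    rw [← NNReal.coe_sum, sum_periodicVariance hw, NNReal.coe_natCast]
    nlinarith [Nat.cast_nonneg (α := ℝ) K]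
  have h3 := abs_blockEntropy_sub_blockEntropy_le P₀ hΔ (by positivity) h1 h2
    (fun r hr => h.eq_periodicVariance hr) seed ℓ ⌊β * ℓ⌋₊
  have h4 : ((boundary Γ (K + w)).card : ℝ) ≤ 2 * (K + w) := by
    exact_mod_cast card_boundary_le Γ (K + w)
  have h5 : (seed.card : ℝ) ≤ 2 * K := by exact_mod_cast h.card_seed_le
  have h6 := (floor_bounds hβ.le ℓ).1
  rw [entropyRate, entropyRate, ← sub_div, abs_div, abs_of_pos (by positivity : (0 : ℝ) < Γ * ℓ),
    div_le_div_iff₀ (by positivity) hΓ']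
  calc _ ≤ (2 * (K + w) * (β * ℓ * ((K + 1) * power P₀.atom / (2 * Δ)))
        + 2 * K * ℓ * Real.log P₀.n) * Γ := by
        refine mul_le_mul_of_nonneg_right (h3.trans ?_) hΓ'.le
        gcongr
    _ = _ := by ring

end Comparison

variable {Δ : ℝ} (hΔ : 0 < Δ)

lemma tendsto_blockMI {Γ : ℕ} (hΓ : 0 < Γ) {J : Fin Γ → Fin Γ → ℝ≥0} {seed : Finset (Fin Γ)}
    {β x : ℝ} (hβ : 0 ≤ β)
    (hx : Tendsto (entropyRate P₀ (toNNReal_ne_zero hΔ) J seed β) atTop (𝓝 x))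
    {m : ℕ → ℕ} (hm : Tendsto (fun ℓ => (m ℓ : ℝ) / ℓ) atTop (𝓝 β)) :
    Tendsto (fun ℓ => blockMI P₀ Δ J seed ℓ (m ℓ)) atTop
      (𝓝 ((Γ - seed.card) / Γ * sectionEntropy P₀ - x)) := by
  have hΓ' : (0 : ℝ) < Γ := by exact_mod_cast hΓ
  have h := tendsto_blockEntropy_div P₀ (toNNReal_ne_zero hΔ) hΓ hβ hx tendsto_id hm
  refine (h.const_sub ((Γ - seed.card) / Γ * sectionEntropy P₀)).congr' ?_
  filter_upwards [eventually_gt_atTop 0] with ℓ hℓ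
  have hℓ' : (0 : ℝ) < ℓ := by exact_mod_cast hℓ
  rw [blockMI_eq P₀ hΔ, id]
  field_simp

lemma tendsto_csMI {β x : ℝ} (hβ : 0 ≤ β)
    (hx : Tendsto (entropyRate P₀ (toNNReal_ne_zero hΔ) (Γ := 1) (fun _ _ => 1) ∅ β) atTop (𝓝 x))
    {M : ℕ → ℕ} (hM : Tendsto (fun L => (M L : ℝ) / L) atTop (𝓝 β)) :
    Tendsto (fun L => csMI P₀ Δ L (M L)) atTop (𝓝 (sectionEntropy P₀ - x)) := by
  have h := tendsto_blockEntropy_div P₀ (toNNReal_ne_zero hΔ) one_pos hβ hx tendsto_id hM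
  refine (h.const_sub (sectionEntropy P₀)).congr' ?_
  filter_upwards [eventually_gt_atTop 0] with L hL
  have hL' : (0 : ℝ) < L := by exact_mod_cast hL
  rw [csMI_eq P₀ hΔ, id, Nat.cast_one]
  field_simp

lemma tendsto_measurement_rate {B : ℕ} (hB : 0 < B) {α : ℝ} {m : ℕ → ℕ}
    (h : Tendsto (fun L : ℕ => (m L : ℝ) / (L * B)) atTop (𝓝 α)) :
    Tendsto (fun L : ℕ => (m L : ℝ) / L) atTop (𝓝 (α * B)) := by
  have hB' : (0 : ℝ) < B := by exact_mod_cast hB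
  refine (h.mul_const (B : ℝ)).congr fun L => ?_
  rw [← div_div, div_mul_cancel₀ _ hB'.ne']

end MutualInformation

end LinearEstimation

end

theorem lemma4 {B : ℕ} (hB : 0 < B) (P₀ : DiscretePrior B) {α Δ : ℝ} (hα : 0 < α) (hΔ : 0 < Δ) :
    ∃ iLim : ℝ,
      (∀ M : ℕ → ℕ, Tendsto (fun L : ℕ => (M L : ℝ) / (L * B)) atTop (𝓝 α) →
        Tendsto (fun L : ℕ => csMI P₀ Δ L (M L)) atTop (𝓝 iLim)) ∧
      (∀ Γ w : ℕ, 2 * w + 1 ≤ Γ →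
        ∀ m : ℕ → ℕ, Tendsto (fun ℓ : ℕ => (Γ * m ℓ : ℝ) / (Γ * ℓ * B)) atTop (𝓝 α) →
          Tendsto (fun ℓ : ℕ => periodicMI P₀ Δ Γ w ℓ (m ℓ)) atTop (𝓝 iLim)) ∧
      (∀ (w K : ℕ) (J : ∀ Γ : ℕ, Fin Γ → Fin Γ → ℝ≥0) (seed : ∀ Γ : ℕ, Finset (Fin Γ)),
        (∀ Γ : ℕ, 2 * w + 1 ≤ Γ → IsSeededDesign w K (J Γ) (seed Γ)) →
        ∃ iSeed : ℕ → ℝ,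
          (∀ Γ : ℕ, 2 * w + 1 ≤ Γ →
            ∀ m : ℕ → ℕ, Tendsto (fun ℓ : ℕ => (Γ * m ℓ : ℝ) / (Γ * ℓ * B)) atTop (𝓝 α) →
              Tendsto (fun ℓ : ℕ => blockMI P₀ Δ (J Γ) (seed Γ) ℓ (m ℓ)) atTop
                (𝓝 (iSeed Γ))) ∧
          Tendsto iSeed atTop (𝓝 iLim)) := by
  have hB' : (0 : ℝ) < B := by exact_mod_cast hB
  have hβ : 0 < α * B := mul_pos hα hB'
  have hΔ' := toNNReal_ne_zero hΔ
  obtain ⟨x, hx⟩ := exists_tendsto_entropyRate P₀ hΔ' one_pos (fun _ _ => 1) ∅ hβ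
  have hper : ∀ Γ w : ℕ, 2 * w + 1 ≤ Γ →
      Tendsto (entropyRate P₀ hΔ' (periodicVariance Γ w) ∅ (α * B)) atTop (𝓝 x) := fun Γ w hw =>
    tendsto_entropyRate_coupled P₀ hΔ' (by omega) _ (sum_periodicVariance hw)
      (sum_periodicVariance_left hw) hβ hx
  have hrate : ∀ Γ : ℕ, 0 < Γ → ∀ m : ℕ → ℕ,
      Tendsto (fun ℓ : ℕ => (Γ * m ℓ : ℝ) / (Γ * ℓ * B)) atTop (𝓝 α) →
        Tendsto (fun ℓ : ℕ => (m ℓ : ℝ) / ℓ) atTop (𝓝 (α * B)) := fun Γ hΓ m hm => by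
    have hΓ' : (Γ : ℝ) ≠ 0 := by exact_mod_cast hΓ.ne'
    refine tendsto_measurement_rate hB (hm.congr fun ℓ => ?_)
    rw [mul_assoc, mul_div_mul_left _ _ hΓ']
  refine ⟨sectionEntropy P₀ - x,
    fun M hM => tendsto_csMI P₀ hΔ hβ.le hx (tendsto_measurement_rate hB hM),
    fun Γ w hw m hm => ?_, fun w K J seed hJ => ?_⟩
  · have hΓ : 0 < Γ := by omega
    have hΓ' : (Γ : ℝ) ≠ 0 := by exact_mod_cast hΓ.ne'
    have h := tendsto_blockMI P₀ hΔ hΓ hβ.le (hper Γ w hw) (hrate Γ hΓ m hm)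
    rwa [Finset.card_empty, Nat.cast_zero, sub_zero, div_self hΓ', one_mul] at h
  · have hy : ∀ Γ : ℕ, ∃ y, 2 * w + 1 ≤ Γ →
        Tendsto (entropyRate P₀ hΔ' (J Γ) (seed Γ) (α * B)) atTop (𝓝 y) := fun Γ => by
      by_cases h : 2 * w + 1 ≤ Γ
      · obtain ⟨y, hy⟩ := exists_tendsto_entropyRate P₀ hΔ' (by omega) (J Γ) (seed Γ) hβ
        exact ⟨y, fun _ => hy⟩
      · exact ⟨0, fun h' => absurd h' h⟩
    choose y hy using hy
    refine ⟨fun Γ => (Γ - (seed Γ).card) / Γ * sectionEntropy P₀ - y Γ, fun Γ hw m hm =>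
      tendsto_blockMI P₀ hΔ (by omega) hβ.le (hy Γ hw) (hrate Γ (by omega) m hm), ?_⟩
    have hinv : ∀ D : ℝ, Tendsto (fun Γ : ℕ => D / (Γ : ℝ)) atTop (𝓝 0) := fun D =>
      tendsto_const_nhds.div_atTop tendsto_natCast_atTop_atTop
    have h1 : Tendsto y atTop (𝓝 x) := by
      rw [tendsto_iff_norm_sub_tendsto_zero]
      refine squeeze_zero' (Eventually.of_forall fun _ => norm_nonneg _) ?_
        (hinv (2 * (K + w) * (α * B * ((K + 1) * power P₀.atom / (2 * Δ.toNNReal)))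
          + 2 * K * Real.log P₀.n))
      filter_upwards [eventually_ge_atTop (2 * w + 1)] with Γ hw
      exact abs_limit_sub_limit_le P₀ hΔ' hw (hJ Γ hw) hβ (hper Γ w hw) (hy Γ hw)
    have h2 : Tendsto (fun Γ : ℕ => ((seed Γ).card : ℝ) / Γ) atTop (𝓝 0) := by
      refine squeeze_zero' (Eventually.of_forall fun _ => by positivity) ?_ (hinv (2 * K))
      filter_upwards [eventually_ge_atTop (2 * w + 1)] with Γ hw
      have : ((seed Γ).card : ℝ) ≤ 2 * K := by exact_mod_cast (hJ Γ hw).card_seed_le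
      gcongr
    have h3 := ((h2.const_sub 1).mul_const (sectionEntropy P₀)).sub h1
    rw [sub_zero, one_mul] at h3
    refine h3.congr' ?_
    filter_upwards [eventually_gt_atTop 0] with Γ hΓ
    have hΓ' : (Γ : ℝ) ≠ 0 := by exact_mod_cast hΓ.ne'
    rw [sub_div, div_self hΓ']
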